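/- \textbf{Setting.} Let $T>0$, let $X$ be a finite-dimensional real normed space with dual $X^*$, and let $\Psi_0:X\to[0,\infty)$ be a gauge: $\Psi_0(v)>0$ for $v\ne0$, $\Psi_0(v_1+v_2)\le\Psi_0(v_1)+\Psi_0(v_2)$, $\Psi_0(\lambda v)=\lambda\Psi_0(v)$ for $\lambda\ge0$. Put $K^*=\{w\in X^*:\langle w,z\rangle\le\Psi_0(z)\ \forall z\in X\}$ and let $I_{K^*}$ be its indicator function ($0$ on $K^*$, $+\infty$ elsewhere). Let $\Psi:X\to[0,\infty)$ be convex with $\Psi(0)=0$, $\Psi(v)/\|v\|\to+\infty$ as $\|v\|\to\infty$, and $\Psi_0(v)=\lim_{\varepsilon\downarrow0}\varepsilon^{-1}\Psi(\varepsilon v)$ for every $v$; let $\Psi^*$ be its conjugate. Let $\mathcal E\in C^1([0,T]\times X)$ satisfy, for some $C>0$, $\mathcal E_t(x)\ge -C$ and $|\partial_t\mathcal E_t(x)|\le C(1+\mathcal E_t(x)^+)$ for all $(t,x)$. Define $$\mathfrak p(v,w)=\inf_{\varepsilon>0}\big(\varepsilon^{-1}\Psi(\varepsilon v)+\varepsilon^{-1}\Psi^*(w)\big),$$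 $$\mathcal B_0\big((t,x);(\alpha,v)\big)=\begin{cases}\Psi_0(v)+I_{K^*}(-\mathrm D\mathcal E_t(x)),&\alpha>0,\\ \mathfrak p(v,-\mathrm D\mathcal E_t(x)),&\alpha=0.\end{cases}$$ \emph{Costs.} For $t\in[0,T]$ and $x_0,x_1\in X$, $$\Delta_{\mathfrak p,\mathcal E}(t;x_0,x_1)=\inf\Big\{\int_{r_0}^{r_1}\mathfrak p(\dot\vartheta,-\mathrm D\mathcal E_t(\vartheta))\,dr:\ \vartheta\in AC([r_0,r_1];X),\ \vartheta(r_0)=x_0,\ \vartheta(r_1)=x_1\Big\},$$ and $\Delta_{\mathcal B_0}\big((t_0,x_0),(t_1,x_1)\big)$ is the infimum of $\int_{r_0}^{r_1}\mathcal B_0\big((\mathsf t,\mathsf u);(\dot{\mathsf t},\dot{\mathsf u})\big)\,dr$ over all Lipschitz curves $(\mathsf t,\mathsf u):[r_0,r_1]\to[0,T]\times X$ from $(t_0,x_0)$ to $(t_1,x_1)$ with $\dot{\mathsf t}\ge0$ a.e. (so it is $+\infty$ if $t_0>t_1$). \emph{Variations.} For $u:[0,T]\to X$ and $0\le a\le b\le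 T$, $$\mathrm{Var}_{\mathcal B_0}(u;[a,b])=\sup\Big\{\sum_{m=1}^M\Delta_{\mathcal B_0}\big((s_{m-1},u(s_{m-1})),(s_m,u(s_m))\big):\ a=s_0<\dots<s_M=b\Big\}.$$ For $u\in BV([0,T];X)$ (defined at every point, with finite pointwise variation) let $u(t_\pm)$ be the one-sided limits, with $u(0_-)=u(0)$ and $u(T_+)=u(T)$, let $J_u=\{t\in[0,T]:u(t_-)\ne u(t)\text{ or }u(t)\ne u(t_+)\}$, let $u'_{\rm co}$ be the diffuse part of the distributional derivative of $u$ on $(0,T)$, and let $\mu$ be a finite nonnegative diffuse measure on $(0,T)$ with $\mathcal L^1\ll\mu$ and $u'_{\rm co}\ll\mu$ (the choice of $\mu$ is immaterial). For $a<b$ set $$\mathrm{Var}_{\mathfrak p,\mathcal E}(u;[a,b])=\int_{(a,b)}\Psi_0\Big(\frac{du'_{\rm co}}{d\mu}\Big)d\mu+\Delta_{\mathfrak p,\mathcal E}(a;u(a),u(a_+))+\Delta_{\mathfrak p,\mathcal E}(b;u(b_-),u(b))$$ $$\qquad+\sum_{t\in J_u\cap(a,b)}\big(\Delta_{\mathfrak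 p,\mathcal E}(t;u(t_-),u(t))+\Delta_{\mathfrak p,\mathcal E}(t;u(t),u(t_+))\big),$$ and $\mathrm{Var}_{\mathfrak p,\mathcal E}(u;[a,a])=0$. We say that $u$ is \emph{locally stable} on $I\subset[0,T]$ if $-\mathrm D\mathcal E_t(u(t))\in K^*$ for a.e. $t\in I\setminus J_u$. A curve $u$ is a \emph{BV solution} if $u\in BV([0,T];X)$, $u$ is locally stable on $[0,T]$, and $\mathrm{Var}_{\mathfrak p,\mathcal E}(u;[0,t])+\mathcal E_t(u(t))=\mathcal E_0(u(0))+\int_0^t\partial_t\mathcal E_s(u(s))\,ds$ for every $t\in[0,T]$. \textbf{Theorem.} (A) For every $u\in BV([0,T];X)$ and every $[a,b]\subset[0,T]$: \begin{enumerate} \item $\mathrm{Var}_{\mathfrak p,\mathcal E}(u;[a,b])\le\mathrm{Var}_{\mathcal B_0}(u;[a,b])$; \item equality holds in (1) if and only if $u$ is locally stable on $(a,b)$; \item if $\mathrm{Var}_{\mathcal B_0}(u;[a,b])<+\infty$, then $u$ is locally stable on $(a,b)$. \end{enumerate} (B) For every curve $u:[0,T]\to X$ (not assumed to be BV), $u$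 is a BV solution if and only if $$\mathrm{Var}_{\mathcal B_0}(u;[t_0,t_1])+\mathcal E_{t_1}(u(t_1))=\mathcal E_{t_0}(u(t_0))+\int_{t_0}^{t_1}\partial_t\mathcal E_t(u(t))\,dt\quad\text{for all }0\le t_0\le t_1\le T,$$ and also if and only if $$\mathrm{Var}_{\mathcal B_0}(u;[0,T])+\mathcal E_T(u(T))\le\mathcal E_0(u(0))+\int_0^T\partial_t\mathcal E_s(u(s))\,ds.$$ In particular both conditions include $\mathrm{Var}_{\mathcal B_0}(u;[0,T])<+\infty$, which already forces $u\in BV([0,T];X)$ (so that the integrals make sense). -/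

import Mathlib

open Set Filter Topology MeasureTheory
open scoped ENNReal NNReal

noncomputable section

namespace RateIndep

/-! ### Standing assumptions on the data -/

/-- `Ψ₀ : X → [0,∞)` is a gauge: non-degenerate, positively `1`-homogeneous and subadditive
(hence convex). -/
structure IsGauge {X : Type*} [NormedAddCommGroup X] [NormedSpace ℝ X] (Ψ₀ : X → ℝ) : Prop where
  nonneg : ∀ v, 0 ≤ Ψ₀ v
  pos : ∀ v, v ≠ 0 → 0 < Ψ₀ v
  add_le : ∀ v₁ v₂, Ψ₀ (v₁ + v₂) ≤ Ψ₀ v₁ + Ψ₀ v₂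
  smul_eq : ∀ (c : ℝ) (v : X), 0 ≤ c → Ψ₀ (c • v) = c * Ψ₀ v

/-- `Ψ : X → [0,∞)` is convex with `Ψ 0 = 0` and superlinear growth, and its rescalings
`Ψ_ε v = ε⁻¹ Ψ (ε v)` converge pointwise to `Ψ₀` as `ε ↓ 0`. -/
structure IsViscousPotential {X : Type*} [NormedAddCommGroup X] [NormedSpace ℝ X]
    (Ψ₀ Ψ : X → ℝ) : Prop where
  nonneg : ∀ v, 0 ≤ Ψ v
  convex : ConvexOn ℝ univ Ψ
  map_zero : Ψ 0 = 0
  superlinear : Tendsto (fun v => Ψ v / ‖v‖) (Bornology.cobounded X) atTop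
  tendsto_gauge : ∀ v, Tendsto (fun ε : ℝ => ε⁻¹ * Ψ (ε • v)) (𝓝[>] 0) (𝓝 (Ψ₀ v))

/-- The partial time derivative `∂ₜ E_t(x)` for `t ∈ [0,T]` (one-sided at the end points). -/
def dtE {X : Type*} (T : ℝ) (E : ℝ → X → ℝ) (t : ℝ) (x : X) : ℝ :=
  derivWithin (fun s => E s x) (Icc 0 T) t

/-- `E ∈ C¹([0,T] × X)`, bounded from below, with energy-bounded time derivative. -/
structure IsAdmissibleEnergy {X : Type*} [NormedAddCommGroup X] [NormedSpace ℝ X]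
    (T : ℝ) (E : ℝ → X → ℝ) : Prop where
  contDiffOn : ContDiffOn ℝ 1 (fun q : ℝ × X => E q.1 q.2) (Icc 0 T ×ˢ univ)
  bounds : ∃ C : ℝ, 0 < C ∧ ∀ t ∈ Icc 0 T, ∀ x : X,
    -C ≤ E t x ∧ |dtE T E t x| ≤ C * (1 + max (E t x) 0)

/-! ### Potentials -/

/-- The dual convex set `K* = {w ∈ X* : ⟨w, z⟩ ≤ Ψ₀ z for all z}`. -/
def stableSet {X : Type*} [NormedAddCommGroup X] [NormedSpace ℝ X] (Ψ₀ : X → ℝ) :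
    Set (X →L[ℝ] ℝ) :=
  {w | ∀ z, w z ≤ Ψ₀ z}

/-- The conjugate `Ψ* w = sup_v (⟨w, v⟩ - Ψ v)`; the supremum is finite as `Ψ` is superlinear. -/
def conj {X : Type*} [NormedAddCommGroup X] [NormedSpace ℝ X] (Ψ : X → ℝ) (w : X →L[ℝ] ℝ) : ℝ :=
  ⨆ v : X, (w v - Ψ v)

/-- The vanishing viscosity contact potential
`𝔭(v,w) = inf_{ε > 0} (ε⁻¹ Ψ(ε v) + ε⁻¹ Ψ*(w))`. -/
def contactPotential {X : Type*} [NormedAddCommGroup X] [NormedSpace ℝ X] (Ψ : X → ℝ)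
    (v : X) (w : X →L[ℝ] ℝ) : ℝ :=
  ⨅ ε : Ioi (0 : ℝ), ((ε : ℝ)⁻¹ * Ψ ((ε : ℝ) • v) + (ε : ℝ)⁻¹ * conj Ψ w)

open Classical in
/-- The augmented space-time contact potential `𝔓(α,v;p,w)` at `p = 0`, for `α ≥ 0`:
`Ψ₀(v) + I_{K*}(w)` if `α > 0`, and `𝔭(v,w)` if `α = 0`. -/
def augmentedPotential {X : Type*} [NormedAddCommGroup X] [NormedSpace ℝ X] (Ψ₀ Ψ : X → ℝ)
    (α : ℝ) (v : X) (w : X →L[ℝ] ℝ) : ℝ≥0∞ :=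
  if 0 < α then ENNReal.ofReal (Ψ₀ v) + (if w ∈ stableSet Ψ₀ then 0 else ⊤)
  else ENNReal.ofReal (contactPotential Ψ v w)

/-- The dissipation `B₀((t,x);(α,v)) = 𝔓(α,v;0,-D E_t(x))`. -/
def dissipationB0 {X : Type*} [NormedAddCommGroup X] [NormedSpace ℝ X] (Ψ₀ Ψ : X → ℝ)
    (E : ℝ → X → ℝ) (t : ℝ) (x : X) (α : ℝ) (v : X) : ℝ≥0∞ :=
  augmentedPotential Ψ₀ Ψ α v (-fderiv ℝ (E t) x)

/-! ### Costs -/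

/-- The Finsler cost `Δ_{𝔭,E}(t;x₀,x₁)`: infimum of `∫ 𝔭(θ'(r), -D E_t(θ(r))) dr` over absolutely
continuous curves `θ : [r₀,r₁] → X` joining `x₀` to `x₁`. -/
def finslerCost {X : Type*} [NormedAddCommGroup X] [NormedSpace ℝ X] (Ψ : X → ℝ)
    (E : ℝ → X → ℝ) (t : ℝ) (x₀ x₁ : X) : ℝ≥0∞ :=
  ⨅ (r₀ : ℝ) (r₁ : ℝ) (θ : ℝ → X) (_ : r₀ < r₁ ∧ AbsolutelyContinuousOnInterval θ r₀ r₁ ∧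
      θ r₀ = x₀ ∧ θ r₁ = x₁),
    ∫⁻ r in Ioo r₀ r₁,
      ENNReal.ofReal (contactPotential Ψ (deriv θ r) (-fderiv ℝ (E t) (θ r)))

/-- `(τ, y)` is a Lipschitz curve `[r₀,r₁] → [0,T] × X` from `(t₀,x₀)` to `(t₁,x₁)` with
`τ' ≥ 0` almost everywhere. -/
structure IsAdmissibleCurve {X : Type*} [NormedAddCommGroup X] [NormedSpace ℝ X] (T : ℝ)
    (t₀ : ℝ) (x₀ : X) (t₁ : ℝ) (x₁ : X) (r₀ r₁ : ℝ) (τ : ℝ → ℝ) (y : ℝ → X) : Prop where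
  lt : r₀ < r₁
  lipschitz_time : ∃ L : ℝ≥0, LipschitzOnWith L τ (Icc r₀ r₁)
  lipschitz_space : ∃ L : ℝ≥0, LipschitzOnWith L y (Icc r₀ r₁)
  mem_Icc : ∀ r ∈ Icc r₀ r₁, τ r ∈ Icc 0 T
  deriv_nonneg : ∀ᵐ r ∂(volume.restrict (Ioo r₀ r₁)), 0 ≤ deriv τ r
  time_left : τ r₀ = t₀
  space_left : y r₀ = x₀
  time_right : τ r₁ = t₁
  space_right : y r₁ = x₁

/-- The pseudo-Finsler distance `Δ_{B₀}((t₀,x₀),(t₁,x₁))` on `[0,T] × X`. For `t₀ > t₁` there is no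
admissible curve and the value is `+∞`. -/
def distB0 {X : Type*} [NormedAddCommGroup X] [NormedSpace ℝ X] (T : ℝ) (Ψ₀ Ψ : X → ℝ)
    (E : ℝ → X → ℝ) (t₀ : ℝ) (x₀ : X) (t₁ : ℝ) (x₁ : X) : ℝ≥0∞ :=
  ⨅ (r₀ : ℝ) (r₁ : ℝ) (τ : ℝ → ℝ) (y : ℝ → X)
      (_ : IsAdmissibleCurve T t₀ x₀ t₁ x₁ r₀ r₁ τ y),
    ∫⁻ r in Ioo r₀ r₁, dissipationB0 Ψ₀ Ψ E (τ r) (y r) (deriv τ r) (deriv y r)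

/-- The total variation `Var_{B₀}(u;[a,b])`: supremum over the partitions
`a = s₀ < s₁ < ⋯ < s_M = b` of `∑ Δ_{B₀}((s_m,u(s_m)),(s_{m+1},u(s_{m+1})))`. -/
def varB0 {X : Type*} [NormedAddCommGroup X] [NormedSpace ℝ X] (T : ℝ) (Ψ₀ Ψ : X → ℝ)
    (E : ℝ → X → ℝ) (u : ℝ → X) (a b : ℝ) : ℝ≥0∞ :=
  ⨆ (M : ℕ) (s : ℕ → ℝ) (_ : StrictMonoOn s (Iic M) ∧ s 0 = a ∧ s M = b),
    ∑ m ∈ Finset.range M, distB0 T Ψ₀ Ψ E (s m) (u (s m)) (s (m + 1)) (u (s (m + 1)))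

/-! ### Curves of bounded variation and the variation induced by `(𝔭, E)`

A curve `[0,T] → X` is represented by a function `u : ℝ → X`, of which only the values on `[0,T]`
are used. It belongs to `BV([0,T];X)` if `BoundedVariationOn u (Icc 0 T)`. -/

/-- The extension of `u|_{[0,T]}` to `ℝ` by the constants `u 0` and `u T`. -/
def constExtend {X : Type*} (T : ℝ) (u : ℝ → X) (t : ℝ) : X := u (max 0 (min t T))

theorem constExtend_of_mem {X : Type*} {T : ℝ} (u : ℝ → X) {t : ℝ} (ht : t ∈ Icc 0 T) :
    constExtend T u t = u t := by
  simp [constExtend, ht.1, ht.2]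

theorem boundedVariationOn_constExtend {X : Type*} [NormedAddCommGroup X] {T : ℝ} (hT : 0 < T)
    {u : ℝ → X} (hu : BoundedVariationOn u (Icc 0 T)) :
    BoundedVariationOn (constExtend T u) univ := by
  have h : eVariationOn (u ∘ fun t : ℝ => max 0 (min t T)) univ ≤ eVariationOn u (Icc 0 T) := by
    apply eVariationOn.comp_le_of_monotoneOn
    · intro x _ y _ hxy
      exact max_le_max le_rfl (min_le_min hxy le_rfl)
    · intro x _
      exact ⟨le_max_left _ _, max_le hT.le (min_le_right _ _)⟩
  exact ne_top_of_le_ne_top hu h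

/-- `u(t₋)` for `t ∈ [0,T]`, with the convention `u(0₋) = u(0)`. -/
def left {X : Type*} [TopologicalSpace X] (T : ℝ) (u : ℝ → X) (t : ℝ) : X :=
  Function.leftLim (constExtend T u) t

/-- `u(t₊)` for `t ∈ [0,T]`, with the convention `u(T₊) = u(T)`. -/
def right {X : Type*} [TopologicalSpace X] (T : ℝ) (u : ℝ → X) (t : ℝ) : X :=
  Function.rightLim (constExtend T u) t

/-- The pointwise jump set `J_u`. -/
def jumpSet {X : Type*} [TopologicalSpace X] (T : ℝ) (u : ℝ → X) : Set ℝ :=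
  {t | t ∈ Icc 0 T ∧ (left T u t ≠ u t ∨ u t ≠ right T u t)}

open Classical in
/-- The distributional derivative of (the extension of) `u`, as an `X`-valued measure. -/
def derivMeasure {X : Type*} [NormedAddCommGroup X] [NormedSpace ℝ X] [FiniteDimensional ℝ X]
    (T : ℝ) (u : ℝ → X) : VectorMeasure ℝ X :=
  haveI : CompleteSpace X := FiniteDimensional.complete ℝ X
  if h : BoundedVariationOn (constExtend T u) univ then h.vectorMeasure else 0

/-- The diffuse part `u'_co` of the distributional derivative of `u` in `(0,T)`: the restriction of
the derivative to the complement of the (countable) jump set. -/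
def diffuseDeriv {X : Type*} [NormedAddCommGroup X] [NormedSpace ℝ X] [FiniteDimensional ℝ X]
    (T : ℝ) (u : ℝ → X) : VectorMeasure ℝ X :=
  (derivMeasure T u).restrict (Ioo 0 T \ jumpSet T u)

/-- A nonnegative diffuse reference measure with respect to which the Lebesgue measure on `(0,T)`
and `u'_co` are absolutely continuous. -/
def refMeasure {X : Type*} [NormedAddCommGroup X] [NormedSpace ℝ X] [FiniteDimensional ℝ X]
    (T : ℝ) (u : ℝ → X) : Measure ℝ :=
  volume.restrict (Ioo 0 T) + (diffuseDeriv T u).variation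

/-- The Radon–Nikodym density `d u'_co / d μ`, computed componentwise in a basis of `X`. -/
def diffuseDensity {X : Type*} [NormedAddCommGroup X] [NormedSpace ℝ X] [FiniteDimensional ℝ X]
    (T : ℝ) (u : ℝ → X) (t : ℝ) : X :=
  ∑ i, SignedMeasure.rnDeriv
      ((diffuseDeriv T u).mapRange ((Module.finBasis ℝ X).coord i).toAddMonoidHom
        (LinearMap.continuous_of_finiteDimensional ((Module.finBasis ℝ X).coord i)))
      (refMeasure T u) t • Module.finBasis ℝ X i

/-- `∫_a^b Ψ₀(u'_co) = ∫_{(a,b)} Ψ₀(d u'_co / d μ) d μ`. -/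
def diffuseVar {X : Type*} [NormedAddCommGroup X] [NormedSpace ℝ X] [FiniteDimensional ℝ X]
    (T : ℝ) (Ψ₀ : X → ℝ) (u : ℝ → X) (a b : ℝ) : ℝ≥0∞ :=
  ∫⁻ t in Ioo a b, ENNReal.ofReal (Ψ₀ (diffuseDensity T u t)) ∂(refMeasure T u)

/-- The jump variation of `u` induced by `(𝔭, E)` on `[a,b]`, `a < b`. -/
def jumpVar {X : Type*} [NormedAddCommGroup X] [NormedSpace ℝ X]
    (T : ℝ) (Ψ : X → ℝ) (E : ℝ → X → ℝ) (u : ℝ → X) (a b : ℝ) : ℝ≥0∞ :=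
  finslerCost Ψ E a (u a) (right T u a) + finslerCost Ψ E b (left T u b) (u b) +
    ∑' t : ↥(jumpSet T u ∩ Ioo a b),
      (finslerCost Ψ E t (left T u t) (u t) + finslerCost Ψ E t (u t) (right T u t))

open Classical in
/-- The (pseudo-)total variation `Var_{𝔭,E}(u;[a,b])` (zero on a degenerate interval). -/
def pVar {X : Type*} [NormedAddCommGroup X] [NormedSpace ℝ X] [FiniteDimensional ℝ X]
    (T : ℝ) (Ψ₀ Ψ : X → ℝ) (E : ℝ → X → ℝ) (u : ℝ → X) (a b : ℝ) : ℝ≥0∞ :=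
  if a < b then diffuseVar T Ψ₀ u a b + jumpVar T Ψ E u a b else 0

/-! ### Local stability, BV solutions, energy balances -/

/-- Local stability of `u` on `I ⊆ [0,T]`: `-D E_t(u(t)) ∈ K*` for a.e. `t ∈ I \ J_u`. -/
def LocallyStableOn {X : Type*} [NormedAddCommGroup X] [NormedSpace ℝ X] (T : ℝ) (Ψ₀ : X → ℝ)
    (E : ℝ → X → ℝ) (u : ℝ → X) (I : Set ℝ) : Prop :=
  ∀ᵐ t ∂(volume : Measure ℝ), t ∈ I \ jumpSet T u → -fderiv ℝ (E t) (u t) ∈ stableSet Ψ₀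

/-- `E_s(u(s)) + ∫_s^t ∂ₜ E_r(u(r)) dr`, the right-hand side of the energy balances. -/
def energyInput {X : Type*} (T : ℝ) (E : ℝ → X → ℝ) (u : ℝ → X) (s t : ℝ) : ℝ :=
  E s (u s) + ∫ r in s..t, dtE T E r (u r)

/-- BV solutions of the rate-independent system driven by `𝔭` and `E`. -/
structure IsBVSolution {X : Type*} [NormedAddCommGroup X] [NormedSpace ℝ X]
    [FiniteDimensional ℝ X] (T : ℝ) (Ψ₀ Ψ : X → ℝ) (E : ℝ → X → ℝ) (u : ℝ → X) : Prop where
  bv : BoundedVariationOn u (Icc 0 T)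
  stable : LocallyStableOn T Ψ₀ E u (Icc 0 T)
  balance : ∀ t ∈ Icc 0 T,
    (pVar T Ψ₀ Ψ E u 0 t : EReal) + (E t (u t) : EReal) = (energyInput T E u 0 t : EReal)

/-- The energy balance with `Var_{B₀}` on every `[t₀,t₁] ⊆ [0,T]`. As the right-hand side is real,
it contains the finiteness of `Var_{B₀}`. -/
def EnergyBalanceB0 {X : Type*} [NormedAddCommGroup X] [NormedSpace ℝ X]
    (T : ℝ) (Ψ₀ Ψ : X → ℝ) (E : ℝ → X → ℝ) (u : ℝ → X) : Prop :=
  ∀ t₀ t₁ : ℝ, 0 ≤ t₀ → t₀ ≤ t₁ → t₁ ≤ T →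
    (varB0 T Ψ₀ Ψ E u t₀ t₁ : EReal) + (E t₁ (u t₁) : EReal) =
      (energyInput T E u t₀ t₁ : EReal)

/-- The energy inequality with `Var_{B₀}` on `[0,T]`. -/
def EnergyInequalityB0 {X : Type*} [NormedAddCommGroup X] [NormedSpace ℝ X]
    (T : ℝ) (Ψ₀ Ψ : X → ℝ) (E : ℝ → X → ℝ) (u : ℝ → X) : Prop :=
  (varB0 T Ψ₀ Ψ E u 0 T : EReal) + (E T (u T) : EReal) ≤ (energyInput T E u 0 T : EReal)

end RateIndep

end

/-! Everything is compared with the distance `distB0`. It dominates `Ψ₀` of the increments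
(`gauge_sub_le_distB0`) and satisfies the triangle inequality. Between two states at the same time
it is the Finsler cost (`finslerCost_eq_distB0`): a monotone time with equal end values is constant,
and an absolutely continuous curve becomes Lipschitz when its velocity is truncated.

Stability. Time advances at finite cost only through stable states. If a continuity point of `u` is
unstable, every sufficiently short step to its right costs at least a fixed positive amount, and
arbitrarily many such steps fit in (`stable_of_varB0_lt_top`).

Lower bound for `varB0`. The increments `Ψ₀ (u t - u s)` are dominated by those of the variation
function. Since `Ψ₀` is the support function of `K*`, testing with functionals in `K*` transfers
this to the diffuse density (`diffuseVar_le_of_increments`). On short steps, freezing the time costs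
only a factor `1 + η` (`exists_freeze`), so steps shrinking to a one-sided limit retain the full
jump cost. Superadditivity of `varB0` then collects the jumps one by one (`pVar_le_varB0`).

Upper bound for stable `u`. Let `ν` be the diffuse reference measure plus the mass of the jumps. It
dominates Lebesgue measure, so its quantile function is a 1-Lipschitz time, and integrating a
bounded density of `u'` along it gives an admissible curve. Off the jumps this curve is on the graph
of `u` and pays `Ψ₀`; at a jump the time stands still and a segment is run through, at a cost
comparable to the size of the jump (`distB0_le_lintegral`). Finitely many jumps are crossed at their
true cost instead, and the remaining ones contribute an error that tends to zero (`distB0_le_pVar`).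
Additivity of `pVar` gives the bound on partitions. Conversely, equality forces stability because
`pVar` is finite for every BV curve (`pVar_lt_top`).

Energy balances. The Young inequality for the contact potential gives a chain rule inequality at
frozen time. Summed over fine partitions, it shows that the dissipation is never smaller than the
energy spent (`energy_le_varB0`). Hence the single inequality on `[0,T]`, together with
superadditivity, forces equality on each `[0,t]`; finiteness of `varB0` supplies bounded variation
and stability, and the first half of the theorem replaces `varB0` by `pVar`. -/

namespace RateIndep

/-! ### Gauges, viscous potentials and their conjugates -/

section Potentials

variable {X : Type*} [NormedAddCommGroup X] [NormedSpace ℝ X] {Ψ₀ Ψ : X → ℝ}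

namespace IsGauge

theorem map_zero (h : IsGauge Ψ₀) : Ψ₀ 0 = 0 := by
  simpa using h.smul_eq 0 (0 : X) le_rfl

theorem convexOn (h : IsGauge Ψ₀) : ConvexOn ℝ univ Ψ₀ := by
  refine ⟨convex_univ, fun x _ y _ a b ha hb _ => ?_⟩
  calc Ψ₀ (a • x + b • y) ≤ Ψ₀ (a • x) + Ψ₀ (b • y) := h.add_le _ _
    _ = a • Ψ₀ x + b • Ψ₀ y := by rw [h.smul_eq a x ha, h.smul_eq b y hb]; rfl

theorem continuous [FiniteDimensional ℝ X] (h : IsGauge Ψ₀) : Continuous Ψ₀ :=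
  h.convexOn.locallyLipschitz.continuous

theorem eq_norm_mul (h : IsGauge Ψ₀) (v : X) : Ψ₀ v = ‖v‖ * Ψ₀ (‖v‖⁻¹ • v) := by
  by_cases hv : v = 0
  · simp [hv, h.map_zero]
  · rw [← h.smul_eq _ _ (norm_nonneg v), smul_inv_smul₀ (norm_ne_zero_iff.2 hv)]

/-- Compactness of the unit sphere. This coercivity constant is what turns bounds on costs into
bounds on norms. -/
theorem exists_norm_le [FiniteDimensional ℝ X] (h : IsGauge Ψ₀) :
    ∃ c : ℝ, 0 < c ∧ ∀ v, c * ‖v‖ ≤ Ψ₀ v := by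
  rcases subsingleton_or_nontrivial X with hX | hX
  · refine ⟨1, one_pos, fun v => ?_⟩
    simp [Subsingleton.elim v 0, h.map_zero]
  · obtain ⟨v₀, hv₀⟩ : (Metric.sphere (0 : X) 1).Nonempty := NormedSpace.sphere_nonempty.2 zero_le_one
    obtain ⟨x, hx, hmin⟩ := (isCompact_sphere (0 : X) 1).exists_isMinOn ⟨v₀, hv₀⟩
      h.continuous.continuousOn
    have hx1 : ‖x‖ = 1 := by simpa using hx
    refine ⟨Ψ₀ x, h.pos x (by rintro rfl; simp at hx1), fun v => ?_⟩
    by_cases hv : v = 0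
    · simp [hv, h.map_zero]
    · rw [h.eq_norm_mul v, mul_comm]
      refine mul_le_mul_of_nonneg_left (hmin ?_) (norm_nonneg _)
      simp [norm_smul, hv]

theorem exists_le_norm [FiniteDimensional ℝ X] (h : IsGauge Ψ₀) :
    ∃ C : ℝ, 0 ≤ C ∧ ∀ v, Ψ₀ v ≤ C * ‖v‖ := by
  obtain ⟨C, hC⟩ := (isCompact_closedBall (0 : X) 1).exists_bound_of_continuousOn
    h.continuous.continuousOn
  have hb : ∀ x : X, ‖x‖ ≤ 1 → Ψ₀ x ≤ C := fun x hx =>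
    (le_abs_self _).trans (hC x (by simpa using hx))
  refine ⟨C, (h.nonneg 0).trans (hb 0 (by simp)), fun v => ?_⟩
  rw [h.eq_norm_mul v, mul_comm]
  refine mul_le_mul_of_nonneg_right (hb _ ?_) (norm_nonneg _)
  rw [norm_smul, norm_inv, norm_norm]
  exact inv_mul_le_one

/-- Hahn–Banach, starting from the line spanned by `v`: `Ψ₀` is the support function of `K*`, and
the supremum is attained. -/
theorem exists_dual [FiniteDimensional ℝ X] (h : IsGauge Ψ₀) (v : X) :
    ∃ ξ ∈ stableSet Ψ₀, ξ v = Ψ₀ v := by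
  by_cases hv : v = 0
  · refine ⟨0, fun z => by simpa using h.nonneg z, by simp [hv, h.map_zero]⟩
  let f : X →ₗ.[ℝ] ℝ := LinearPMap.mkSpanSingleton v (Ψ₀ v) hv
  obtain ⟨g, hg, hgle⟩ := exists_extension_of_le_sublinear f Ψ₀
    (fun c hc x => h.smul_eq c x hc.le) h.add_le (by
      rintro ⟨x, hx⟩
      obtain ⟨c, rfl⟩ := Submodule.mem_span_singleton.1 hx
      have : f ⟨c • v, hx⟩ = c • Ψ₀ v := LinearPMap.mkSpanSingleton'_apply _ _ _ _ _
      rw [this]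
      change c * Ψ₀ v ≤ Ψ₀ (c • v)
      rcases le_total 0 c with hc | hc
      · rw [h.smul_eq _ _ hc]
      · exact (mul_nonpos_of_nonpos_of_nonneg hc (h.nonneg v)).trans (h.nonneg _))
  refine ⟨LinearMap.toContinuousLinearMap g, fun z => hgle z, ?_⟩
  have hmem : v ∈ f.domain := Submodule.mem_span_singleton_self v
  have h1 := hg ⟨v, hmem⟩
  have h2 : f ⟨v, hmem⟩ = Ψ₀ v := LinearPMap.mkSpanSingleton'_apply_self v (Ψ₀ v) _ hmem
  change g v = Ψ₀ v
  rw [← h2, ← h1]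

theorem isClosed_stableSet : IsClosed (stableSet Ψ₀) := by
  have : stableSet Ψ₀ = ⋂ z, {w : X →L[ℝ] ℝ | w z ≤ Ψ₀ z} := by
    ext w; simp [stableSet]
  rw [this]
  exact isClosed_iInter fun z => isClosed_le
    (ContinuousLinearMap.apply ℝ ℝ z).continuous continuous_const

end IsGauge

namespace IsViscousPotential

theorem continuous [FiniteDimensional ℝ X] (h : IsViscousPotential Ψ₀ Ψ) : Continuous Ψ :=
  h.convex.locallyLipschitz.continuous

theorem smul_le (h : IsViscousPotential Ψ₀ Ψ) (v : X) {a : ℝ} (h0 : 0 ≤ a) (h1 : a ≤ 1) :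
    Ψ (a • v) ≤ a * Ψ v := by
  have := h.convex.2 (mem_univ v) (mem_univ (0 : X)) h0 (sub_nonneg.2 h1) (by ring)
  simpa [h.map_zero] using this

/-- Convexity and `Ψ 0 = 0` make the difference quotient at the origin monotone, so the limit `Ψ₀`
is an infimum. -/
theorem slope_mono (h : IsViscousPotential Ψ₀ Ψ) (v : X) {ε ε' : ℝ} (h0 : 0 < ε) (h1 : ε ≤ ε') :
    ε⁻¹ * Ψ (ε • v) ≤ ε'⁻¹ * Ψ (ε' • v) := by
  have h0' : 0 < ε' := h0.trans_le h1
  have := h.smul_le (ε' • v) (a := ε / ε') (by positivity) ((div_le_one h0').2 h1)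
  rw [smul_smul, div_mul_cancel₀ _ h0'.ne'] at this
  calc ε⁻¹ * Ψ (ε • v) ≤ ε⁻¹ * (ε / ε' * Ψ (ε' • v)) := by gcongr
    _ = ε'⁻¹ * Ψ (ε' • v) := by field_simp

theorem gauge_le (h : IsViscousPotential Ψ₀ Ψ) (v : X) {ε : ℝ} (h0 : 0 < ε) :
    Ψ₀ v ≤ ε⁻¹ * Ψ (ε • v) := by
  refine le_of_tendsto (h.tendsto_gauge v) ?_
  filter_upwards [Ioc_mem_nhdsGT h0] with e he using h.slope_mono v he.1 he.2

/-- Superlinear growth confines the supremum defining the conjugate to one ball, for all `w` in a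
bounded set. -/
theorem exists_radius [FiniteDimensional ℝ X] (h : IsViscousPotential Ψ₀ Ψ) (R : ℝ) :
    ∃ ρ : ℝ, 0 ≤ ρ ∧ ∀ (w : X →L[ℝ] ℝ) v, ‖w‖ ≤ R → ρ ≤ ‖v‖ → w v - Ψ v ≤ 0 := by
  have := h.superlinear.eventually (eventually_ge_atTop R)
  rw [← comap_norm_atTop, eventually_comap] at this
  obtain ⟨ρ, hρ⟩ := eventually_atTop.1 this
  refine ⟨max ρ 1, by positivity, fun w v hw hv => ?_⟩
  have h1 := hρ ‖v‖ ((le_max_left _ _).trans hv) v rfl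
  have hv0 : 0 < ‖v‖ := one_pos.trans_le ((le_max_right _ _).trans hv)
  rw [le_div_iff₀ hv0] at h1
  have h2 : w v ≤ ‖w‖ * ‖v‖ := (le_abs_self _).trans (w.le_opNorm v)
  nlinarith

theorem bddAbove_conj [FiniteDimensional ℝ X] (h : IsViscousPotential Ψ₀ Ψ) (w : X →L[ℝ] ℝ) :
    BddAbove (range fun v => w v - Ψ v) := by
  obtain ⟨ρ, h0, hρ⟩ := h.exists_radius ‖w‖
  refine ⟨‖w‖ * ρ, ?_⟩
  rintro _ ⟨v, rfl⟩
  rcases le_total ρ ‖v‖ with hv | hv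
  · exact (hρ w v le_rfl hv).trans (by positivity)
  · have h2 : w v ≤ ‖w‖ * ‖v‖ := (le_abs_self _).trans (w.le_opNorm v)
    have := h.nonneg v
    have : ‖w‖ * ‖v‖ ≤ ‖w‖ * ρ := by gcongr
    change w v - Ψ v ≤ _
    linarith

theorem le_conj [FiniteDimensional ℝ X] (h : IsViscousPotential Ψ₀ Ψ) (w : X →L[ℝ] ℝ) (v : X) :
    w v - Ψ v ≤ conj Ψ w :=
  le_ciSup (h.bddAbove_conj w) v

theorem conj_nonneg [FiniteDimensional ℝ X] (h : IsViscousPotential Ψ₀ Ψ) (w : X →L[ℝ] ℝ) :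
    0 ≤ conj Ψ w := by
  simpa [h.map_zero] using h.le_conj w 0

theorem conj_eq_zero [FiniteDimensional ℝ X] (h : IsViscousPotential Ψ₀ Ψ) {w : X →L[ℝ] ℝ}
    (hw : w ∈ stableSet Ψ₀) : conj Ψ w = 0 := by
  refine le_antisymm (ciSup_le fun v => ?_) (h.conj_nonneg w)
  have h1 := hw v
  have h2 := h.gauge_le v one_pos
  simp only [inv_one, one_smul, one_mul] at h2
  linarith

/-- Only `v` in a fixed ball matter in the supremum, and for these `w v` is Lipschitz in `w` with
constant `ρ`. -/
theorem conj_le_add [FiniteDimensional ℝ X] (h : IsViscousPotential Ψ₀ Ψ) (R : ℝ) :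
    ∃ ρ : ℝ, 0 ≤ ρ ∧ ∀ w w' : X →L[ℝ] ℝ, ‖w‖ ≤ R → conj Ψ w ≤ conj Ψ w' + ρ * ‖w - w'‖ := by
  obtain ⟨ρ, h0, hρ⟩ := h.exists_radius R
  refine ⟨ρ, h0, fun w w' hw => ciSup_le fun v => ?_⟩
  have h3 : 0 ≤ ρ * ‖w - w'‖ := by positivity
  rcases le_total ρ ‖v‖ with hv | hv
  · linarith [hρ w v hw hv, h.conj_nonneg w']
  · have h1 := h.le_conj w' v
    have h2 : (w - w') v ≤ ‖w - w'‖ * ‖v‖ := (le_abs_self _).trans ((w - w').le_opNorm v)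
    have : ‖w - w'‖ * ‖v‖ ≤ ‖w - w'‖ * ρ := by gcongr
    simp only [sub_apply] at h2
    linarith

/-- Dini's argument: the quotients decrease to a continuous limit on the compact unit sphere, hence
uniformly. -/
theorem exists_uniform_slope [FiniteDimensional ℝ X] (h₀ : IsGauge Ψ₀)
    (h : IsViscousPotential Ψ₀ Ψ) {η : ℝ} (hη : 0 < η) :
    ∃ e : ℝ, 0 < e ∧ ∀ v : X, ‖v‖ = 1 → e⁻¹ * Ψ (e • v) ≤ Ψ₀ v + η := by
  let U : ℕ → Set X := fun n => {v | (1 / ((n : ℝ) + 1))⁻¹ * Ψ ((1 / ((n : ℝ) + 1)) • v) < Ψ₀ v + η}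
  have hU : ∀ n, IsOpen (U n) := fun n => isOpen_lt
    (continuous_const.mul (h.continuous.comp (continuous_const_smul _)))
    (h₀.continuous.add continuous_const)
  have hpos : ∀ n : ℕ, 0 < 1 / ((n : ℝ) + 1) := fun n => Nat.one_div_pos_of_nat
  have hmono : Monotone U := fun m n hmn v hv =>
    (h.slope_mono v (hpos n) (Nat.one_div_le_one_div hmn)).trans_lt hv
  obtain ⟨n, hn⟩ := (isCompact_sphere (0 : X) 1).elim_directed_cover U hU (fun v _ => by
    have h1 : Tendsto (fun n : ℕ => 1 / ((n : ℝ) + 1)) atTop (𝓝[>] 0) :=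
      tendsto_nhdsWithin_iff.2 ⟨tendsto_one_div_add_atTop_nhds_zero_nat,
        Eventually.of_forall hpos⟩
    have h2 := ((h.tendsto_gauge v).comp h1).eventually
      (gt_mem_nhds (lt_add_of_pos_right (Ψ₀ v) hη))
    obtain ⟨n, hn⟩ := h2.exists
    exact mem_iUnion.2 ⟨n, hn⟩) hmono.directed_le
  exact ⟨_, hpos n, fun v hv => (hn (by simpa using hv) : v ∈ U n).le⟩

end IsViscousPotential

/-! ### The contact potential -/

theorem le_contactPotential {v : X} {w : X →L[ℝ] ℝ} {a : ℝ}
    (h : ∀ ε : ℝ, 0 < ε → a ≤ ε⁻¹ * Ψ (ε • v) + ε⁻¹ * conj Ψ w) : a ≤ contactPotential Ψ v w :=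
  haveI : Nonempty (Ioi (0 : ℝ)) := ⟨⟨1, mem_Ioi.2 one_pos⟩⟩
  le_ciInf fun ε => h ε ε.2

variable [FiniteDimensional ℝ X]

theorem bddBelow_contactPotential (h : IsViscousPotential Ψ₀ Ψ) (v : X) (w : X →L[ℝ] ℝ) :
    BddBelow (range fun ε : Ioi (0 : ℝ) =>
      ((ε : ℝ)⁻¹ * Ψ ((ε : ℝ) • v) + (ε : ℝ)⁻¹ * conj Ψ w)) := by
  refine ⟨0, ?_⟩
  rintro _ ⟨⟨ε, hε⟩, rfl⟩
  have : (0 : ℝ) < ε := hε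
  have := h.nonneg (ε • v)
  have := h.conj_nonneg w
  positivity

theorem contactPotential_le (h : IsViscousPotential Ψ₀ Ψ) (v : X) (w : X →L[ℝ] ℝ) {ε : ℝ}
    (hε : 0 < ε) : contactPotential Ψ v w ≤ ε⁻¹ * Ψ (ε • v) + ε⁻¹ * conj Ψ w :=
  ciInf_le (bddBelow_contactPotential h v w) (⟨ε, hε⟩ : Ioi (0 : ℝ))

theorem gauge_le_contactPotential (h : IsViscousPotential Ψ₀ Ψ) (v : X) (w : X →L[ℝ] ℝ) :
    Ψ₀ v ≤ contactPotential Ψ v w :=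
  le_contactPotential fun ε hε => by
    have := h.gauge_le v hε
    have := mul_nonneg (inv_nonneg.2 hε.le) (h.conj_nonneg w)
    linarith

/-- The Young inequality for `Ψ` at `ε • v`, divided by `ε`. It is the source of the chain rule
inequality. -/
theorem pairing_le_contactPotential (h : IsViscousPotential Ψ₀ Ψ) (v : X) (w : X →L[ℝ] ℝ) :
    w v ≤ contactPotential Ψ v w :=
  le_contactPotential fun ε hε => by
    have := h.le_conj w (ε • v)
    rw [map_smul, smul_eq_mul] at this
    rw [← mul_add, le_inv_mul_iff₀ hε]
    linarith

/-- On `K*` the conjugate vanishes, so `ε` may tend to zero without penalty. -/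
theorem contactPotential_eq_gauge (h : IsViscousPotential Ψ₀ Ψ) (v : X) {w : X →L[ℝ] ℝ}
    (hw : w ∈ stableSet Ψ₀) : contactPotential Ψ v w = Ψ₀ v := by
  refine le_antisymm (ge_of_tendsto (h.tendsto_gauge v) ?_) (gauge_le_contactPotential h v w)
  filter_upwards [self_mem_nhdsWithin] with ε hε
  simpa [h.conj_eq_zero hw] using contactPotential_le h v w hε

/-- With no velocity only the conjugate term remains, and it disappears as `ε → ∞`. -/
theorem contactPotential_zero_left (h₀ : IsGauge Ψ₀) (h : IsViscousPotential Ψ₀ Ψ)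
    (w : X →L[ℝ] ℝ) : contactPotential Ψ 0 w = 0 := by
  refine le_antisymm ?_ (h₀.map_zero ▸ gauge_le_contactPotential h 0 w)
  have h1 : Tendsto (fun ε : ℝ => ε⁻¹ * conj Ψ w) atTop (𝓝 (0 * conj Ψ w)) :=
    tendsto_inv_atTop_zero.mul_const _
  rw [zero_mul] at h1
  refine ge_of_tendsto h1 ?_
  filter_upwards [eventually_gt_atTop 0] with ε hε
  simpa [h.map_zero] using contactPotential_le h 0 w hε

theorem exists_contactPotential_le_norm (h₀ : IsGauge Ψ₀) (h : IsViscousPotential Ψ₀ Ψ) (R : ℝ) :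
    ∃ C : ℝ, 0 ≤ C ∧ ∀ (v : X) (w : X →L[ℝ] ℝ), ‖w‖ ≤ R → contactPotential Ψ v w ≤ C * ‖v‖ := by
  obtain ⟨ρ, hρ0, hρ⟩ := h.conj_le_add R
  obtain ⟨e, he, hu⟩ := h.exists_uniform_slope h₀ one_pos
  obtain ⟨C, hC0, hC⟩ := h₀.exists_le_norm
  refine ⟨C + 1 + e⁻¹ * (ρ * |R|), by positivity, fun v w hw => ?_⟩
  by_cases hv : v = 0
  · simp [hv, contactPotential_zero_left h₀ h]
  have hv0 : 0 < ‖v‖ := norm_pos_iff.2 hv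
  -- Scaling `ε` by `‖v‖⁻¹` evaluates `Ψ` on the sphere of radius `e`, where the slope bound is
  -- uniform.
  have h1 := contactPotential_le h v w (ε := e * ‖v‖⁻¹) (by positivity)
  have h2 := hu (‖v‖⁻¹ • v) (by simp [norm_smul, hv])
  have h3 := hC (‖v‖⁻¹ • v)
  have h4 := hρ w 0 hw
  rw [h.conj_eq_zero (w := 0) (fun z => by simpa using h₀.nonneg z), sub_zero, zero_add] at h4
  have h4' : conj Ψ w ≤ ρ * |R| := h4.trans (by gcongr; exact hw.trans (le_abs_self R))
  rw [norm_smul, norm_inv, norm_norm, inv_mul_cancel₀ hv0.ne'] at h3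
  rw [← smul_smul, mul_inv, inv_inv] at h1
  calc contactPotential Ψ v w ≤ _ := h1
    _ = (e⁻¹ * Ψ (e • ‖v‖⁻¹ • v) + e⁻¹ * conj Ψ w) * ‖v‖ := by ring
    _ ≤ (C + 1 + e⁻¹ * (ρ * |R|)) * ‖v‖ := by
      gcongr
      linarith

/-- The contact potential is continuous in the dual variable, uniformly on bounded sets and
relatively to the norm of the velocity. -/
theorem exists_contactPotential_modulus (h₀ : IsGauge Ψ₀) (h : IsViscousPotential Ψ₀ Ψ) (R : ℝ)
    {η : ℝ} (hη : 0 < η) :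
    ∃ δ : ℝ, 0 < δ ∧ ∀ (v : X) (w w' : X →L[ℝ] ℝ), ‖w'‖ ≤ R → ‖w' - w‖ ≤ δ →
      contactPotential Ψ v w' ≤ contactPotential Ψ v w + η * ‖v‖ := by
  obtain ⟨ρ, hρ0, hρ⟩ := h.conj_le_add R
  obtain ⟨e, he, hu⟩ := h.exists_uniform_slope h₀ (half_pos hη)
  refine ⟨(η / 2) * e / (ρ + 1), by positivity, fun v w w' hw' hww => ?_⟩
  by_cases hv : v = 0
  · simp [hv, contactPotential_zero_left h₀ h]
  have hv0 : 0 < ‖v‖ := norm_pos_iff.2 hv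
  rw [← sub_le_iff_le_add]
  refine le_contactPotential fun ε hε => ?_
  rw [sub_le_iff_le_add]
  set ε₀ := e * ‖v‖⁻¹ with hε₀
  have hε₀pos : 0 < ε₀ := by positivity
  -- Given a competitor `ε` for `w`, use `m` for `w'`. Raising `ε` to `ε₀` keeps the `Ψ` term within
  -- `η/2 * ‖v‖` by the uniform slope, while `m ≥ ε₀` prevents the factor `m⁻¹` from amplifying the
  -- error in the conjugate.
  set m := max ε ε₀ with hm
  have hmpos : 0 < m := hε.trans_le (le_max_left _ _)
  have h1 := contactPotential_le h v w' hmpos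
  have h2 := hρ w' w hw'
  have h3 : ρ * ‖w' - w‖ ≤ (η / 2) * e := by
    calc ρ * ‖w' - w‖ ≤ (ρ + 1) * ((η / 2) * e / (ρ + 1)) := by gcongr; linarith
      _ = _ := by field_simp
  have h4 : m⁻¹ * Ψ (m • v) ≤ ε⁻¹ * Ψ (ε • v) + (η / 2) * ‖v‖ := by
    rcases le_total ε₀ ε with hle | hle
    · rw [hm, max_eq_left hle]
      have : 0 ≤ η / 2 * ‖v‖ := by positivity
      linarith
    · rw [hm, max_eq_right hle]
      have h5 := hu (‖v‖⁻¹ • v) (by simp [norm_smul, hv])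
      have h6 := h₀.eq_norm_mul v
      have h7 := h.gauge_le v hε
      calc ε₀⁻¹ * Ψ (ε₀ • v) = ‖v‖ * (e⁻¹ * Ψ (e • ‖v‖⁻¹ • v)) := by
            rw [hε₀, ← smul_smul, mul_inv, inv_inv]; ring
        _ ≤ ‖v‖ * (Ψ₀ (‖v‖⁻¹ • v) + η / 2) := by gcongr
        _ = Ψ₀ v + η / 2 * ‖v‖ := by rw [mul_add, ← h6]; ring
        _ ≤ _ := by linarith
  have h8 : m⁻¹ * conj Ψ w' ≤ ε⁻¹ * conj Ψ w + (η / 2) * ‖v‖ := by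
    calc m⁻¹ * conj Ψ w' ≤ m⁻¹ * (conj Ψ w + (η / 2) * e) := by gcongr; linarith
      _ = m⁻¹ * conj Ψ w + m⁻¹ * ((η / 2) * e) := by ring
      _ ≤ ε⁻¹ * conj Ψ w + ε₀⁻¹ * ((η / 2) * e) := by
        have := h.conj_nonneg w
        gcongr
        · exact le_max_left _ _
        · exact le_max_right _ _
      _ = _ := by rw [hε₀]; field_simp
  linarith

end Potentials

end RateIndep

namespace RateIndep

/-! ### Regularity of the energy -/

section Energy

variable {X : Type*} [NormedAddCommGroup X] [NormedSpace ℝ X] {T : ℝ} {E : ℝ → X → ℝ}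

namespace IsAdmissibleEnergy

theorem hasFDerivWithinAt (hE : IsAdmissibleEnergy T E) {t : ℝ} (ht : t ∈ Icc 0 T) (x : X) :
    HasFDerivWithinAt (fun q : ℝ × X => E q.1 q.2)
      (fderivWithin ℝ (fun q : ℝ × X => E q.1 q.2) (Icc 0 T ×ˢ univ) (t, x))
      (Icc 0 T ×ˢ univ) (t, x) :=
  (hE.contDiffOn.differentiableOn one_ne_zero (t, x) ⟨ht, mem_univ x⟩).hasFDerivWithinAt

/-- The strip has no boundary in the `X` directions, so the derivative in `x` is unrestricted even
at the end times. -/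
theorem hasFDerivAt (hE : IsAdmissibleEnergy T E) {t : ℝ} (ht : t ∈ Icc 0 T) (x : X) :
    HasFDerivAt (E t)
      ((fderivWithin ℝ (fun q : ℝ × X => E q.1 q.2) (Icc 0 T ×ˢ univ) (t, x)).comp
        (ContinuousLinearMap.inr ℝ ℝ X)) x := by
  have h1 : HasFDerivWithinAt (fun y : X => (t, y)) (ContinuousLinearMap.inr ℝ ℝ X) univ x :=
    (hasFDerivAt_prodMk_right t x).hasFDerivWithinAt
  have := (hE.hasFDerivWithinAt ht x).comp x h1 (fun y _ => ⟨ht, mem_univ y⟩)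
  exact hasFDerivWithinAt_univ.1 this

theorem differentiable (hE : IsAdmissibleEnergy T E) {t : ℝ} (ht : t ∈ Icc 0 T) :
    Differentiable ℝ (E t) := fun x => (hE.hasFDerivAt ht x).differentiableAt

theorem hasDerivWithinAt (hE : IsAdmissibleEnergy T E) {t : ℝ} (ht : t ∈ Icc 0 T) (x : X) :
    HasDerivWithinAt (fun s => E s x)
      (fderivWithin ℝ (fun q : ℝ × X => E q.1 q.2) (Icc 0 T ×ˢ univ) (t, x) (1, 0))
      (Icc 0 T) t := by
  have h1 : HasFDerivWithinAt (fun s : ℝ => (s, x)) (ContinuousLinearMap.inl ℝ ℝ X) (Icc 0 T) t :=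
    (hasFDerivAt_prodMk_left t x).hasFDerivWithinAt
  have hm : MapsTo (fun s : ℝ => (s, x)) (Icc 0 T) (Icc 0 T ×ˢ (univ : Set X)) :=
    fun s hs => ⟨hs, mem_univ x⟩
  have h2 := HasFDerivWithinAt.comp t (hE.hasFDerivWithinAt ht x) h1 hm
  have h3 := h2.hasDerivWithinAt
  simp only [ContinuousLinearMap.comp_apply, ContinuousLinearMap.inl_apply] at h3
  exact h3

theorem hasDerivWithinAt_dtE (hT : 0 < T) (hE : IsAdmissibleEnergy T E) {t : ℝ}
    (ht : t ∈ Icc 0 T) (x : X) :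
    HasDerivWithinAt (fun s => E s x) (dtE T E t x) (Icc 0 T) t := by
  have h := hE.hasDerivWithinAt ht x
  rwa [dtE, h.derivWithin (uniqueDiffOn_Icc hT t ht)]

theorem continuousOn_fderivWithin (hT : 0 < T) (hE : IsAdmissibleEnergy T E) :
    ContinuousOn (fderivWithin ℝ (fun q : ℝ × X => E q.1 q.2) (Icc 0 T ×ˢ univ))
      (Icc 0 T ×ˢ univ) :=
  hE.contDiffOn.continuousOn_fderivWithin ((uniqueDiffOn_Icc hT).prod uniqueDiffOn_univ) le_rfl

theorem continuousOn_fderiv (hT : 0 < T) (hE : IsAdmissibleEnergy T E) :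
    ContinuousOn (fun q : ℝ × X => fderiv ℝ (E q.1) q.2) (Icc 0 T ×ˢ univ) := by
  have h1 : ContinuousOn (fun q : ℝ × X =>
      (fderivWithin ℝ (fun q : ℝ × X => E q.1 q.2) (Icc 0 T ×ˢ univ) q).comp
        (ContinuousLinearMap.inr ℝ ℝ X)) (Icc 0 T ×ˢ univ) :=
    (hE.continuousOn_fderivWithin hT).clm_comp continuousOn_const
  exact h1.congr fun q hq => (hE.hasFDerivAt hq.1 q.2).fderiv

theorem continuousOn_dtE (hT : 0 < T) (hE : IsAdmissibleEnergy T E) :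
    ContinuousOn (fun q : ℝ × X => dtE T E q.1 q.2) (Icc 0 T ×ˢ univ) := by
  have h1 : ContinuousOn (fun q : ℝ × X =>
      fderivWithin ℝ (fun q : ℝ × X => E q.1 q.2) (Icc 0 T ×ˢ univ) q (1, 0))
      (Icc 0 T ×ˢ univ) :=
    (hE.continuousOn_fderivWithin hT).clm_apply continuousOn_const
  exact h1.congr fun q hq =>
    (hE.hasDerivWithinAt hq.1 q.2).derivWithin (uniqueDiffOn_Icc hT q.1 hq.1)

theorem exists_bound_fderiv [FiniteDimensional ℝ X] (hT : 0 < T) (hE : IsAdmissibleEnergy T E)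
    (R : ℝ) :
    ∃ M : ℝ, 0 ≤ M ∧ ∀ t ∈ Icc 0 T, ∀ x : X, ‖x‖ ≤ R → ‖fderiv ℝ (E t) x‖ ≤ M := by
  have hc : IsCompact (Icc 0 T ×ˢ Metric.closedBall (0 : X) R) :=
    isCompact_Icc.prod (isCompact_closedBall 0 R)
  obtain ⟨M, hM⟩ := hc.exists_bound_of_continuousOn
    ((hE.continuousOn_fderiv hT).mono (prod_mono le_rfl (subset_univ _)))
  exact ⟨max M 0, le_max_right _ _, fun t ht x hx =>
    (hM (t, x) ⟨ht, by simpa using hx⟩).trans (le_max_left _ _)⟩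

theorem exists_bound_dtE [FiniteDimensional ℝ X] (hT : 0 < T) (hE : IsAdmissibleEnergy T E)
    (R : ℝ) :
    ∃ M : ℝ, 0 ≤ M ∧ ∀ t ∈ Icc 0 T, ∀ x : X, ‖x‖ ≤ R → ‖dtE T E t x‖ ≤ M := by
  have hc : IsCompact (Icc 0 T ×ˢ Metric.closedBall (0 : X) R) :=
    isCompact_Icc.prod (isCompact_closedBall 0 R)
  obtain ⟨M, hM⟩ := hc.exists_bound_of_continuousOn
    ((hE.continuousOn_dtE hT).mono (prod_mono le_rfl (subset_univ _)))
  exact ⟨max M 0, le_max_right _ _, fun t ht x hx =>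
    (hM (t, x) ⟨ht, by simpa using hx⟩).trans (le_max_left _ _)⟩

theorem exists_modulus_fderiv [FiniteDimensional ℝ X] (hT : 0 < T) (hE : IsAdmissibleEnergy T E)
    (R : ℝ) {η : ℝ} (hη : 0 < η) :
    ∃ δ : ℝ, 0 < δ ∧ ∀ s ∈ Icc 0 T, ∀ t ∈ Icc 0 T, ∀ x y : X, ‖x‖ ≤ R → ‖y‖ ≤ R →
      |s - t| < δ → ‖x - y‖ < δ → ‖fderiv ℝ (E s) x - fderiv ℝ (E t) y‖ ≤ η := by
  have hc : IsCompact (Icc 0 T ×ˢ Metric.closedBall (0 : X) R) :=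
    isCompact_Icc.prod (isCompact_closedBall 0 R)
  have hu := hc.uniformContinuousOn_of_continuous
    ((hE.continuousOn_fderiv hT).mono (prod_mono le_rfl (subset_univ _)))
  obtain ⟨δ, hδ, h⟩ := Metric.uniformContinuousOn_iff.1 hu η hη
  refine ⟨δ, hδ, fun s hs t ht x y hx hy hst hxy => ?_⟩
  have := h (s, x) ⟨hs, by simpa using hx⟩ (t, y) ⟨ht, by simpa using hy⟩
    (by rw [Prod.dist_eq, Real.dist_eq, dist_eq_norm]; exact max_lt hst hxy)
  rw [dist_eq_norm] at this
  exact this.le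

end IsAdmissibleEnergy

end Energy

/-! ### Absolutely continuous and Lipschitz curves -/

section Curves

variable {X : Type*} [NormedAddCommGroup X] [NormedSpace ℝ X]

/-- Free of integrability assumptions, since the integral of a non-integrable function is `0` by
convention. Costs can thus be bounded below without knowing that they are integrable. -/
theorem ofReal_integral_le_lintegral_ofReal {α : Type*} [MeasurableSpace α] {μ : Measure α}
    (f : α → ℝ) : ENNReal.ofReal (∫ a, f a ∂μ) ≤ ∫⁻ a, ENNReal.ofReal (f a) ∂μ := by
  by_cases hf : Integrable f μ
  · rw [integral_eq_lintegral_pos_part_sub_lintegral_neg_part hf]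
    refine (ENNReal.ofReal_le_ofReal (sub_le_self _ ENNReal.toReal_nonneg)).trans ?_
    exact ENNReal.ofReal_toReal_le
  · simp [integral_undef hf]

theorem AbsolutelyContinuousOnInterval.lipschitz_comp {Y Z : Type*} [PseudoMetricSpace Y]
    [PseudoMetricSpace Z] {f : ℝ → Y} {a b : ℝ} (hf : AbsolutelyContinuousOnInterval f a b)
    {g : Y → Z} {K : ℝ≥0} (hg : LipschitzWith K g) :
    AbsolutelyContinuousOnInterval (g ∘ f) a b := by
  have h0 : Tendsto (fun E : ℕ × (ℕ → ℝ × ℝ) =>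
      K * ∑ i ∈ Finset.range E.1, dist (f (E.2 i).1) (f (E.2 i).2))
      (AbsolutelyContinuousOnInterval.totalLengthFilter ⊓
        𝓟 (AbsolutelyContinuousOnInterval.disjWithin a b)) (𝓝 (K * 0)) :=
    Tendsto.const_mul _ hf
  rw [mul_zero] at h0
  refine squeeze_zero (fun E => Finset.sum_nonneg fun i _ => dist_nonneg) (fun E => ?_) h0
  rw [Finset.mul_sum]
  exact Finset.sum_le_sum fun i _ => hg.dist_le_mul _ _

theorem ae_differentiableAt_of_ac [FiniteDimensional ℝ X] {θ : ℝ → X} {a b : ℝ}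
    (hθ : AbsolutelyContinuousOnInterval θ a b) :
    ∀ᵐ r, r ∈ uIcc a b → DifferentiableAt ℝ θ r :=
  hθ.boundedVariationOn.ae_differentiableAt_of_mem_uIcc

theorem deriv_clm_comp {θ : ℝ → X} {r : ℝ} (h : DifferentiableAt ℝ θ r) (ξ : X →L[ℝ] ℝ) :
    deriv (fun s => ξ (θ s)) r = ξ (deriv θ r) :=
  (ξ.hasFDerivAt.comp_hasDerivAt r h.hasDerivAt).deriv

theorem ac_clm_comp {θ : ℝ → X} {a b : ℝ} (hθ : AbsolutelyContinuousOnInterval θ a b)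
    (ξ : X →L[ℝ] ℝ) : AbsolutelyContinuousOnInterval (fun s => ξ (θ s)) a b :=
  AbsolutelyContinuousOnInterval.lipschitz_comp hθ ξ.lipschitz

theorem intervalIntegrable_clm_deriv [FiniteDimensional ℝ X] {θ : ℝ → X} {a b : ℝ}
    (hθ : AbsolutelyContinuousOnInterval θ a b) (ξ : X →L[ℝ] ℝ) :
    IntervalIntegrable (fun r => ξ (deriv θ r)) volume a b := by
  refine (ac_clm_comp hθ ξ).intervalIntegrable_deriv.congr_ae ?_
  refine (ae_restrict_iff' measurableSet_uIoc).2 ?_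
  filter_upwards [ae_differentiableAt_of_ac hθ] with r hr hr'
  exact deriv_clm_comp (hr (uIoc_subset_uIcc hr')) ξ

theorem integral_clm_deriv [FiniteDimensional ℝ X] {θ : ℝ → X} {a b : ℝ}
    (hθ : AbsolutelyContinuousOnInterval θ a b) (ξ : X →L[ℝ] ℝ) :
    ∫ r in a..b, ξ (deriv θ r) = ξ (θ b - θ a) := by
  rw [map_sub, ← (ac_clm_comp hθ ξ).integral_deriv_eq_sub]
  refine intervalIntegral.integral_congr_ae ?_
  filter_upwards [ae_differentiableAt_of_ac hθ] with r hr hr'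
  exact (deriv_clm_comp (hr (uIoc_subset_uIcc hr')) ξ).symm

/-- Reduced to real-valued functions by expanding the derivative in a basis. -/
theorem intervalIntegrable_deriv_of_ac [FiniteDimensional ℝ X] {θ : ℝ → X} {a b : ℝ}
    (hθ : AbsolutelyContinuousOnInterval θ a b) : IntervalIntegrable (deriv θ) volume a b := by
  let B := Module.finBasis ℝ X
  have h : deriv θ = ∑ i, fun r => (LinearMap.toContinuousLinearMap (B.coord i)) (deriv θ r) • B i := by
    ext r
    simp [B.sum_repr]
  rw [h]
  exact IntervalIntegrable.sum _ fun i _ =>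
    have h := intervalIntegrable_clm_deriv hθ (LinearMap.toContinuousLinearMap (B.coord i))
    ⟨Integrable.smul_const h.1 _, Integrable.smul_const h.2 _⟩

theorem integral_deriv_of_ac [FiniteDimensional ℝ X] {θ : ℝ → X} {a b : ℝ}
    (hθ : AbsolutelyContinuousOnInterval θ a b) : ∫ r in a..b, deriv θ r = θ b - θ a := by
  have : CompleteSpace X := FiniteDimensional.complete ℝ X
  have h : ∀ ξ : X →L[ℝ] ℝ, ξ (∫ r in a..b, deriv θ r) = ξ (θ b - θ a) := fun ξ => by
    rw [← integral_clm_deriv hθ ξ, ξ.intervalIntegral_comp_comm (intervalIntegrable_deriv_of_ac hθ)]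
  exact (SeparatingDual.eq_iff_forall_dual_eq (R := ℝ)).2 h

/-- The functional in `K*` that realizes `Ψ₀` on the total increment bounds `Ψ₀` of the velocity
from below at every parameter. -/
theorem gauge_sub_le_lintegral [FiniteDimensional ℝ X] {Ψ₀ : X → ℝ} (hΨ₀ : IsGauge Ψ₀)
    {θ : ℝ → X} {a b : ℝ} (hab : a ≤ b) (hθ : AbsolutelyContinuousOnInterval θ a b) :
    ENNReal.ofReal (Ψ₀ (θ b - θ a)) ≤ ∫⁻ r in Ioo a b, ENNReal.ofReal (Ψ₀ (deriv θ r)) := by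
  obtain ⟨ξ, hξ, h⟩ := hΨ₀.exists_dual (θ b - θ a)
  rw [← h, ← integral_clm_deriv hθ ξ, intervalIntegral.integral_of_le hab,
    integral_Ioc_eq_integral_Ioo]
  exact (ofReal_integral_le_lintegral_ofReal _).trans
    (lintegral_mono fun r => ENNReal.ofReal_le_ofReal (hξ _))

theorem lipschitzOnWith_ite {Y : Type*} [PseudoMetricSpace Y] {f g : ℝ → Y} {a b c : ℝ} {K K' : ℝ≥0}
    (hab : a ≤ b) (hbc : b ≤ c)
    (hf : LipschitzOnWith K f (Icc a b)) (hg : LipschitzOnWith K' g (Icc b c)) (hfg : f b = g b) :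
    LipschitzOnWith (max K K') (fun r => if r ≤ b then f r else g r) (Icc a c) := by
  have key : ∀ x ∈ Icc a c, ∀ y ∈ Icc a c, x ≤ y →
      dist (if x ≤ b then f x else g x) (if y ≤ b then f y else g y) ≤ (max K K' : ℝ≥0) * dist x y := by
    intro x hx y hy hxy
    have hK : (K : ℝ) ≤ (max K K' : ℝ≥0) := by exact_mod_cast le_max_left _ _
    have hK' : (K' : ℝ) ≤ (max K K' : ℝ≥0) := by exact_mod_cast le_max_right _ _
    by_cases h1 : y ≤ b
    · rw [if_pos (hxy.trans h1), if_pos h1]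
      exact (hf.dist_le_mul x ⟨hx.1, hxy.trans h1⟩ y ⟨hy.1, h1⟩).trans (by gcongr)
    · rw [if_neg h1]
      push Not at h1
      by_cases h2 : x ≤ b
      · rw [if_pos h2]
        have e1 := hf.dist_le_mul x ⟨hx.1, h2⟩ b ⟨hab, le_rfl⟩
        have e2 := hg.dist_le_mul b ⟨le_rfl, hbc⟩ y ⟨h1.le, hy.2⟩
        rw [← hfg] at e2
        rw [Real.dist_eq, abs_sub_comm, abs_of_nonneg (by linarith)] at e1 e2 ⊢
        calc dist (f x) (g y) ≤ dist (f x) (f b) + dist (f b) (g y) := dist_triangle _ _ _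
          _ ≤ K * (b - x) + K' * (y - b) := add_le_add e1 e2
          _ ≤ (max K K' : ℝ≥0) * (b - x) + (max K K' : ℝ≥0) * (y - b) := by
            have := sub_nonneg.2 h2
            have := sub_nonneg.2 h1.le
            gcongr
          _ = _ := by ring
      · rw [if_neg h2]
        push Not at h2
        exact (hg.dist_le_mul x ⟨h2.le, hx.2⟩ y ⟨h1.le, hy.2⟩).trans (by gcongr)
  refine LipschitzOnWith.of_dist_le_mul fun x hx y hy => ?_
  rcases le_total x y with h | h
  · exact key x hx y hy h
  · rw [dist_comm, dist_comm x y]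
    exact key y hy x hx h

end Curves

end RateIndep

namespace RateIndep

/-! ### The pseudo-Finsler distance in the extended phase space -/

section Dist

variable {X : Type*} [NormedAddCommGroup X] [NormedSpace ℝ X] {T : ℝ} {Ψ₀ Ψ : X → ℝ}
  {E : ℝ → X → ℝ} {t₀ t₁ t₂ : ℝ} {x₀ x₁ x₂ : X} {r₀ r₁ : ℝ} {τ : ℝ → ℝ} {y : ℝ → X}

/-- The cost of a curve in the extended phase space. -/
noncomputable def curveCost (Ψ₀ Ψ : X → ℝ) (E : ℝ → X → ℝ) (r₀ r₁ : ℝ) (τ : ℝ → ℝ) (y : ℝ → X) :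
    ℝ≥0∞ :=
  ∫⁻ r in Ioo r₀ r₁, dissipationB0 Ψ₀ Ψ E (τ r) (y r) (deriv τ r) (deriv y r)

theorem le_distB0 {a : ℝ≥0∞} (h : ∀ r₀ r₁ τ y, IsAdmissibleCurve T t₀ x₀ t₁ x₁ r₀ r₁ τ y →
    a ≤ curveCost Ψ₀ Ψ E r₀ r₁ τ y) : a ≤ distB0 T Ψ₀ Ψ E t₀ x₀ t₁ x₁ :=
  le_iInf fun r₀ => le_iInf fun r₁ => le_iInf fun τ => le_iInf fun y => le_iInf fun hc =>
    h r₀ r₁ τ y hc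

theorem distB0_le (h : IsAdmissibleCurve T t₀ x₀ t₁ x₁ r₀ r₁ τ y) :
    distB0 T Ψ₀ Ψ E t₀ x₀ t₁ x₁ ≤ curveCost Ψ₀ Ψ E r₀ r₁ τ y :=
  iInf_le_of_le r₀ <| iInf_le_of_le r₁ <| iInf_le_of_le τ <| iInf_le_of_le y <| iInf_le _ h

theorem exists_curve_of_distB0_lt {c : ℝ≥0∞} (h : distB0 T Ψ₀ Ψ E t₀ x₀ t₁ x₁ < c) :
    ∃ r₀ r₁ τ y, IsAdmissibleCurve T t₀ x₀ t₁ x₁ r₀ r₁ τ y ∧ curveCost Ψ₀ Ψ E r₀ r₁ τ y < c := by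
  by_contra! hcon
  exact (le_distB0 hcon).not_gt h

theorem dissipationB0_of_not_pos {t α : ℝ} {x v : X} (h : ¬ 0 < α) :
    dissipationB0 Ψ₀ Ψ E t x α v = ENNReal.ofReal (contactPotential Ψ v (-fderiv ℝ (E t) x)) := by
  simp [dissipationB0, augmentedPotential, h]

theorem dissipationB0_of_stable [FiniteDimensional ℝ X] (hΨ : IsViscousPotential Ψ₀ Ψ)
    {t α : ℝ} {x v : X} (h : -fderiv ℝ (E t) x ∈ stableSet Ψ₀) :
    dissipationB0 Ψ₀ Ψ E t x α v = ENNReal.ofReal (Ψ₀ v) := by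
  simp [dissipationB0, augmentedPotential, h, contactPotential_eq_gauge hΨ]

theorem dissipationB0_of_not_stable {t α : ℝ} {x v : X} (hα : 0 < α)
    (h : -fderiv ℝ (E t) x ∉ stableSet Ψ₀) : dissipationB0 Ψ₀ Ψ E t x α v = ⊤ := by
  simp [dissipationB0, augmentedPotential, h, hα]

/-- When time advances, the state is either stable, and the two potentials agree, or the dissipation
is infinite. So stopping the clock never increases the integrand at a given state. -/
theorem contactPotential_le_dissipationB0 [FiniteDimensional ℝ X]
    (hΨ : IsViscousPotential Ψ₀ Ψ) (t α : ℝ) (x v : X) :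
    ENNReal.ofReal (contactPotential Ψ v (-fderiv ℝ (E t) x)) ≤ dissipationB0 Ψ₀ Ψ E t x α v := by
  by_cases hα : 0 < α
  · by_cases h : -fderiv ℝ (E t) x ∈ stableSet Ψ₀
    · rw [dissipationB0_of_stable hΨ h, contactPotential_eq_gauge hΨ _ h]
    · rw [dissipationB0_of_not_stable hα h]
      exact le_top
  · rw [dissipationB0_of_not_pos hα]

theorem gauge_le_dissipationB0 [FiniteDimensional ℝ X]
    (hΨ : IsViscousPotential Ψ₀ Ψ) (t α : ℝ) (x v : X) :
    ENNReal.ofReal (Ψ₀ v) ≤ dissipationB0 Ψ₀ Ψ E t x α v :=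
  (ENNReal.ofReal_le_ofReal (gauge_le_contactPotential hΨ v _)).trans
    (contactPotential_le_dissipationB0 hΨ t α x v)

namespace IsAdmissibleCurve

theorem ac_time (h : IsAdmissibleCurve T t₀ x₀ t₁ x₁ r₀ r₁ τ y) :
    AbsolutelyContinuousOnInterval τ r₀ r₁ := by
  obtain ⟨L, hL⟩ := h.lipschitz_time
  exact LipschitzOnWith.absolutelyContinuousOnInterval (uIcc_of_le h.lt.le ▸ hL)

theorem ac_space (h : IsAdmissibleCurve T t₀ x₀ t₁ x₁ r₀ r₁ τ y) :
    AbsolutelyContinuousOnInterval y r₀ r₁ := by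
  obtain ⟨L, hL⟩ := h.lipschitz_space
  exact LipschitzOnWith.absolutelyContinuousOnInterval (uIcc_of_le h.lt.le ▸ hL)

theorem monotoneOn (h : IsAdmissibleCurve T t₀ x₀ t₁ x₁ r₀ r₁ τ y) :
    MonotoneOn τ (Icc r₀ r₁) := by
  intro r hr s hs hrs
  have hac : AbsolutelyContinuousOnInterval τ r s := by
    refine h.ac_time.mono ?_
    rw [uIcc_of_le hrs, uIcc_of_le h.lt.le]
    exact Icc_subset_Icc hr.1 hs.2
  rw [← sub_nonneg, ← hac.integral_deriv_eq_sub, intervalIntegral.integral_of_le hrs,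
    integral_Ioc_eq_integral_Ioo]
  refine setIntegral_nonneg_of_ae_restrict ?_
  exact ae_restrict_of_ae_restrict_of_subset (Ioo_subset_Ioo hr.1 hs.2) h.deriv_nonneg

theorem gauge_sub_le [FiniteDimensional ℝ X] (hΨ₀ : IsGauge Ψ₀) (hΨ : IsViscousPotential Ψ₀ Ψ)
    (h : IsAdmissibleCurve T t₀ x₀ t₁ x₁ r₀ r₁ τ y) {r : ℝ} (hr : r ∈ Icc r₀ r₁) :
    ENNReal.ofReal (Ψ₀ (y r - x₀)) ≤ curveCost Ψ₀ Ψ E r₀ r₁ τ y := by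
  have hac : AbsolutelyContinuousOnInterval y r₀ r := by
    refine h.ac_space.mono ?_
    rw [uIcc_of_le hr.1, uIcc_of_le h.lt.le]
    exact Icc_subset_Icc le_rfl hr.2
  rw [← h.space_left]
  calc _ ≤ ∫⁻ s in Ioo r₀ r, ENNReal.ofReal (Ψ₀ (deriv y s)) := gauge_sub_le_lintegral hΨ₀ hr.1 hac
    _ ≤ ∫⁻ s in Ioo r₀ r₁, ENNReal.ofReal (Ψ₀ (deriv y s)) :=
      lintegral_mono_set (Ioo_subset_Ioo le_rfl hr.2)
    _ ≤ _ := lintegral_mono fun s => gauge_le_dissipationB0 hΨ _ _ _ _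

/-- The time component may be frozen at any admissible value without touching the path in `X`. -/
theorem const_time (h : IsAdmissibleCurve T t₀ x₀ t₁ x₁ r₀ r₁ τ y) {σ : ℝ} (hσ : σ ∈ Icc 0 T) :
    IsAdmissibleCurve T σ x₀ σ x₁ r₀ r₁ (fun _ => σ) y where
  lt := h.lt
  lipschitz_time := ⟨0, (LipschitzWith.const σ).lipschitzOnWith⟩
  lipschitz_space := h.lipschitz_space
  mem_Icc := fun _ _ => hσ
  deriv_nonneg := by simp
  time_left := rfl
  space_left := h.space_left
  time_right := rfl
  space_right := h.space_right

theorem shift (h : IsAdmissibleCurve T t₀ x₀ t₁ x₁ r₀ r₁ τ y) (k : ℝ) :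
    IsAdmissibleCurve T t₀ x₀ t₁ x₁ (r₀ + k) (r₁ + k) (fun r => τ (r - k)) (fun r => y (r - k)) := by
  have hmaps : MapsTo (fun r => r - k) (Icc (r₀ + k) (r₁ + k)) (Icc r₀ r₁) := fun r hr =>
    ⟨by have := hr.1; change r₀ ≤ r - k; linarith, by have := hr.2; change r - k ≤ r₁; linarith⟩
  have hlip : LipschitzOnWith 1 (fun r => r - k) (Icc (r₀ + k) (r₁ + k)) :=
    (LipschitzWith.of_dist_le_mul fun a b => by simp).lipschitzOnWith
  obtain ⟨L, hL⟩ := h.lipschitz_time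
  obtain ⟨L', hL'⟩ := h.lipschitz_space
  refine ⟨by linarith [h.lt], ⟨L * 1, hL.comp hlip hmaps⟩, ⟨L' * 1, hL'.comp hlip hmaps⟩,
    fun r hr => h.mem_Icc _ (hmaps hr), ?_, ?_, ?_, ?_, ?_⟩
  · simp only [deriv_comp_sub_const]
    have h1 := (ae_restrict_iff' measurableSet_Ioo).1 h.deriv_nonneg
    have h2 := (measurePreserving_sub_right volume k).quasiMeasurePreserving.ae h1
    refine (ae_restrict_iff' measurableSet_Ioo).2 ?_
    filter_upwards [h2] with r hr hr'
    exact hr ⟨by linarith [hr'.1], by linarith [hr'.2]⟩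
  all_goals simp only [add_sub_cancel_right]
  · exact h.time_left
  · exact h.space_left
  · exact h.time_right
  · exact h.space_right

end IsAdmissibleCurve

theorem curveCost_shift (k : ℝ) :
    curveCost Ψ₀ Ψ E (r₀ + k) (r₁ + k) (fun r => τ (r - k)) (fun r => y (r - k)) =
      curveCost Ψ₀ Ψ E r₀ r₁ τ y := by
  simp only [curveCost, deriv_comp_sub_const]
  rw [← lintegral_indicator measurableSet_Ioo, ← lintegral_indicator measurableSet_Ioo]
  conv_rhs => rw [← lintegral_sub_right_eq_self _ k]
  congr 1 with r
  simp only [indicator, mem_Ioo, lt_sub_iff_add_lt, sub_lt_iff_lt_add]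

theorem deriv_ite_of_lt {Z : Type*} [NormedAddCommGroup Z] [NormedSpace ℝ Z] (f g : ℝ → Z)
    {a r : ℝ} (hr : r < a) : deriv (fun r => if r ≤ a then f r else g r) r = deriv f r :=
  Filter.EventuallyEq.deriv_eq (by
    filter_upwards [Iio_mem_nhds hr] with s hs using if_pos (le_of_lt hs))

theorem deriv_ite_of_gt {Z : Type*} [NormedAddCommGroup Z] [NormedSpace ℝ Z] (f g : ℝ → Z)
    {a r : ℝ} (hr : a < r) : deriv (fun r => if r ≤ a then f r else g r) r = deriv g r :=
  Filter.EventuallyEq.deriv_eq (by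
    filter_upwards [Ioi_mem_nhds hr] with s hs using if_neg (not_le.2 hs))

/-- Concatenation of two admissible curves. -/
theorem distB0_le_of_concat {r₂ : ℝ} {τ' : ℝ → ℝ} {y' : ℝ → X}
    (h : IsAdmissibleCurve T t₀ x₀ t₁ x₁ r₀ r₁ τ y)
    (h' : IsAdmissibleCurve T t₁ x₁ t₂ x₂ r₁ r₂ τ' y') :
    distB0 T Ψ₀ Ψ E t₀ x₀ t₂ x₂ ≤
      curveCost Ψ₀ Ψ E r₀ r₁ τ y + curveCost Ψ₀ Ψ E r₁ r₂ τ' y' := by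
  have hsub : Ioo r₀ r₂ ⊆ Ioo r₀ r₁ ∪ ({r₁} ∪ Ioo r₁ r₂) := fun r hr => by
    rcases lt_trichotomy r r₁ with hlt | heq | hgt
    · exact Or.inl ⟨hr.1, hlt⟩
    · exact Or.inr (Or.inl heq)
    · exact Or.inr (Or.inr ⟨hgt, hr.2⟩)
  obtain ⟨L, hL⟩ := h.lipschitz_time
  obtain ⟨L', hL'⟩ := h'.lipschitz_time
  obtain ⟨M, hM⟩ := h.lipschitz_space
  obtain ⟨M', hM'⟩ := h'.lipschitz_space
  have hcurve : IsAdmissibleCurve T t₀ x₀ t₂ x₂ r₀ r₂ (fun r => if r ≤ r₁ then τ r else τ' r)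
      (fun r => if r ≤ r₁ then y r else y' r) := by
    refine ⟨h.lt.trans h'.lt,
      ⟨_, lipschitzOnWith_ite h.lt.le h'.lt.le hL hL' (h.time_right.trans h'.time_left.symm)⟩,
      ⟨_, lipschitzOnWith_ite h.lt.le h'.lt.le hM hM' (h.space_right.trans h'.space_left.symm)⟩,
      fun r hr => ?_, ?_, ?_, ?_, ?_, ?_⟩
    · split_ifs with hle
      · exact h.mem_Icc r ⟨hr.1, hle⟩
      · exact h'.mem_Icc r ⟨(not_le.1 hle).le, hr.2⟩
    · refine (ae_restrict_iff' measurableSet_Ioo).2 ?_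
      filter_upwards [(ae_restrict_iff' measurableSet_Ioo).1 h.deriv_nonneg,
        (ae_restrict_iff' measurableSet_Ioo).1 h'.deriv_nonneg,
        (measure_eq_zero_iff_ae_notMem.1 (measure_singleton r₁ : volume {r₁} = 0))]
        with r hr hr' hne hmem
      rcases lt_or_gt_of_ne (hne : r ≠ r₁) with hlt | hgt
      · rw [deriv_ite_of_lt _ _ hlt]; exact hr ⟨hmem.1, hlt⟩
      · rw [deriv_ite_of_gt _ _ hgt]; exact hr' ⟨hgt, hmem.2⟩
    · rw [if_pos h.lt.le]; exact h.time_left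
    · rw [if_pos h.lt.le]; exact h.space_left
    · rw [if_neg (not_le.2 h'.lt)]; exact h'.time_right
    · rw [if_neg (not_le.2 h'.lt)]; exact h'.space_right
  refine (distB0_le hcurve).trans ?_
  refine (lintegral_mono_set hsub).trans ((lintegral_union_le _ _ _).trans ?_)
  refine add_le_add ?_ ((lintegral_union_le _ _ _).trans ?_)
  · refine (setLIntegral_congr_fun measurableSet_Ioo fun r hr => ?_).le
    dsimp only
    rw [deriv_ite_of_lt _ _ hr.2, deriv_ite_of_lt _ _ hr.2, if_pos hr.2.le, if_pos hr.2.le]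
  · rw [setLIntegral_measure_zero _ _ (measure_singleton r₁), zero_add]
    refine (setLIntegral_congr_fun measurableSet_Ioo fun r hr => ?_).le
    dsimp only
    rw [deriv_ite_of_gt _ _ hr.1, deriv_ite_of_gt _ _ hr.1, if_neg (not_le.2 hr.1), if_neg (not_le.2 hr.1)]

theorem distB0_triangle (t₀ t₁ t₂ : ℝ) (x₀ x₁ x₂ : X) :
    distB0 T Ψ₀ Ψ E t₀ x₀ t₂ x₂ ≤
      distB0 T Ψ₀ Ψ E t₀ x₀ t₁ x₁ + distB0 T Ψ₀ Ψ E t₁ x₁ t₂ x₂ := by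
  -- Moving one summand to the other side by truncated subtraction lets each infimum be tested on a
  -- single curve.
  rw [← tsub_le_iff_right]
  refine le_distB0 fun r₀ r₁ τ y h => ?_
  rw [tsub_le_iff_right, ← tsub_le_iff_left]
  refine le_distB0 fun r₁' r₂' τ' y' h' => ?_
  rw [tsub_le_iff_left]
  have h2 := h'.shift (r₁ - r₁')
  rw [add_sub_cancel] at h2
  have h3 := distB0_le_of_concat (Ψ₀ := Ψ₀) (Ψ := Ψ) (E := E) h h2
  rwa [show curveCost Ψ₀ Ψ E r₁ (r₂' + (r₁ - r₁')) (fun r => τ' (r - (r₁ - r₁')))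
    (fun r => y' (r - (r₁ - r₁'))) = curveCost Ψ₀ Ψ E r₁' r₂' τ' y' by
      conv_rhs => rw [← curveCost_shift (r₁ - r₁'), add_sub_cancel]] at h3

variable [FiniteDimensional ℝ X]

theorem gauge_sub_le_distB0 (hΨ₀ : IsGauge Ψ₀) (hΨ : IsViscousPotential Ψ₀ Ψ) :
    ENNReal.ofReal (Ψ₀ (x₁ - x₀)) ≤ distB0 T Ψ₀ Ψ E t₀ x₀ t₁ x₁ :=
  le_distB0 fun r₀ r₁ τ y h => by
    simpa [h.space_right] using h.gauge_sub_le (E := E) hΨ₀ hΨ (right_mem_Icc.2 h.lt.le)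

/-- Freezing the time variable changes the cost of a short step only by a factor close to `1`. -/
theorem exists_freeze (hT : 0 < T) (hΨ₀ : IsGauge Ψ₀) (hΨ : IsViscousPotential Ψ₀ Ψ)
    (hE : IsAdmissibleEnergy T E) (R : ℝ) {η : ℝ} (hη : 0 < η) :
    ∃ δ : ℝ, 0 < δ ∧ ∀ (s σ t : ℝ) (x₀ x₁ : X), 0 ≤ s → s ≤ σ → σ ≤ t → t ≤ T → t - s < δ →
      ‖x₀‖ ≤ R → distB0 T Ψ₀ Ψ E s x₀ t x₁ < ENNReal.ofReal R →
      distB0 T Ψ₀ Ψ E σ x₀ σ x₁ ≤ ENNReal.ofReal (1 + η) * distB0 T Ψ₀ Ψ E s x₀ t x₁ := by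
  obtain ⟨c, hc, hcle⟩ := hΨ₀.exists_norm_le
  obtain ⟨M, hM0, hM⟩ := hE.exists_bound_fderiv hT (R + R / c)
  obtain ⟨δ₁, hδ₁, hmod⟩ := exists_contactPotential_modulus hΨ₀ hΨ M (mul_pos hη hc)
  obtain ⟨δ, hδ, hunif⟩ := hE.exists_modulus_fderiv hT (R + R / c) hδ₁
  refine ⟨δ, hδ, fun s σ t x₀ x₁ hs hsσ hσt ht hts hx₀ hdist => ?_⟩
  have hσ : σ ∈ Icc 0 T := ⟨hs.trans hsσ, hσt.trans ht⟩
  have key : ∀ r₀ r₁ τ y, IsAdmissibleCurve T s x₀ t x₁ r₀ r₁ τ y →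
      curveCost Ψ₀ Ψ E r₀ r₁ τ y < ENNReal.ofReal R →
      distB0 T Ψ₀ Ψ E σ x₀ σ x₁ ≤ ENNReal.ofReal (1 + η) * curveCost Ψ₀ Ψ E r₀ r₁ τ y := by
    intro r₀ r₁ τ y h hcost
    refine (distB0_le (h.const_time hσ)).trans ?_
    rw [curveCost, curveCost, ← lintegral_const_mul' _ _ ENNReal.ofReal_ne_top]
    refine setLIntegral_mono' measurableSet_Ioo fun r hr => ?_
    have hr' := Ioo_subset_Icc_self hr
    have hball : ‖y r‖ ≤ R + R / c := by
      have h1 := (h.gauge_sub_le (E := E) hΨ₀ hΨ hr').trans_lt hcost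
      have h2 := (ENNReal.ofReal_lt_ofReal_iff_of_nonneg (hΨ₀.nonneg _)).1 h1
      have h3 : ‖y r - x₀‖ ≤ R / c := by
        rw [le_div_iff₀ hc, mul_comm]; exact (hcle _).trans h2.le
      calc ‖y r‖ = ‖x₀ + (y r - x₀)‖ := by rw [add_sub_cancel]
        _ ≤ _ := (norm_add_le _ _).trans (add_le_add hx₀ h3)
    have hτ := h.mem_Icc r hr'
    have hτ1 : s ≤ τ r := by
      rw [← h.time_left]; exact h.monotoneOn (left_mem_Icc.2 h.lt.le) hr' hr'.1
    have hτ2 : τ r ≤ t := by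
      rw [← h.time_right]; exact h.monotoneOn hr' (right_mem_Icc.2 h.lt.le) hr'.2
    have hDE := hunif σ hσ (τ r) hτ (y r) (y r) hball hball
      (by rw [abs_lt]; constructor <;> linarith) (by simpa using hδ)
    rw [dissipationB0_of_not_pos (by simp)]
    have h4 := hmod (deriv y r) (-fderiv ℝ (E (τ r)) (y r)) (-fderiv ℝ (E σ) (y r))
      (by rw [norm_neg]; exact hM σ hσ _ hball)
      (by rw [← neg_sub', norm_neg]; exact hDE)
    have h5 : contactPotential Ψ (deriv y r) (-fderiv ℝ (E σ) (y r)) ≤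
        (1 + η) * contactPotential Ψ (deriv y r) (-fderiv ℝ (E (τ r)) (y r)) := by
      have h6 := gauge_le_contactPotential hΨ (deriv y r) (-fderiv ℝ (E (τ r)) (y r))
      have h7 := hcle (deriv y r)
      have h8 := mul_le_mul_of_nonneg_left (h7.trans h6) hη.le
      linarith
    calc _ ≤ ENNReal.ofReal ((1 + η) *
          contactPotential Ψ (deriv y r) (-fderiv ℝ (E (τ r)) (y r))) :=
          ENNReal.ofReal_le_ofReal h5
      _ = ENNReal.ofReal (1 + η) *
          ENNReal.ofReal (contactPotential Ψ (deriv y r) (-fderiv ℝ (E (τ r)) (y r))) :=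
          ENNReal.ofReal_mul (by positivity)
      _ ≤ _ := by gcongr; exact contactPotential_le_dissipationB0 hΨ _ _ _ _
  have hne : ENNReal.ofReal (1 + η) ≠ 0 := by
    rw [Ne, ENNReal.ofReal_eq_zero]; linarith
  rw [mul_comm, ← ENNReal.div_le_iff hne ENNReal.ofReal_ne_top]
  refine le_distB0 fun r₀ r₁ τ y h => ?_
  rw [ENNReal.div_le_iff hne ENNReal.ofReal_ne_top, mul_comm]
  -- The estimate is available only for curves of cost below `R`; a more expensive curve is beaten
  -- by a cheap one, which exists by `hdist`.
  by_cases hcost : curveCost Ψ₀ Ψ E r₀ r₁ τ y < ENNReal.ofReal R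
  · exact key r₀ r₁ τ y h hcost
  · obtain ⟨a, b, τ', y', h', hlt⟩ := exists_curve_of_distB0_lt hdist
    refine (key a b τ' y' h' hlt).trans ?_
    gcongr
    exact hlt.le.trans (not_lt.1 hcost)

theorem exists_distB0_segment_le (hT : 0 < T) (hΨ₀ : IsGauge Ψ₀) (hΨ : IsViscousPotential Ψ₀ Ψ)
    (hE : IsAdmissibleEnergy T E) (R : ℝ) :
    ∃ C : ℝ, 0 ≤ C ∧ (∀ t ∈ Icc 0 T, ∀ x v : X, ‖x‖ ≤ R →
        contactPotential Ψ v (-fderiv ℝ (E t) x) ≤ C * ‖v‖) ∧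
      ∀ t ∈ Icc 0 T, ∀ x₀ x₁ : X, ‖x₀‖ ≤ R → ‖x₁‖ ≤ R →
      distB0 T Ψ₀ Ψ E t x₀ t x₁ ≤ ENNReal.ofReal (C * ‖x₁ - x₀‖) := by
  obtain ⟨M, hM0, hM⟩ := hE.exists_bound_fderiv hT R
  obtain ⟨C, hC0, hC⟩ := exists_contactPotential_le_norm hΨ₀ hΨ M
  have hb : ∀ t ∈ Icc 0 T, ∀ x v : X, ‖x‖ ≤ R →
      contactPotential Ψ v (-fderiv ℝ (E t) x) ≤ C * ‖v‖ := fun t ht x v hx =>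
    hC v _ (by rw [norm_neg]; exact hM t ht x hx)
  refine ⟨C, hC0, hb, fun t ht x₀ x₁ h₀ h₁ => ?_⟩
  have hd : ∀ r : ℝ, HasDerivAt (fun r : ℝ => x₀ + r • (x₁ - x₀)) (x₁ - x₀) r := fun r => by
    simpa using ((hasDerivAt_id r).smul_const (x₁ - x₀)).const_add x₀
  have hcurve : IsAdmissibleCurve T t x₀ t x₁ 0 1 (fun _ => t) (fun r => x₀ + r • (x₁ - x₀)) := by
    refine ⟨one_pos, ⟨0, (LipschitzWith.const t).lipschitzOnWith⟩,
      ⟨‖x₁ - x₀‖₊, LipschitzOnWith.of_dist_le_mul fun a _ b _ => ?_⟩, fun _ _ => ht, by simp, rfl,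
      by simp, rfl, by simp⟩
    rw [dist_add_left, dist_eq_norm, ← sub_smul, norm_smul, mul_comm, dist_eq_norm]
    rfl
  refine (distB0_le hcurve).trans ?_
  calc curveCost Ψ₀ Ψ E 0 1 (fun _ => t) (fun r => x₀ + r • (x₁ - x₀))
      ≤ ∫⁻ r in Ioo (0 : ℝ) 1, ENNReal.ofReal (C * ‖x₁ - x₀‖) := by
        refine setLIntegral_mono' measurableSet_Ioo fun r hr => ?_
        rw [dissipationB0_of_not_pos (by simp), (hd r).deriv]
        refine ENNReal.ofReal_le_ofReal (hb t ht _ _ ?_)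
        have : x₀ + r • (x₁ - x₀) = (1 - r) • x₀ + r • x₁ := by
          rw [smul_sub, sub_smul, one_smul]; abel
        dsimp only
        rw [this]
        calc ‖(1 - r) • x₀ + r • x₁‖ ≤ (1 - r) * ‖x₀‖ + r * ‖x₁‖ := by
              refine (norm_add_le _ _).trans_eq ?_
              rw [norm_smul, norm_smul, Real.norm_of_nonneg hr.1.le,
                Real.norm_of_nonneg (sub_nonneg.2 hr.2.le)]
          _ ≤ (1 - r) * R + r * R := by
              have := sub_nonneg.2 hr.2.le
              have := hr.1.le
              gcongr
          _ = R := by ring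
    _ = _ := by simp

theorem distB0_self (hΨ₀ : IsGauge Ψ₀) (hΨ : IsViscousPotential Ψ₀ Ψ) {t : ℝ} (ht : t ∈ Icc 0 T)
    (x : X) : distB0 T Ψ₀ Ψ E t x t x = 0 := by
  have hcurve : IsAdmissibleCurve T t x t x 0 1 (fun _ => t) (fun _ => x) :=
    ⟨one_pos, ⟨0, (LipschitzWith.const t).lipschitzOnWith⟩,
      ⟨0, (LipschitzWith.const x).lipschitzOnWith⟩, fun _ _ => ht, by simp, rfl, rfl, rfl, rfl⟩
  refine le_antisymm ((distB0_le hcurve).trans_eq ?_) zero_le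
  simp [curveCost, dissipationB0_of_not_pos, contactPotential_zero_left hΨ₀ hΨ]

end Dist

end RateIndep

namespace RateIndep

/-! ### The distance at a fixed time is the Finsler cost -/

section Finsler

variable {X : Type*} [NormedAddCommGroup X] [NormedSpace ℝ X] {T : ℝ} {Ψ₀ Ψ : X → ℝ}
  {E : ℝ → X → ℝ}

theorem IsAdmissibleCurve.time_eq {t r₀ r₁ : ℝ} {x₀ x₁ : X} {τ : ℝ → ℝ} {y : ℝ → X}
    (h : IsAdmissibleCurve T t x₀ t x₁ r₀ r₁ τ y) {r : ℝ} (hr : r ∈ Icc r₀ r₁) : τ r = t := by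
  refine le_antisymm ?_ ?_
  · conv_rhs => rw [← h.time_right]
    exact h.monotoneOn hr (right_mem_Icc.2 h.lt.le) hr.2
  · conv_lhs => rw [← h.time_left]
    exact h.monotoneOn (left_mem_Icc.2 h.lt.le) hr hr.1

variable [FiniteDimensional ℝ X]

theorem finslerCost_le_distB0 (hΨ : IsViscousPotential Ψ₀ Ψ) {t : ℝ} (x₀ x₁ : X) :
    finslerCost Ψ E t x₀ x₁ ≤ distB0 T Ψ₀ Ψ E t x₀ t x₁ := by
  refine le_distB0 fun r₀ r₁ τ y h => ?_
  refine iInf_le_of_le r₀ <| iInf_le_of_le r₁ <| iInf_le_of_le y <|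
    iInf_le_of_le ⟨h.lt, h.ac_space, h.space_left, h.space_right⟩ ?_
  refine setLIntegral_mono' measurableSet_Ioo fun r hr => ?_
  have := contactPotential_le_dissipationB0 (E := E) hΨ (τ r) (deriv τ r) (y r) (deriv y r)
  rwa [h.time_eq (Ioo_subset_Icc_self hr)] at this ⊢

/-- Truncating the velocity of an absolutely continuous curve. -/
theorem exists_lipschitz_approx {θ : ℝ → X} {a b : ℝ} (hab : a < b)
    (hθ : AbsolutelyContinuousOnInterval θ a b) {ε : ℝ} (hε : 0 < ε) :
    ∃ (φ : ℝ → X) (L : ℝ≥0), LipschitzWith L φ ∧ φ a = θ a ∧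
      (∀ r ∈ Icc a b, ‖φ r - θ r‖ ≤ ε) ∧
      ∀ᵐ r ∂volume.restrict (Ioo a b), deriv φ r = deriv θ r ∨ deriv φ r = 0 := by
  have : CompleteSpace X := FiniteDimensional.complete ℝ X
  borelize X
  set g := deriv θ with hg
  have hgm : StronglyMeasurable g := stronglyMeasurable_deriv θ
  have hgi : IntegrableOn g (Ioc a b) :=
    (intervalIntegrable_iff_integrableOn_Ioc_of_le hab.le).1 (intervalIntegrable_deriv_of_ac hθ)
  -- Velocities larger than `n` are set to zero. By dominated convergence the truncated velocities
  -- converge in `L¹`, so their primitives converge uniformly; where the velocity was removed the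
  -- contact potential will vanish.
  let S : ℕ → Set ℝ := fun n => {r | ‖g r‖ ≤ n} ∩ Ioc a b
  have hS : ∀ n, MeasurableSet (S n) := fun n =>
    (hgm.norm.measurable measurableSet_Iic).inter measurableSet_Ioc
  let G : ℕ → ℝ → X := fun n => (S n).indicator g
  have hGm : ∀ n, StronglyMeasurable (G n) := fun n => hgm.indicator (hS n)
  have hGb : ∀ n r, ‖G n r‖ ≤ n := fun n r => by
    by_cases hr : r ∈ S n
    · rw [show G n r = g r from indicator_of_mem hr g]; exact hr.1
    · rw [show G n r = 0 from indicator_of_notMem hr g]; simp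
  have hGint : ∀ n c d, IntervalIntegrable (G n) volume c d := fun n c d => by
    rw [intervalIntegrable_iff]
    exact Measure.integrableOn_of_bounded (M := n) measure_Ioc_lt_top.ne
      (hGm n).aestronglyMeasurable (Eventually.of_forall (hGb n))
  have hlim : Tendsto (fun n => ∫ r in Ioc a b, ‖G n r - g r‖) atTop (𝓝 0) := by
    have h0 : (0 : ℝ) = ∫ r in Ioc a b, (0 : ℝ) := by simp
    rw [h0]
    refine tendsto_integral_of_dominated_convergence (fun r => ‖g r‖)
      (fun n => ((hGm n).sub hgm).norm.aestronglyMeasurable) hgi.norm (fun n => ?_) ?_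
    · refine Eventually.of_forall fun r => ?_
      rw [norm_norm]
      by_cases hr : r ∈ S n
      · rw [show G n r = g r from indicator_of_mem hr g]; simp
      · rw [show G n r = 0 from indicator_of_notMem hr g]; simp
    · refine (ae_restrict_iff' measurableSet_Ioc).2 (Eventually.of_forall fun r hr => ?_)
      refine tendsto_const_nhds.congr' ?_
      filter_upwards [eventually_ge_atTop ⌈‖g r‖⌉₊] with n hn
      have hmem : r ∈ S n := ⟨(Nat.le_ceil ‖g r‖).trans (Nat.cast_le.2 hn), hr⟩
      rw [show G n r = g r from indicator_of_mem hmem g]; simp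
  obtain ⟨n, hn⟩ := (hlim.eventually (gt_mem_nhds hε)).exists
  refine ⟨fun r => θ a + ∫ s in a..r, G n s, n, ?_, by simp, fun r hr => ?_, ?_⟩
  · refine LipschitzWith.of_dist_le_mul fun r s => ?_
    rw [dist_add_left, dist_eq_norm, intervalIntegral.integral_interval_sub_left (hGint _ _ _)
      (hGint _ _ _)]
    refine (intervalIntegral.norm_integral_le_of_norm_le_const fun x _ => hGb n x).trans_eq ?_
    rw [Real.dist_eq]; rfl
  · have hsub : uIcc a r ⊆ uIcc a b := by
      rw [uIcc_of_le hr.1, uIcc_of_le hab.le]; exact Icc_subset_Icc le_rfl hr.2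
    have h1 : θ r = θ a + ∫ s in a..r, g s := by
      rw [integral_deriv_of_ac (hθ.mono hsub)]; abel
    rw [h1, add_sub_add_left_eq_sub, ← intervalIntegral.integral_sub (hGint _ _ _)
      (intervalIntegrable_deriv_of_ac (hθ.mono hsub))]
    refine (intervalIntegral.norm_integral_le_integral_norm hr.1).trans (le_trans ?_ hn.le)
    rw [intervalIntegral.integral_of_le hr.1]
    refine setIntegral_mono_set ?_ (Eventually.of_forall fun _ => norm_nonneg _)
      (LE.le.eventuallyLE (Ioc_subset_Ioc le_rfl hr.2))
    exact (((hGint n a b).1).sub hgi).norm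
  · refine (ae_restrict_iff' measurableSet_Ioo).2 ?_
    filter_upwards [(hGint n a b).ae_hasDerivAt_integral] with r hr hr'
    have hmem : r ∈ uIcc a b := by rw [uIcc_of_le hab.le]; exact Ioo_subset_Icc_self hr'
    rw [((hr hmem a (by simp)).const_add (θ a)).deriv]
    by_cases hr : r ∈ S n
    · exact Or.inl (indicator_of_mem hr g)
    · exact Or.inr (indicator_of_notMem hr g)

/-- An absolutely continuous competitor is replaced by a Lipschitz one with truncated velocity,
which almost ends at `x₁`; a short segment closes the gap at a cost proportional to its length. -/
theorem distB0_le_finslerCost (hT : 0 < T) (hΨ₀ : IsGauge Ψ₀) (hΨ : IsViscousPotential Ψ₀ Ψ)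
    (hE : IsAdmissibleEnergy T E) {t : ℝ} (ht : t ∈ Icc 0 T) (x₀ x₁ : X) :
    distB0 T Ψ₀ Ψ E t x₀ t x₁ ≤ finslerCost Ψ E t x₀ x₁ := by
  refine le_iInf fun a => le_iInf fun b => le_iInf fun θ => le_iInf fun ⟨hab, hθ, h0, h1⟩ => ?_
  have : CompleteSpace X := FiniteDimensional.complete ℝ X
  borelize X
  obtain ⟨R, hR⟩ := hθ.exists_bound
  rw [uIcc_of_le hab.le] at hR
  obtain ⟨M, hM0, hM⟩ := hE.exists_bound_fderiv hT (R + 1)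
  obtain ⟨C, hC0, -, hC⟩ := exists_distB0_segment_le hT hΨ₀ hΨ hE (R + 1)
  have hgi : IntegrableOn (deriv θ) (Ioo a b) :=
    ((intervalIntegrable_iff_integrableOn_Ioo_of_le hab.le).1 (intervalIntegrable_deriv_of_ac hθ))
  set G := ∫ r in Ioo a b, ‖deriv θ r‖ with hG
  have hG0 : 0 ≤ G := integral_nonneg fun r => norm_nonneg _
  have hGeq : ∫⁻ r in Ioo a b, ENNReal.ofReal ‖deriv θ r‖ = ENNReal.ofReal G :=
    (ofReal_integral_eq_lintegral_ofReal hgi.norm (Eventually.of_forall fun r => norm_nonneg _)).symm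
  refine ENNReal.le_of_forall_pos_le_add fun ε hε _ => ?_
  have hε' : (0 : ℝ) < ε := hε
  -- Chosen so that the change of the integrand, at most `η * G` in total, and the closing segment,
  -- at most `C * η`, add up to at most `ε`.
  set η := (ε : ℝ) / (G + C + 1) with hη
  have hη0 : 0 < η := by positivity
  obtain ⟨δ₁, hδ₁, hmod⟩ := exists_contactPotential_modulus hΨ₀ hΨ M hη0
  obtain ⟨δ, hδ, hunif⟩ := hE.exists_modulus_fderiv hT (R + 1) hδ₁
  -- The three bounds serve the uniform continuity of the force, the length of the closing segment,
  -- and staying in the ball of radius `R + 1`.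
  obtain ⟨φ, L, hL, hφa, hφ, hφd⟩ := exists_lipschitz_approx hab hθ
    (ε := min (δ / 2) (min η 1)) (by positivity)
  have hφδ : ∀ r ∈ Icc a b, ‖φ r - θ r‖ < δ := fun r hr =>
    ((hφ r hr).trans (min_le_left _ _)).trans_lt (half_lt_self hδ)
  have hφη : ∀ r ∈ Icc a b, ‖φ r - θ r‖ ≤ η := fun r hr =>
    (hφ r hr).trans ((min_le_right _ _).trans (min_le_left _ _))
  have hφR : ∀ r ∈ Icc a b, ‖φ r‖ ≤ R + 1 := fun r hr => by
    have h2 := (hφ r hr).trans ((min_le_right _ _).trans (min_le_right _ _))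
    calc ‖φ r‖ = ‖θ r + (φ r - θ r)‖ := by rw [add_sub_cancel]
      _ ≤ _ := (norm_add_le _ _).trans (add_le_add (hR r hr) h2)
  have hcurve : IsAdmissibleCurve T t x₀ t (φ b) a b (fun _ => t) φ :=
    ⟨hab, ⟨0, (LipschitzWith.const t).lipschitzOnWith⟩, ⟨L, hL.lipschitzOnWith⟩, fun _ _ => ht,
      by simp, rfl, hφa.trans h0, rfl, rfl⟩
  have hstep : distB0 T Ψ₀ Ψ E t x₀ t (φ b) ≤ (∫⁻ r in Ioo a b,
      ENNReal.ofReal (contactPotential Ψ (deriv θ r) (-fderiv ℝ (E t) (θ r)))) +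
        ENNReal.ofReal (η * G) := by
    refine (distB0_le hcurve).trans ?_
    rw [ENNReal.ofReal_mul hη0.le, ← hGeq, ← lintegral_const_mul _
      ((measurable_deriv θ).norm.ennreal_ofReal), ← lintegral_add_right _
      (((measurable_deriv θ).norm.ennreal_ofReal).const_mul _)]
    refine lintegral_mono_ae ?_
    filter_upwards [hφd, ae_restrict_mem measurableSet_Ioo] with r hr hmem
    have hmem' := Ioo_subset_Icc_self hmem
    rw [dissipationB0_of_not_pos (by simp)]
    rcases hr with hr | hr
    · rw [hr, ← ENNReal.ofReal_mul hη0.le, ← ENNReal.ofReal_add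
        ((hΨ₀.nonneg _).trans (gauge_le_contactPotential hΨ _ _)) (by positivity)]
      refine ENNReal.ofReal_le_ofReal (hmod _ _ _ ?_ ?_)
      · rw [norm_neg]; exact hM t ht _ (hφR r hmem')
      · rw [← neg_sub', norm_neg]
        exact hunif t ht t ht _ _ (hφR r hmem') ((hR r hmem').trans (by linarith))
          (by simpa using hδ) (hφδ r hmem')
    · rw [hr, contactPotential_zero_left hΨ₀ hΨ, ENNReal.ofReal_zero]
      exact zero_le
  have hseg := hC t ht (φ b) x₁ (hφR b (right_mem_Icc.2 hab.le))
    (by rw [← h1]; exact (hR b (right_mem_Icc.2 hab.le)).trans (by linarith))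
  have hlast : C * ‖x₁ - φ b‖ ≤ C * η := by
    rw [norm_sub_rev, ← h1]
    exact mul_le_mul_of_nonneg_left (hφη b (right_mem_Icc.2 hab.le)) hC0
  refine (distB0_triangle t t t x₀ (φ b) x₁).trans ((add_le_add hstep hseg).trans ?_)
  rw [add_assoc]
  gcongr
  rw [← ENNReal.ofReal_add (by positivity) (by positivity), ← ENNReal.ofReal_coe_nnreal]
  refine ENNReal.ofReal_le_ofReal ?_
  calc η * G + C * ‖x₁ - φ b‖ ≤ η * (G + C + 1) := by linarith
    _ = ε := by rw [hη]; field_simp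

theorem finslerCost_eq_distB0 (hT : 0 < T) (hΨ₀ : IsGauge Ψ₀) (hΨ : IsViscousPotential Ψ₀ Ψ)
    (hE : IsAdmissibleEnergy T E) {t : ℝ} (ht : t ∈ Icc 0 T) (x₀ x₁ : X) :
    finslerCost Ψ E t x₀ x₁ = distB0 T Ψ₀ Ψ E t x₀ t x₁ :=
  le_antisymm (finslerCost_le_distB0 hΨ x₀ x₁) (distB0_le_finslerCost hT hΨ₀ hΨ hE ht x₀ x₁)

/-- The chain rule at frozen time. -/
theorem energy_sub_le_distB0 (hT : 0 < T) (hΨ : IsViscousPotential Ψ₀ Ψ)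
    (hE : IsAdmissibleEnergy T E) {t : ℝ} (ht : t ∈ Icc 0 T) (x₀ x₁ : X) :
    ENNReal.ofReal (E t x₀ - E t x₁) ≤ distB0 T Ψ₀ Ψ E t x₀ t x₁ := by
  refine le_distB0 fun a b τ y h => ?_
  obtain ⟨R, hR⟩ := h.ac_space.exists_bound
  rw [uIcc_of_le h.lt.le] at hR
  obtain ⟨M, hM0, hM⟩ := hE.exists_bound_fderiv hT R
  -- The energy is Lipschitz on a ball containing the curve, so `E t ∘ y` is absolutely continuous
  -- and is the integral of its derivative.
  have hlipE : LipschitzOnWith M.toNNReal (E t) (Metric.closedBall 0 R) :=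
    Convex.lipschitzOnWith_of_nnnorm_fderiv_le (𝕜 := ℝ)
      (fun x _ => hE.differentiable ht x)
      (fun x hx => by
        rw [← NNReal.coe_le_coe, coe_nnnorm, Real.coe_toNNReal _ hM0]
        exact hM t ht x (by simpa using hx))
      (convex_closedBall 0 R)
  obtain ⟨L, hL⟩ := h.lipschitz_space
  have hac : AbsolutelyContinuousOnInterval (fun r => E t (y r)) a b :=
    LipschitzOnWith.absolutelyContinuousOnInterval (uIcc_of_le h.lt.le ▸
      hlipE.comp hL (fun r hr => by simpa using hR r hr))
  have hint := hac.integral_deriv_eq_sub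
  rw [intervalIntegral.integral_of_le h.lt.le, integral_Ioc_eq_integral_Ioo, h.space_left,
    h.space_right] at hint
  rw [← neg_sub, ← hint, ← integral_neg]
  refine (ofReal_integral_le_lintegral_ofReal _).trans (lintegral_mono_ae ?_)
  filter_upwards [ae_restrict_of_ae (ae_differentiableAt_of_ac h.ac_space),
    ae_restrict_mem measurableSet_Ioo] with r hr hmem
  have hmem' := Ioo_subset_Icc_self hmem
  have hd := hr (by rwa [uIcc_of_le h.lt.le])
  have h1 : deriv (fun r => E t (y r)) r = fderiv ℝ (E t) (y r) (deriv y r) :=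
    ((hE.differentiable ht (y r)).hasFDerivAt.comp_hasDerivAt r hd.hasDerivAt).deriv
  have h2 := contactPotential_le_dissipationB0 (E := E) hΨ (τ r) (deriv τ r) (y r) (deriv y r)
  rw [h.time_eq hmem'] at h2 ⊢
  refine le_trans (ENNReal.ofReal_le_ofReal ?_) h2
  rw [h1]
  exact pairing_le_contactPotential hΨ (deriv y r) (-fderiv ℝ (E t) (y r))

end Finsler

end RateIndep

namespace RateIndep

/-! ### One-sided limits and jumps of curves of bounded variation -/

section BV

variable {X : Type*} [NormedAddCommGroup X] [NormedSpace ℝ X] [FiniteDimensional ℝ X]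
  {T : ℝ} {u : ℝ → X}

/-- Each coordinate is a difference of two monotone functions, and these have countably many
discontinuities. -/
theorem countable_not_continuousAt_constExtend (hT : 0 < T)
    (hu : BoundedVariationOn u (Icc 0 T)) : {t | ¬ ContinuousAt (constExtend T u) t}.Countable := by
  have hbv := boundedVariationOn_constExtend hT hu
  let B := Module.finBasis ℝ X
  have h1 : ∀ i, {t | ¬ ContinuousAt (fun t => B.coord i (constExtend T u t)) t}.Countable := by
    intro i
    have h2 := (LinearMap.toContinuousLinearMap (B.coord i)).lipschitz.comp_boundedVariationOn hbv
    obtain ⟨p, q, hp, hq, hpq⟩ := h2.locallyBoundedVariationOn.exists_monotoneOn_sub_monotoneOn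
    rw [monotoneOn_univ] at hp hq
    refine (hp.countable_not_continuousAt.union hq.countable_not_continuousAt).mono ?_
    intro t ht
    by_contra hcon
    simp only [mem_union, mem_ofPred_eq, not_or, not_not] at hcon
    refine ht ?_
    have h3 : (fun t => B.coord i (constExtend T u t)) = p - q := hpq
    rw [h3]
    exact hcon.1.sub hcon.2
  refine (countable_iUnion h1).mono fun t ht => ?_
  by_contra hcon
  simp only [mem_iUnion, mem_ofPred_eq, not_exists, not_not] at hcon
  refine ht ?_
  have h4 : constExtend T u = fun t => ∑ i, B.coord i (constExtend T u t) • B i := by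
    ext t
    simp [B.sum_repr]
  rw [h4]
  exact tendsto_finsetSum _ fun i _ => (hcon i).smul_const (B i)

theorem tendsto_left (hT : 0 < T) (hu : BoundedVariationOn u (Icc 0 T)) {t : ℝ} (ht : t ∈ Ioc 0 T) :
    Tendsto u (𝓝[<] t) (𝓝 (left T u t)) := by
  have : CompleteSpace X := FiniteDimensional.complete ℝ X
  refine ((boundedVariationOn_constExtend hT hu).tendsto_leftLim t).congr' ?_
  filter_upwards [Ioo_mem_nhdsLT ht.1] with s hs
  exact constExtend_of_mem u ⟨hs.1.le, hs.2.le.trans ht.2⟩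

theorem tendsto_right (hT : 0 < T) (hu : BoundedVariationOn u (Icc 0 T)) {t : ℝ}
    (ht : t ∈ Ico 0 T) : Tendsto u (𝓝[>] t) (𝓝 (right T u t)) := by
  have : CompleteSpace X := FiniteDimensional.complete ℝ X
  refine ((boundedVariationOn_constExtend hT hu).tendsto_rightLim t).congr' ?_
  filter_upwards [Ioo_mem_nhdsGT ht.2] with s hs
  exact constExtend_of_mem u ⟨ht.1.trans hs.1.le, hs.2.le⟩

theorem continuousAt_of_notMem_jumpSet (hT : 0 < T) (hu : BoundedVariationOn u (Icc 0 T)) {t : ℝ}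
    (ht : t ∈ Ioo 0 T) (hJ : t ∉ jumpSet T u) : ContinuousAt u t := by
  have h1 : left T u t = u t ∧ u t = right T u t := by
    by_contra hcon
    exact hJ ⟨Ioo_subset_Icc_self ht, by tauto⟩
  rw [continuousAt_iff_continuous_left'_right']
  constructor
  · have := tendsto_left hT hu ⟨ht.1, ht.2.le⟩
    rwa [h1.1] at this
  · have := tendsto_right hT hu ⟨ht.1.le, ht.2⟩
    rwa [← h1.2] at this

theorem left_right_of_notMem_jumpSet {Y : Type*} [TopologicalSpace Y] {u : ℝ → Y} {t : ℝ}
    (ht : t ∈ Icc 0 T) (hJ : t ∉ jumpSet T u) :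
    left T u t = u t ∧ right T u t = u t := by
  by_contra hcon
  exact hJ ⟨ht, by
    by_contra h
    push Not at h
    exact hcon ⟨h.1, h.2.symm⟩⟩

theorem countable_jumpSet (hT : 0 < T) (hu : BoundedVariationOn u (Icc 0 T)) :
    (jumpSet T u).Countable := by
  refine (countable_not_continuousAt_constExtend hT hu).mono ?_
  intro t ht (hcont : ContinuousAt _ t)
  have h1 : left T u t = u t :=
    (ContinuousWithinAt.leftLim_eq hcont.continuousWithinAt).trans (constExtend_of_mem u ht.1)
  have h2 : right T u t = u t :=
    (ContinuousWithinAt.rightLim_eq hcont.continuousWithinAt).trans (constExtend_of_mem u ht.1)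
  exact ht.2.elim (fun h => h h1) (fun h => h h2.symm)

theorem stronglyMeasurable_constExtend (hT : 0 < T) (hu : BoundedVariationOn u (Icc 0 T)) :
    StronglyMeasurable (constExtend T u) :=
  StronglyMeasurable.of_countable_not_continuousAt (countable_not_continuousAt_constExtend hT hu)

theorem exists_norm_bound {Y : Type*} [NormedAddCommGroup Y] {u : ℝ → Y} (hT : 0 < T)
    (hu : BoundedVariationOn u (Icc 0 T)) :
    ∃ R : ℝ, 0 ≤ R ∧ ∀ t ∈ Icc 0 T, ‖u t‖ ≤ R := by
  refine ⟨‖u 0‖ + (eVariationOn u (Icc 0 T)).toReal, by positivity, fun t ht => ?_⟩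
  have h1 := hu.dist_le ht (left_mem_Icc.2 hT.le)
  rw [dist_eq_norm] at h1
  calc ‖u t‖ = ‖u 0 + (u t - u 0)‖ := by rw [add_sub_cancel]
    _ ≤ _ := (norm_add_le _ _).trans (by gcongr)

theorem norm_left_le (hT : 0 < T) (hu : BoundedVariationOn u (Icc 0 T)) {R : ℝ}
    (hR : ∀ t ∈ Icc 0 T, ‖u t‖ ≤ R) {t : ℝ} (ht : t ∈ Ioc 0 T) : ‖left T u t‖ ≤ R := by
  refine le_of_tendsto (tendsto_left hT hu ht).norm ?_
  filter_upwards [Ioo_mem_nhdsLT ht.1] with s hs using hR s ⟨hs.1.le, hs.2.le.trans ht.2⟩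

theorem norm_right_le (hT : 0 < T) (hu : BoundedVariationOn u (Icc 0 T)) {R : ℝ}
    (hR : ∀ t ∈ Icc 0 T, ‖u t‖ ≤ R) {t : ℝ} (ht : t ∈ Ico 0 T) : ‖right T u t‖ ≤ R := by
  refine le_of_tendsto (tendsto_right hT hu ht).norm ?_
  filter_upwards [Ioo_mem_nhdsGT ht.2] with s hs using hR s ⟨ht.1.trans hs.1.le, hs.2.le⟩

end BV

/-! ### The total variation `varB0` -/

section VarB0

variable {X : Type*} [NormedAddCommGroup X] [NormedSpace ℝ X] {T : ℝ} {Ψ₀ Ψ : X → ℝ}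
  {E : ℝ → X → ℝ} {u : ℝ → X} {a b c : ℝ}

theorem varB0_le {V : ℝ≥0∞} (h : ∀ (M : ℕ) (s : ℕ → ℝ), StrictMonoOn s (Iic M) → s 0 = a → s M = b →
    ∑ m ∈ Finset.range M, distB0 T Ψ₀ Ψ E (s m) (u (s m)) (s (m + 1)) (u (s (m + 1))) ≤ V) :
    varB0 T Ψ₀ Ψ E u a b ≤ V :=
  iSup_le fun M => iSup_le fun s => iSup_le fun hs => h M s hs.1 hs.2.1 hs.2.2

theorem sum_le_varB0 {M : ℕ} {s : ℕ → ℝ} (h : StrictMonoOn s (Iic M)) (h0 : s 0 = a)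
    (hM : s M = b) :
    ∑ m ∈ Finset.range M, distB0 T Ψ₀ Ψ E (s m) (u (s m)) (s (m + 1)) (u (s (m + 1))) ≤
      varB0 T Ψ₀ Ψ E u a b :=
  le_iSup_of_le M <| le_iSup_of_le s <| le_iSup_of_le ⟨h, h0, hM⟩ le_rfl

theorem varB0_self : varB0 T Ψ₀ Ψ E u a a = 0 := by
  refine le_antisymm (varB0_le fun M s hs h0 hM => ?_) zero_le
  rcases Nat.eq_zero_or_pos M with rfl | hpos
  · simp
  · exact absurd (h0.trans hM.symm) (hs (by simp) (by simp) hpos).ne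

theorem exists_partition (hab : a ≤ b) :
    ∃ (M : ℕ) (s : ℕ → ℝ), StrictMonoOn s (Iic M) ∧ s 0 = a ∧ s M = b := by
  rcases hab.eq_or_lt with rfl | hlt
  · exact ⟨0, fun _ => a, fun x hx y hy hxy => by simp at hx hy; omega, rfl, rfl⟩
  · refine ⟨1, fun n => if n = 0 then a else b, fun x hx y hy hxy => ?_, by simp, by simp⟩
    have hx : x ≤ 1 := hx
    have hy : y ≤ 1 := hy
    obtain rfl : x = 0 := by omega
    obtain rfl : y = 1 := by omega
    simpa using hlt

theorem distB0_le_varB0 (hab : a < b) :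
    distB0 T Ψ₀ Ψ E a (u a) b (u b) ≤ varB0 T Ψ₀ Ψ E u a b := by
  have h := sum_le_varB0 (T := T) (Ψ₀ := Ψ₀) (Ψ := Ψ) (E := E) (u := u) (M := 1)
    (s := fun n => if n = 0 then a else b) (a := a) (b := b) (fun x hx y hy hxy => by
      have hx : x ≤ 1 := hx
      have hy : y ≤ 1 := hy
      obtain rfl : x = 0 := by omega
      obtain rfl : y = 1 := by omega
      simpa using hab) (by simp) (by simp)
  simpa using h

/-- Indexing by one nonempty type of partitions allows a sum of two suprema to be bounded pair by
pair. -/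
theorem varB0_eq_iSup_subtype : varB0 T Ψ₀ Ψ E u a b =
    ⨆ p : {p : ℕ × (ℕ → ℝ) // StrictMonoOn p.2 (Iic p.1) ∧ p.2 0 = a ∧ p.2 p.1 = b},
      ∑ m ∈ Finset.range p.1.1, distB0 T Ψ₀ Ψ E (p.1.2 m) (u (p.1.2 m)) (p.1.2 (m + 1))
        (u (p.1.2 (m + 1))) := by
  simp only [varB0, iSup_subtype, iSup_prod]

/-- Two partitions concatenate at `c`. This superadditivity is the only structural property of
`varB0` that the lower estimates use under splitting. -/
theorem varB0_add_le (hac : a ≤ c) (hcb : c ≤ b) :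
    varB0 T Ψ₀ Ψ E u a c + varB0 T Ψ₀ Ψ E u c b ≤ varB0 T Ψ₀ Ψ E u a b := by
  obtain ⟨M₁, s₁, h₁⟩ := exists_partition hac
  obtain ⟨M₂, s₂, h₂⟩ := exists_partition hcb
  have i₁ : Nonempty {p : ℕ × (ℕ → ℝ) // StrictMonoOn p.2 (Iic p.1) ∧ p.2 0 = a ∧ p.2 p.1 = c} :=
    ⟨⟨(M₁, s₁), h₁⟩⟩
  have i₂ : Nonempty {p : ℕ × (ℕ → ℝ) // StrictMonoOn p.2 (Iic p.1) ∧ p.2 0 = c ∧ p.2 p.1 = b} :=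
    ⟨⟨(M₂, s₂), h₂⟩⟩
  rw [varB0_eq_iSup_subtype (a := a) (b := c), varB0_eq_iSup_subtype (a := c) (b := b)]
  refine ENNReal.iSup_add_iSup_le ?_
  rintro ⟨⟨M, s⟩, hs, hs0, hsM⟩ ⟨⟨M', s'⟩, hs', hs'0, hs'M⟩
  dsimp only at hs hs0 hsM hs' hs'0 hs'M ⊢
  set w : ℕ → ℝ := fun n => if n ≤ M then s n else s' (n - M) with hw
  have hw1 : ∀ n, n ≤ M → w n = s n := fun n hn => if_pos hn
  have hw2 : ∀ n, w (M + n) = s' n := fun n => by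
    rcases Nat.eq_zero_or_pos n with rfl | hn
    · rw [add_zero, hw1 M le_rfl, hsM, hs'0]
    · simp only [hw]; rw [if_neg (by omega), Nat.add_sub_cancel_left]
  have hmono : StrictMonoOn w (Iic (M + M')) := by
    intro x hx y hy hxy
    have hy : y ≤ M + M' := hy
    by_cases hyM : y ≤ M
    · rw [hw1 x (by omega), hw1 y hyM]
      exact hs (show x ≤ M by omega) hyM hxy
    · obtain ⟨k, rfl⟩ : ∃ k, y = M + k := ⟨y - M, by omega⟩
      rw [hw2]
      by_cases hxM : x ≤ M
      · rw [hw1 x hxM]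
        calc s x ≤ s M := hs.monotoneOn hxM (mem_Iic.2 le_rfl) hxM
          _ = s' 0 := by rw [hsM, hs'0]
          _ < s' k := hs' (show 0 ≤ M' by omega) (show k ≤ M' by omega) (by omega)
      · obtain ⟨j, rfl⟩ : ∃ j, x = M + j := ⟨x - M, by omega⟩
        rw [hw2]
        exact hs' (show j ≤ M' by omega) (show k ≤ M' by omega) (by omega)
  have h := sum_le_varB0 (T := T) (Ψ₀ := Ψ₀) (Ψ := Ψ) (E := E) (u := u) hmono
    ((hw1 0 (Nat.zero_le _)).trans hs0) ((hw2 M').trans hs'M)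
  rw [Finset.sum_range_add] at h
  refine le_trans (le_of_eq ?_) h
  congr 1
  · refine Finset.sum_congr rfl fun m hm => ?_
    have hm : m < M := Finset.mem_range.1 hm
    rw [hw1 m hm.le, hw1 (m + 1) hm]
  · refine Finset.sum_congr rfl fun m _ => ?_
    rw [hw2 m, add_assoc, hw2 (m + 1)]

theorem varB0_mono {a' b' : ℝ} (ha : a ≤ a') (hab : a' ≤ b') (hb : b' ≤ b) :
    varB0 T Ψ₀ Ψ E u a' b' ≤ varB0 T Ψ₀ Ψ E u a b :=
  calc _ ≤ varB0 T Ψ₀ Ψ E u a a' + varB0 T Ψ₀ Ψ E u a' b' := le_add_self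
    _ ≤ varB0 T Ψ₀ Ψ E u a b' := varB0_add_le ha hab
    _ ≤ varB0 T Ψ₀ Ψ E u a b' + varB0 T Ψ₀ Ψ E u b' b := le_self_add
    _ ≤ _ := varB0_add_le (ha.trans hab) hb

theorem sum_varB0_le {p : ℕ → ℝ} (hp : Monotone p) (n : ℕ) :
    ∑ i ∈ Finset.range n, varB0 T Ψ₀ Ψ E u (p i) (p (i + 1)) ≤
      varB0 T Ψ₀ Ψ E u (p 0) (p n) := by
  induction n with
  | zero => simp
  | succ n ih =>
    rw [Finset.sum_range_succ]
    exact (add_le_add_left ih _).trans (varB0_add_le (hp (Nat.zero_le n)) (hp (Nat.le_succ n)))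

variable [FiniteDimensional ℝ X]

/-- Each increment satisfies `c * ‖u t - u s‖ ≤ Ψ₀ (u t - u s)`, and the right-hand side is at most
the distance between the two states. -/
theorem boundedVariationOn_of_varB0_lt_top (hΨ₀ : IsGauge Ψ₀) (hΨ : IsViscousPotential Ψ₀ Ψ)
    (h : varB0 T Ψ₀ Ψ E u 0 T < ⊤) : BoundedVariationOn u (Icc 0 T) := by
  obtain ⟨c, hc, hcle⟩ := hΨ₀.exists_norm_le
  have key : ENNReal.ofReal c * eVariationOn u (Icc 0 T) ≤ varB0 T Ψ₀ Ψ E u 0 T := by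
    rw [eVariationOn, ENNReal.mul_iSup]
    refine iSup_le ?_
    rintro ⟨n, p, hp, hmem⟩
    rw [Finset.mul_sum]
    calc _ ≤ ∑ i ∈ Finset.range n, varB0 T Ψ₀ Ψ E u (p i) (p (i + 1)) := by
          refine Finset.sum_le_sum fun i _ => ?_
          -- The partitions of `eVariationOn` are only weakly increasing; a repeated point
          -- contributes nothing.
          rcases (hp (Nat.le_succ i)).eq_or_lt with heq | hlt
          · dsimp only
            rw [heq]; simp
          · refine le_trans ?_ (distB0_le_varB0 hlt)
            refine le_trans ?_ (gauge_sub_le_distB0 hΨ₀ hΨ)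
            rw [edist_dist, ← ENNReal.ofReal_mul hc.le, dist_eq_norm]
            exact ENNReal.ofReal_le_ofReal (hcle _)
      _ ≤ varB0 T Ψ₀ Ψ E u (p 0) (p n) := sum_varB0_le hp n
      _ ≤ _ := varB0_mono (hmem 0).1 (hp (Nat.zero_le n)) (hmem n).2
  intro htop
  rw [htop, ENNReal.mul_top (by simpa using hc)] at key
  exact absurd (key.trans_lt h) (by simp)

/-- Near a non-stable point the time cannot advance at finite cost without leaving a ball. -/
theorem le_distB0_of_not_stable (hΨ₀ : IsGauge Ψ₀) (hΨ : IsViscousPotential Ψ₀ Ψ)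
    {κ ρ s s' : ℝ} {x₀ x₁ z : X} (hκ : 0 ≤ κ) (hκle : ∀ v, κ * ‖v‖ ≤ Ψ₀ v) (hs : s < s')
    (hx₀ : ‖x₀ - z‖ ≤ ρ / 2)
    (hns : ∀ σ ∈ Icc 0 T, s ≤ σ → σ ≤ s' → ∀ x, ‖x - z‖ < ρ → -fderiv ℝ (E σ) x ∉ stableSet Ψ₀) :
    ENNReal.ofReal (κ * (ρ / 2)) ≤ distB0 T Ψ₀ Ψ E s x₀ s' x₁ := by
  refine le_distB0 fun r₀ r₁ τ y h => ?_
  by_cases hex : ∃ r ∈ Icc r₀ r₁, ρ ≤ ‖y r - z‖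
  · obtain ⟨r, hr, hρ⟩ := hex
    refine le_trans (ENNReal.ofReal_le_ofReal ?_) (h.gauge_sub_le (E := E) hΨ₀ hΨ hr)
    refine le_trans (mul_le_mul_of_nonneg_left ?_ hκ) (hκle _)
    have : ‖y r - z‖ ≤ ‖y r - x₀‖ + ‖x₀ - z‖ := norm_sub_le_norm_sub_add_norm_sub _ _ _
    linarith
  · push Not at hex
    -- A curve that stays in the ball sees only unstable states. Since `τ` must increase from `s` to
    -- `s'`, the clock runs on a set of positive measure, and there the dissipation is infinite.
    set A := {r | 0 < deriv τ r} ∩ Ioo r₀ r₁ with hA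
    have hAm : MeasurableSet A := (measurable_deriv τ measurableSet_Ioi).inter measurableSet_Ioo
    have hvol : volume A ≠ 0 := by
      intro h0
      have h1 : ∫ r in r₀..r₁, deriv τ r = 0 := by
        rw [intervalIntegral.integral_of_le h.lt.le, integral_Ioc_eq_integral_Ioo]
        refine integral_eq_zero_of_ae ?_
        filter_upwards [h.deriv_nonneg, ae_restrict_mem measurableSet_Ioo,
          ae_restrict_of_ae (measure_eq_zero_iff_ae_notMem.1 h0)] with r h2 h3 h4
        exact le_antisymm (not_lt.1 fun h5 => h4 ⟨h5, h3⟩) h2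
      rw [h.ac_time.integral_deriv_eq_sub, h.time_left, h.time_right] at h1
      linarith
    have htop : (⊤ : ℝ≥0∞) ≤ curveCost Ψ₀ Ψ E r₀ r₁ τ y := by
      calc (⊤ : ℝ≥0∞) = ∫⁻ _ in A, ⊤ := by rw [setLIntegral_const, ENNReal.top_mul hvol]
        _ ≤ ∫⁻ r in A, dissipationB0 Ψ₀ Ψ E (τ r) (y r) (deriv τ r) (deriv y r) := by
          refine setLIntegral_mono' hAm fun r hr => ?_
          have hr' := Ioo_subset_Icc_self hr.2
          refine (dissipationB0_of_not_stable hr.1 (hns _ (h.mem_Icc r hr') ?_ ?_ _ (hex r hr'))).ge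
          · rw [← h.time_left]
            exact h.monotoneOn (left_mem_Icc.2 h.lt.le) hr' hr'.1
          · rw [← h.time_right]
            exact h.monotoneOn hr' (right_mem_Icc.2 h.lt.le) hr'.2
        _ ≤ _ := lintegral_mono_set inter_subset_right
    exact le_top.trans htop

/-- `K*` is closed and the force is continuous, so instability at a continuity point persists in a
neighbourhood. There every step to the right of `t` costs at least `κ * (ρ / 2)`, and `n`
consecutive steps exceed any finite variation. -/
theorem stable_of_varB0_lt_top (hT : 0 < T) (hΨ₀ : IsGauge Ψ₀) (hΨ : IsViscousPotential Ψ₀ Ψ)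
    (hE : IsAdmissibleEnergy T E) (hu : BoundedVariationOn u (Icc 0 T)) (ha : 0 ≤ a) (hb : b ≤ T)
    (h : varB0 T Ψ₀ Ψ E u a b < ⊤) {t : ℝ} (ht : t ∈ Ioo a b) (hJ : t ∉ jumpSet T u) :
    -fderiv ℝ (E t) (u t) ∈ stableSet Ψ₀ := by
  by_contra hns
  have htT : t ∈ Ioo 0 T := ⟨ha.trans_lt ht.1, ht.2.trans_le hb⟩
  obtain ⟨κ, hκ, hκle⟩ := hΨ₀.exists_norm_le
  have hcont : ContinuousWithinAt (fun q : ℝ × X => -fderiv ℝ (E q.1) q.2) (Icc 0 T ×ˢ univ)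
      (t, u t) := ((hE.continuousOn_fderiv hT).neg) (t, u t) ⟨Ioo_subset_Icc_self htT, mem_univ _⟩
  have hev := hcont.eventually (IsGauge.isClosed_stableSet.isOpen_compl.mem_nhds hns)
  obtain ⟨ρ, hρ, hball⟩ := Metric.mem_nhdsWithin_iff.1 hev
  have hcu := continuousAt_of_notMem_jumpSet hT hu htT hJ
  obtain ⟨δ₁, hδ₁, hδ₁u⟩ := Metric.continuousAt_iff.1 hcu (ρ / 2) (half_pos hρ)
  set δ := min (min δ₁ ρ) (b - t) with hδ
  have hδ0 : 0 < δ := lt_min (lt_min hδ₁ hρ) (sub_pos.2 ht.2)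
  have hδδ₁ : δ ≤ δ₁ := (min_le_left _ _).trans (min_le_left _ _)
  have hδρ : δ ≤ ρ := (min_le_left _ _).trans (min_le_right _ _)
  have hδb : δ ≤ b - t := min_le_right _ _
  have key : ∀ s s', t < s → s < s' → s' < t + δ →
      ENNReal.ofReal (κ * (ρ / 2)) ≤ varB0 T Ψ₀ Ψ E u s s' := by
    intro s s' h1 h2 h3
    refine le_trans ?_ (distB0_le_varB0 h2)
    refine le_distB0_of_not_stable hΨ₀ hΨ hκ.le hκle h2 (z := u t) ?_ ?_
    · have := hδ₁u (x := s) (by rw [Real.dist_eq, abs_lt]; constructor <;> linarith)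
      rw [dist_eq_norm] at this
      exact this.le
    · intro σ hσ h4 h5 x hx
      have : ((σ, x) : ℝ × X) ∈ Metric.ball (t, u t) ρ ∩ Icc 0 T ×ˢ univ := by
        refine ⟨?_, hσ, mem_univ _⟩
        rw [Metric.mem_ball, Prod.dist_eq]
        refine max_lt ?_ (by rwa [dist_eq_norm])
        rw [Real.dist_eq, abs_lt]; constructor <;> linarith
      exact hball this
  have hne : ENNReal.ofReal (κ * (ρ / 2)) ≠ 0 := by
    rw [Ne, ENNReal.ofReal_eq_zero, not_le]; positivity
  obtain ⟨n, hn⟩ := ENNReal.exists_nat_mul_gt hne h.ne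
  -- The shifts by `1` and `2` keep all points strictly between `t` and `t + δ`; the truncation `min
  -- k n` makes `p` monotone on all of `ℕ`.
  set p : ℕ → ℝ := fun k => t + δ * (((min k n : ℕ) : ℝ) + 1) / (n + 2) with hp
  have hpm : Monotone p := fun i j hij => by
    simp only [hp]
    have : ((min i n : ℕ) : ℝ) ≤ ((min j n : ℕ) : ℝ) := by exact_mod_cast min_le_min_right n hij
    gcongr
  have hpt : ∀ k, t < p k := fun k => by
    simp only [hp]
    have : 0 < δ * (((min k n : ℕ) : ℝ) + 1) / (n + 2) := by positivity
    linarith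
  have hpδ : ∀ k, p k < t + δ := fun k => by
    simp only [hp]
    have h1 : ((min k n : ℕ) : ℝ) ≤ n := by exact_mod_cast min_le_right k n
    have : δ * (((min k n : ℕ) : ℝ) + 1) / (n + 2) < δ := by
      rw [div_lt_iff₀ (by positivity)]
      nlinarith
    linarith
  have hlt : ∀ k < n, p k < p (k + 1) := fun k hk => by
    simp only [hp]
    rw [min_eq_left hk.le, min_eq_left hk]
    push_cast
    gcongr
    linarith
  have hsum : (n : ℝ≥0∞) * ENNReal.ofReal (κ * (ρ / 2)) ≤ varB0 T Ψ₀ Ψ E u a b := by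
    calc (n : ℝ≥0∞) * ENNReal.ofReal (κ * (ρ / 2))
        = ∑ _i ∈ Finset.range n, ENNReal.ofReal (κ * (ρ / 2)) := by simp
      _ ≤ ∑ i ∈ Finset.range n, varB0 T Ψ₀ Ψ E u (p i) (p (i + 1)) :=
        Finset.sum_le_sum fun i hi => key _ _ (hpt i) (hlt i (Finset.mem_range.1 hi)) (hpδ _)
      _ ≤ varB0 T Ψ₀ Ψ E u (p 0) (p n) := sum_varB0_le hpm n
      _ ≤ _ := varB0_mono (ht.1.trans (hpt 0)).le (hpm (Nat.zero_le n))
        ((hpδ n).le.trans (by linarith))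
  exact absurd hn (not_lt.2 hsum)

end VarB0

end RateIndep

namespace RateIndep

/-! ### The derivative of a curve of bounded variation as a vector measure -/

/-- In a basis the variation is dominated by a finite combination of total variations of signed
measures. -/
theorem isFiniteMeasure_variation {α X : Type*} [MeasurableSpace α] [NormedAddCommGroup X]
    [NormedSpace ℝ X] [FiniteDimensional ℝ X] (m : VectorMeasure α X) :
    IsFiniteMeasure m.variation := by
  let B := Module.finBasis ℝ X
  let s : Fin (Module.finrank ℝ X) → SignedMeasure α := fun i =>
    m.mapRange (B.coord i).toAddMonoidHom (LinearMap.continuous_of_finiteDimensional (B.coord i))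
  have h1 : m.variation ≤ ∑ i, ‖B i‖₊ • (s i).totalVariation := by
    refine VectorMeasure.variation_le_of_forall_enorm_le fun A hA => ?_
    have h2 : m A = ∑ i, s i A • B i := (B.sum_repr (m A)).symm
    rw [h2, Measure.finsetSum_apply]
    refine (enorm_sum_le _ _).trans (Finset.sum_le_sum fun i _ => ?_)
    rw [enorm_smul, Measure.smul_apply, mul_comm]
    change ‖B i‖ₑ * ‖s i A‖ₑ ≤ ‖B i‖ₑ * (s i).totalVariation A
    gcongr
    exact (s i).enorm_le_totalVariation A
  have h3 : ∀ i, IsFiniteMeasure (‖B i‖₊ • (s i).totalVariation) := fun i => by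
    rw [SignedMeasure.totalVariation]; infer_instance
  have h4 : IsFiniteMeasure (∑ i, ‖B i‖₊ • (s i).totalVariation) := by
    refine ⟨?_⟩
    rw [Measure.finsetSum_apply]
    exact ENNReal.sum_lt_top.2 fun i _ => measure_lt_top _ _
  exact isFiniteMeasure_of_le _ h1

section Deriv

variable {X : Type*} [NormedAddCommGroup X] [NormedSpace ℝ X] [FiniteDimensional ℝ X]
  {T : ℝ} {u : ℝ → X}

theorem derivMeasure_Ioc (hT : 0 < T) (hu : BoundedVariationOn u (Icc 0 T)) {a b : ℝ} (hab : a ≤ b) :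
    derivMeasure T u (Ioc a b) = right T u b - right T u a := by
  have : CompleteSpace X := FiniteDimensional.complete ℝ X
  rw [derivMeasure, dif_pos (boundedVariationOn_constExtend hT hu)]
  exact BoundedVariationOn.vectorMeasure_Ioc _ hab

theorem derivMeasure_Ioo (hT : 0 < T) (hu : BoundedVariationOn u (Icc 0 T)) {a b : ℝ}
    (hab : a < b) :
    derivMeasure T u (Ioo a b) = left T u b - right T u a := by
  have : CompleteSpace X := FiniteDimensional.complete ℝ X
  rw [derivMeasure, dif_pos (boundedVariationOn_constExtend hT hu)]
  exact BoundedVariationOn.vectorMeasure_Ioo _ hab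

theorem derivMeasure_singleton (hT : 0 < T) (hu : BoundedVariationOn u (Icc 0 T)) (t : ℝ) :
    derivMeasure T u {t} = right T u t - left T u t := by
  have : CompleteSpace X := FiniteDimensional.complete ℝ X
  rw [derivMeasure, dif_pos (boundedVariationOn_constExtend hT hu)]
  exact BoundedVariationOn.vectorMeasure_singleton _

theorem measurableSet_jumpSet (hT : 0 < T) (hu : BoundedVariationOn u (Icc 0 T)) :
    MeasurableSet (jumpSet T u) := (countable_jumpSet hT hu).measurableSet

theorem diffuseDeriv_apply (hT : 0 < T) (hu : BoundedVariationOn u (Icc 0 T)) {A : Set ℝ}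
    (hA : MeasurableSet A) :
    diffuseDeriv T u A = derivMeasure T u (A ∩ (Ioo 0 T \ jumpSet T u)) :=
  VectorMeasure.restrict_apply _ (measurableSet_Ioo.diff (measurableSet_jumpSet hT hu)) hA

theorem isFiniteMeasure_refMeasure : IsFiniteMeasure (refMeasure T u) := by
  have := isFiniteMeasure_variation (diffuseDeriv T u)
  have : IsFiniteMeasure (volume.restrict (Ioo (0 : ℝ) T)) := ⟨by simp⟩
  rw [refMeasure]; infer_instance

/-- An atom of the derivative of `u` is `u(t₊) - u(t₋)`, which vanishes off the jump set; so the
reference measure is diffuse. -/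
theorem refMeasure_singleton (hT : 0 < T) (hu : BoundedVariationOn u (Icc 0 T)) (t : ℝ) :
    refMeasure T u {t} = 0 := by
  rw [refMeasure, Measure.add_apply, add_eq_zero]
  constructor
  · exact le_antisymm ((Measure.restrict_apply_le _ _).trans_eq (measure_singleton t)) zero_le
  · rw [VectorMeasure.variation_apply_eq_zero (measurableSet_singleton t)]
    intro A hA hAm
    rw [diffuseDeriv_apply hT hu hAm]
    rcases Set.subset_singleton_iff_eq.1 (inter_subset_left.trans hA :
      A ∩ (Ioo 0 T \ jumpSet T u) ⊆ {t}) with h | h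
    · rw [h]; simp
    · have ht : t ∈ A ∩ (Ioo 0 T \ jumpSet T u) := by rw [h]; exact mem_singleton t
      have hlr := left_right_of_notMem_jumpSet (Ioo_subset_Icc_self ht.2.1) ht.2.2
      rw [h, derivMeasure_singleton hT hu, hlr.1, hlr.2, sub_self]

theorem refMeasure_jumpSet (hT : 0 < T) (hu : BoundedVariationOn u (Icc 0 T)) :
    refMeasure T u (jumpSet T u) = 0 := by
  rw [← biUnion_of_singleton (jumpSet T u)]
  exact (measure_biUnion_null_iff (countable_jumpSet hT hu)).2 fun t _ =>
    refMeasure_singleton hT hu t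

theorem volume_restrict_le_refMeasure : volume.restrict (Ioo 0 T) ≤ refMeasure T u :=
  Measure.le_add_right le_rfl

theorem enorm_diffuseDeriv_le (A : Set ℝ) : ‖diffuseDeriv T u A‖ₑ ≤ refMeasure T u A :=
  (VectorMeasure.enorm_measure_le_variation _ A).trans
    (by rw [refMeasure, Measure.add_apply]; exact le_add_self)

theorem measurable_diffuseDensity [MeasurableSpace X] [BorelSpace X] :
    Measurable (diffuseDensity T u) := by
  unfold diffuseDensity
  exact Finset.measurable_sum _ fun i _ => (SignedMeasure.measurable_rnDeriv _ _).smul_const _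

theorem integrable_diffuseDensity : Integrable (diffuseDensity T u) (refMeasure T u) := by
  unfold diffuseDensity
  exact integrable_finsetSum _ fun i _ => (SignedMeasure.integrable_rnDeriv _ _).smul_const _

theorem setIntegral_rnDeriv_coord (i : Fin (Module.finrank ℝ X)) {A : Set ℝ}
    (hA : MeasurableSet A) :
    ∫ t in A, SignedMeasure.rnDeriv
      ((diffuseDeriv T u).mapRange ((Module.finBasis ℝ X).coord i).toAddMonoidHom
        (LinearMap.continuous_of_finiteDimensional ((Module.finBasis ℝ X).coord i)))
      (refMeasure T u) t ∂(refMeasure T u) = (Module.finBasis ℝ X).coord i (diffuseDeriv T u A) := by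
  have := isFiniteMeasure_refMeasure (T := T) (u := u)
  rw [← withDensityᵥ_apply (SignedMeasure.integrable_rnDeriv _ _) hA,
    SignedMeasure.withDensityᵥ_rnDeriv_eq]
  · rfl
  · intro s hs
    by_cases hsm : MeasurableSet s
    · rw [Measure.toENNRealVectorMeasure_apply_measurable hsm] at hs
      have h0 : diffuseDeriv T u s = 0 := by
        rw [← enorm_eq_zero, ← nonpos_iff_eq_zero, ← hs]
        exact enorm_diffuseDeriv_le s
      change (Module.finBasis ℝ X).coord i (diffuseDeriv T u s) = 0
      rw [h0, _root_.map_zero]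
    · exact VectorMeasure.not_measurable _ hsm

theorem setIntegral_diffuseDensity {A : Set ℝ} (hA : MeasurableSet A) :
    ∫ t in A, diffuseDensity T u t ∂(refMeasure T u) = diffuseDeriv T u A := by
  unfold diffuseDensity
  rw [integral_finsetSum _ fun i _ =>
    ((SignedMeasure.integrable_rnDeriv _ _).integrableOn.smul_const _ : IntegrableOn _ A _)]
  conv_rhs => rw [← (Module.finBasis ℝ X).sum_repr (diffuseDeriv T u A)]
  refine Finset.sum_congr rfl fun i _ => ?_
  rw [integral_smul_const, setIntegral_rnDeriv_coord i hA]
  rfl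

/-- Since `‖u'_co(A)‖ ≤ μ(A)`, the mean of each coordinate of the density over any set is bounded by
the norm of the coordinate functional. Boundedness is what will make the parametrized curve
Lipschitz. -/
theorem exists_norm_diffuseDensity_le :
    ∃ K : ℝ, ∀ᵐ t ∂(refMeasure T u), ‖diffuseDensity T u t‖ ≤ K := by
  have := isFiniteMeasure_refMeasure (T := T) (u := u)
  let B := Module.finBasis ℝ X
  let D : Fin (Module.finrank ℝ X) → ℝ → ℝ := fun i => SignedMeasure.rnDeriv
      ((diffuseDeriv T u).mapRange (B.coord i).toAddMonoidHom
        (LinearMap.continuous_of_finiteDimensional (B.coord i))) (refMeasure T u)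
  let L : Fin (Module.finrank ℝ X) → X →L[ℝ] ℝ := fun i => LinearMap.toContinuousLinearMap (B.coord i)
  have hD : ∀ i, Integrable (D i) (refMeasure T u) := fun i => SignedMeasure.integrable_rnDeriv _ _
  have hbound : ∀ i (A : Set ℝ), |L i (diffuseDeriv T u A)| ≤ ‖L i‖ * (refMeasure T u).real A := by
    intro i A
    refine ((L i).le_opNorm _).trans ?_
    gcongr
    rw [Measure.real, ← toReal_enorm]
    exact ENNReal.toReal_mono (measure_ne_top _ _) (enorm_diffuseDeriv_le A)
  have h1 : ∀ i, D i ≤ᵐ[refMeasure T u] fun _ => ‖L i‖ := fun i =>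
    ae_le_of_forall_setIntegral_le (hD i) (integrable_const _) fun A hA _ => by
      rw [setIntegral_const, smul_eq_mul, mul_comm]
      exact (setIntegral_rnDeriv_coord i hA).le.trans ((le_abs_self _).trans (hbound i A))
  have h2 : ∀ i, (fun _ => -‖L i‖) ≤ᵐ[refMeasure T u] D i := fun i =>
    ae_le_of_forall_setIntegral_le (integrable_const _) (hD i) fun A hA _ => by
      rw [setIntegral_const, smul_eq_mul, mul_neg, mul_comm]
      exact (neg_le_of_abs_le (hbound i A)).trans (setIntegral_rnDeriv_coord i hA).ge
  refine ⟨∑ i, ‖L i‖ * ‖B i‖, ?_⟩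
  filter_upwards [ae_all_iff.2 h1, ae_all_iff.2 h2] with t ht1 ht2
  refine (norm_sum_le _ _).trans (Finset.sum_le_sum fun i _ => ?_)
  rw [norm_smul]
  gcongr
  exact abs_le.2 ⟨ht2 i, ht1 i⟩

/-- The derivative of `u` on a set of jump points is the sum of the jumps. -/
theorem derivMeasure_countable {A : Set ℝ} (hA : A.Countable) :
    derivMeasure T u A = ∑' t : A, derivMeasure T u {(t : ℝ)} := by
  conv_lhs => rw [← biUnion_of_singleton A]
  exact VectorMeasure.of_biUnion hA (fun s _ t _ hst => by simpa [Function.onFun] using hst)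
    fun t _ => measurableSet_singleton t

theorem derivMeasure_eq_add (hT : 0 < T) (hu : BoundedVariationOn u (Icc 0 T)) {A : Set ℝ}
    (hA : MeasurableSet A) (hAT : A ⊆ Ioo 0 T) :
    derivMeasure T u A = diffuseDeriv T u A + derivMeasure T u (A ∩ jumpSet T u) := by
  have hJ := measurableSet_jumpSet hT hu
  rw [diffuseDeriv_apply hT hu hA, ← VectorMeasure.of_union _ (hA.inter
    (measurableSet_Ioo.diff hJ)) (hA.inter hJ)]
  · congr 1
    ext t
    by_cases h : t ∈ jumpSet T u
    · simp [h]
    · simp only [mem_union, mem_inter_iff, Set.mem_sdiff, h, not_false_eq_true, and_true, and_false,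
        or_false]
      exact ⟨fun h => ⟨h, hAT h⟩, fun h => h.1⟩
  · exact disjoint_left.2 fun t ht ht' => ht.2.2 ht'.2

/-- The sum of the pointwise jumps is controlled by the pointwise variation. -/
theorem sum_edist_jump_le (hT : 0 < T) (hu : BoundedVariationOn u (Icc 0 T)) (F : Finset ℝ) :
    ∑ t ∈ F, (edist (constExtend T u t) (left T u t) + edist (constExtend T u t) (right T u t)) ≤
      eVariationOn (constExtend T u) univ := by
  have : CompleteSpace X := FiniteDimensional.complete ℝ X
  have hbv := boundedVariationOn_constExtend hT hu
  set f := constExtend T u with hf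
  -- Stopping the variation before `x` makes the induction work: the variation on `(-∞,x)` splits at
  -- the largest point `t` into that on `(-∞,t)`, the left jump at `t`, and that on `[t,x)`.
  suffices h : ∀ x, (∀ t ∈ F, t < x) →
      ∑ t ∈ F, (edist (f t) (left T u t) + edist (f t) (right T u t)) ≤ eVariationOn f (Iio x) by
    obtain ⟨x, hx⟩ := F.bddAbove
    exact (h (x + 1) fun t ht => (hx ht).trans_lt (lt_add_one x)).trans
      (eVariationOn.mono _ (subset_univ _))
  induction F using Finset.induction_on_max with
  | empty => simp
  | insert t F htF ih =>
    intro x hx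
    have htx : t < x := hx t (Finset.mem_insert_self _ _)
    rw [Finset.sum_insert fun h => lt_irrefl _ (htF t h)]
    have h1 : edist (f t) (right T u t) ≤ eVariationOn f (Ico t x) := by
      refine le_of_tendsto (tendsto_const_nhds.edist (hbv.tendsto_rightLim t)) ?_
      filter_upwards [Ioo_mem_nhdsGT htx] with s hs
      exact eVariationOn.edist_le f (left_mem_Ico.2 htx) ⟨hs.1.le, hs.2⟩
    have h2 := hbv.eVariationOn_Iic_eq_Iio_add_edist (a := t)
    have h3 : eVariationOn f (Iic t) + eVariationOn f (Ico t x) = eVariationOn f (Iio x) := by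
      rw [← eVariationOn.union f (x := t) isGreatest_Iic ⟨left_mem_Ico.2 htx, fun y hy => hy.1⟩,
        Iic_union_Ico_eq_Iio htx]
    rw [← h3, h2]
    calc _ ≤ edist (f t) (left T u t) + eVariationOn f (Ico t x) + eVariationOn f (Iio t) := by
          gcongr
          exact ih t htF
      _ = _ := by rw [add_right_comm, add_comm (edist _ _)]; rfl

end Deriv

end RateIndep

namespace RateIndep

/-! ### The quantile function of a finite measure -/

section Quantile

variable {a b : ℝ} {ν : Measure ℝ} [IsFiniteMeasure ν]

theorem measureReal_Iio_left (hν : ν (Ioo a b)ᶜ = 0) {t : ℝ} (ht : t ≤ a) :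
    ν.real (Iio t) = 0 := by
  rw [measureReal_eq_zero_iff]
  refine measure_mono_null ?_ hν
  intro s hs h
  exact absurd h.1 (not_lt.2 ((mem_Iio.1 hs).le.trans ht))

theorem measureReal_Iio_right (hν : ν (Ioo a b)ᶜ = 0) {t : ℝ} (ht : b ≤ t) :
    ν.real (Iio t) = ν.real univ := by
  have h : ν (Ici t) = 0 := by
    refine measure_mono_null ?_ hν
    intro s hs h
    exact absurd h.2 (not_lt.2 (ht.trans (mem_Ici.1 hs)))
  have h2 := measureReal_compl (μ := ν) (measurableSet_Ici (a := t))
  rw [compl_Ici, measureReal_eq_zero_iff (s := Ici t) |>.2 h, sub_zero] at h2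
  exact h2

theorem sub_le_measureReal_Ico (hvol : volume.restrict (Ioo a b) ≤ ν) {s t : ℝ} (hs : a ≤ s)
    (ht : t ≤ b) : t - s ≤ ν.real (Ico s t) := by
  have h1 : volume (Ioo s t) ≤ ν (Ioo s t) := by
    have := hvol (Ioo s t)
    rwa [Measure.restrict_eq_self _ (Ioo_subset_Ioo hs ht)] at this
  have h2 : ENNReal.ofReal (t - s) ≤ ν (Ico s t) := by
    rw [← Real.volume_Ioo]; exact h1.trans (measure_mono Ioo_subset_Ico_self)
  rw [← ENNReal.ofReal_le_ofReal_iff measureReal_nonneg, ofReal_measureReal]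
  exact h2

/-- A finite measure `ν` on an interval dominating the Lebesgue measure is the image of the Lebesgue
measure under a Lipschitz monotone function. -/
theorem exists_quantile (hab : a < b) (hν : ν (Ioo a b)ᶜ = 0)
    (hvol : volume.restrict (Ioo a b) ≤ ν) :
    ∃ τ : ℝ → ℝ, LipschitzWith 1 τ ∧ MonotoneOn τ (Icc 0 (ν.real univ)) ∧ τ 0 = a ∧
      τ (ν.real univ) = b ∧ (∀ r ∈ Icc 0 (ν.real univ), τ r ∈ Icc a b) ∧
      (∀ r ∈ Ioo 0 (ν.real univ), ∀ t, t ≤ τ r ↔ ν.real (Iio t) ≤ r) := by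
  set N := ν.real univ with hN
  have hN0 : 0 ≤ N := measureReal_nonneg
  let S : ℝ → Set ℝ := fun r => {t | t ∈ Icc a b ∧ ν.real (Iio t) ≤ r}
  let σ : ℝ → ℝ := fun r => sSup (S r)
  have hmono_ν : ∀ {s t : ℝ}, s ≤ t → ν.real (Iio s) ≤ ν.real (Iio t) := fun hst =>
    measureReal_mono (Iio_subset_Iio hst)
  have hne : ∀ r ∈ Icc 0 N, a ∈ S r := fun r hr =>
    ⟨left_mem_Icc.2 hab.le, (measureReal_Iio_left hν le_rfl).trans_le hr.1⟩
  have hbdd : ∀ r, BddAbove (S r) := fun r => ⟨b, fun t ht => ht.1.2⟩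
  have hmem : ∀ r ∈ Icc 0 N, σ r ∈ Icc a b := fun r hr =>
    ⟨le_csSup (hbdd r) (hne r hr), csSup_le ⟨a, hne r hr⟩ fun t ht => ht.1.2⟩
  have hiff : ∀ r ∈ Icc 0 N, ∀ t ∈ Icc a b, t ≤ σ r ↔ ν.real (Iio t) ≤ r := by
    intro r hr t ht
    refine ⟨fun h => ?_, fun h => le_csSup (hbdd r) ⟨ht, h⟩⟩
    have h1 : ∀ s < t, ν.real (Iio s) ≤ r := fun s hs => by
      obtain ⟨s', hs', hlt⟩ := exists_lt_of_lt_csSup ⟨a, hne r hr⟩ (hs.trans_le h)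
      exact (hmono_ν hlt.le).trans hs'.2
    rw [← ENNReal.ofReal_le_ofReal_iff hr.1, ofReal_measureReal]
    -- Continuity of `ν` from below: the constraint `ν.real (Iio t) ≤ r` survives at the supremum.
    have h2 : Iio t = ⋃ n : ℕ, Iio (t - 1 / ((n : ℝ) + 1)) := by
      ext s
      simp only [mem_Iio, mem_iUnion]
      constructor
      · intro hs
        obtain ⟨n, hn⟩ := exists_nat_one_div_lt (sub_pos.2 hs)
        exact ⟨n, by linarith⟩
      · rintro ⟨n, hn⟩
        have : 0 < 1 / ((n : ℝ) + 1) := Nat.one_div_pos_of_nat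
        linarith
    have h3 : Monotone fun n : ℕ => Iio (t - 1 / ((n : ℝ) + 1)) := fun m n hmn =>
      Iio_subset_Iio (sub_le_sub_left (Nat.one_div_le_one_div hmn) t)
    rw [h2, h3.measure_iUnion]
    refine iSup_le fun n => ?_
    rw [← ofReal_measureReal]
    refine ENNReal.ofReal_le_ofReal (h1 _ ?_)
    have : 0 < 1 / ((n : ℝ) + 1) := Nat.one_div_pos_of_nat
    linarith
  have hself : ∀ r ∈ Icc 0 N, ν.real (Iio (σ r)) ≤ r := fun r hr =>
    (hiff r hr _ (hmem r hr)).1 le_rfl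
  have hmono : MonotoneOn σ (Icc 0 N) := fun r hr r' hr' hrr =>
    (hiff r' hr' _ (hmem r hr)).2 ((hself r hr).trans hrr)
  have hlip : LipschitzOnWith 1 σ (Icc 0 N) := by
    -- Faster growth would leave mass above `r` below `t''`, while `[t'', σ r')` carries at least
    -- its length `r' - r`; together this contradicts `ν.real (Iio (σ r')) ≤ r'`.
    have key : ∀ r ∈ Icc 0 N, ∀ r' ∈ Icc 0 N, r ≤ r' → σ r' ≤ σ r + (r' - r) := by
      intro r hr r' hr' hrr
      by_contra! hcon
      set t'' := σ r' - (r' - r) with ht''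
      have h1 : t'' ∈ Icc a b := ⟨by linarith [(hmem r hr).1], by linarith [(hmem r' hr').2]⟩
      have h2 : r < ν.real (Iio t'') := by
        by_contra! h
        have := (hiff r hr t'' h1).2 h
        linarith
      have h3 := sub_le_measureReal_Ico hvol h1.1 (hmem r' hr').2
      have h4 : ν.real (Iio (σ r')) = ν.real (Iio t'') + ν.real (Ico t'' (σ r')) := by
        rw [← measureReal_union (by
          rw [disjoint_left]
          intro x (hx : x < t'') hx'
          exact absurd hx (not_lt.2 hx'.1)) measurableSet_Ico,
          Iio_union_Ico_eq_Iio (by linarith)]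
      linarith [hself r' hr']
    refine LipschitzOnWith.of_dist_le_mul fun x hx y hy => ?_
    rw [NNReal.coe_one, one_mul, Real.dist_eq, Real.dist_eq, abs_le]
    rcases le_total x y with hxy | hxy
    · have h1 := key x hx y hy hxy
      have h2 := hmono hx hy hxy
      rw [abs_sub_comm, abs_of_nonneg (sub_nonneg.2 hxy)]
      constructor <;> linarith
    · have h1 := key y hy x hx hxy
      have h2 := hmono hy hx hxy
      rw [abs_of_nonneg (sub_nonneg.2 hxy)]
      constructor <;> linarith
  obtain ⟨τ, hτ, heq⟩ := hlip.extend_real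
  have h0 : (0 : ℝ) ∈ Icc 0 N := left_mem_Icc.2 hN0
  have hNN : N ∈ Icc 0 N := right_mem_Icc.2 hN0
  refine ⟨τ, hτ, hmono.congr heq, ?_, ?_, fun r hr => heq hr ▸ hmem r hr, fun r hr t => ?_⟩
  · rw [← heq h0]
    refine le_antisymm ?_ (hmem 0 h0).1
    have h1 := hself 0 h0
    have h2 := sub_le_measureReal_Ico hvol le_rfl (hmem 0 h0).2
    have h3 : ν.real (Ico a (σ 0)) ≤ ν.real (Iio (σ 0)) := measureReal_mono Ico_subset_Iio_self
    linarith
  · rw [← heq hNN]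
    refine le_antisymm (hmem N hNN).2 ((hiff N hNN b (right_mem_Icc.2 hab.le)).2 ?_)
    exact measureReal_mono (subset_univ _)
  · have hr' := Ioo_subset_Icc_self hr
    rw [← heq hr']
    rcases lt_or_ge t a with hta | hta
    · exact ⟨fun _ => (measureReal_Iio_left hν hta.le).trans_le hr.1.le,
        fun _ => hta.le.trans (hmem r hr').1⟩
    rcases le_or_gt t b with htb | htb
    · exact hiff r hr' t ⟨hta, htb⟩
    · refine ⟨fun h => absurd (h.trans (hmem r hr').2) (not_le.2 htb), fun h => ?_⟩
      rw [measureReal_Iio_right hν htb.le] at h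
      exact absurd hr.2 (not_lt.2 h)

theorem map_quantile {τ : ℝ → ℝ} (hτ : Measurable τ)
    (hiff : ∀ r ∈ Ioo 0 (ν.real univ), ∀ t, t ≤ τ r ↔ ν.real (Iio t) ≤ r) :
    Measure.map τ (volume.restrict (Ioo 0 (ν.real univ))) = ν := by
  have : IsFiniteMeasure (volume.restrict (Ioo 0 (ν.real univ))) := ⟨by simp⟩
  refine Measure.ext_of_Ici _ _ fun t => ?_
  rw [Measure.map_apply hτ measurableSet_Ici, Measure.restrict_apply (hτ measurableSet_Ici)]
  have hset : τ ⁻¹' Ici t ∩ Ioo 0 (ν.real univ) = Ici (ν.real (Iio t)) ∩ Ioo 0 (ν.real univ) := by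
    ext r
    exact ⟨fun h => ⟨(hiff r h.2 t).1 h.1, h.2⟩, fun h => ⟨(hiff r h.2 t).2 h.1, h.2⟩⟩
  rw [hset]
  have h1 : ν (Ici t) = ENNReal.ofReal (ν.real univ - ν.real (Iio t)) := by
    rw [← compl_Iio, ← ofReal_measureReal, measureReal_compl measurableSet_Iio]
  rw [h1]
  rcases (measureReal_nonneg (μ := ν) (s := Iio t)).eq_or_lt with h0 | hpos
  · have h2 : Ioo 0 (ν.real univ) ⊆ Ici 0 := by
      intro r hr
      exact hr.1.le
    rw [← h0, inter_eq_right.2 h2, Real.volume_Ioo]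
  · rw [show Ici (ν.real (Iio t)) ∩ Ioo 0 (ν.real univ) = Ico (ν.real (Iio t)) (ν.real univ) from
      Set.ext fun r => ⟨fun h => ⟨h.1, h.2.2⟩, fun h => ⟨h.1, hpos.trans_le h.1, h.2⟩⟩,
      Real.volume_Ico]

/-- Where `ν` has no atom the distribution function is continuous, so it inverts the quantile
function exactly. -/
theorem measureReal_Iio_quantile {τ : ℝ → ℝ}
    (hiff : ∀ r ∈ Ioo 0 (ν.real univ), ∀ t, t ≤ τ r ↔ ν.real (Iio t) ≤ r) {r : ℝ}
    (hr : r ∈ Ioo 0 (ν.real univ)) (h0 : ν {τ r} = 0) : ν.real (Iio (τ r)) = r := by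
  refine le_antisymm ((hiff r hr _).1 le_rfl) ?_
  have h1 : ν (Iic (τ r)) = ν (Iio (τ r)) := by
    refine le_antisymm ?_ (measure_mono Iio_subset_Iic_self)
    rw [← Iio_union_right]
    exact (measure_union_le _ _).trans_eq (by rw [h0, add_zero])
  have h2 : Tendsto (ν ∘ Iio) (𝓝[>] (τ r)) (𝓝 (ν (⋂ s > τ r, Iio s))) :=
    tendsto_measure_biInter_gt (fun s _ => measurableSet_Iio.nullMeasurableSet)
      (fun s t _ hst => Iio_subset_Iio hst) ⟨τ r + 1, by simp, measure_ne_top _ _⟩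
  have h3 : (⋂ s > τ r, Iio s) = Iic (τ r) := by
    ext s
    simp only [mem_iInter, mem_Iio, mem_Iic]
    exact ⟨fun h => le_of_forall_gt h, fun h s' hs' => h.trans_lt hs'⟩
  rw [h3, h1] at h2
  have h4 : ENNReal.ofReal r ≤ ν (Iio (τ r)) := by
    refine ge_of_tendsto h2 ?_
    filter_upwards [self_mem_nhdsWithin] with s hs
    rw [Function.comp, ← ofReal_measureReal]
    refine ENNReal.ofReal_le_ofReal (le_of_not_ge fun h => ?_)
    exact absurd ((hiff r hr s).2 h) (not_le.2 hs)
  rwa [← ofReal_measureReal, ENNReal.ofReal_le_ofReal_iff measureReal_nonneg] at h4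

/-- Away from atoms, `s < r` is equivalent to `τ s < τ r`, and the image of Lebesgue measure under
`τ` is `ν`. -/
theorem integral_comp_quantile {X : Type*} [NormedAddCommGroup X] [NormedSpace ℝ X] {τ : ℝ → ℝ}
    (hτ : Measurable τ)
    (hiff : ∀ r ∈ Ioo 0 (ν.real univ), ∀ t, t ≤ τ r ↔ ν.real (Iio t) ≤ r) {g : ℝ → X}
    (hg : StronglyMeasurable g) {r : ℝ} (hr : r ∈ Ioo 0 (ν.real univ)) (h0 : ν {τ r} = 0) :
    ∫ s in (0 : ℝ)..r, g (τ s) = ∫ t in Iio (τ r), g t ∂ν := by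
  have hset : Ioo 0 r = τ ⁻¹' Iio (τ r) ∩ Ioo 0 (ν.real univ) := by
    ext s
    constructor
    · intro hs
      have hs' : s ∈ Ioo 0 (ν.real univ) := ⟨hs.1, hs.2.trans hr.2⟩
      refine ⟨mem_preimage.2 (mem_Iio.2 (not_le.1 fun h => ?_)), hs'⟩
      have := (hiff s hs' _).1 h
      rw [measureReal_Iio_quantile hiff hr h0] at this
      exact absurd hs.2 (not_lt.2 this)
    · rintro ⟨hs, hs'⟩
      refine ⟨hs'.1, not_le.1 fun h => ?_⟩
      rw [← measureReal_Iio_quantile hiff hr h0] at h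
      exact absurd ((hiff s hs' _).2 h) (not_le.2 hs)
  rw [intervalIntegral.integral_of_le hr.1.le, integral_Ioc_eq_integral_Ioo, hset,
    ← Measure.restrict_restrict (hτ measurableSet_Iio)]
  conv_rhs => rw [← map_quantile hτ hiff]
  rw [setIntegral_map measurableSet_Iio hg.aestronglyMeasurable hτ.aemeasurable]

end Quantile

/-- A monotone function has positive derivative at most once on each of its level sets. -/
theorem countable_deriv_pos_of_mem {τ : ℝ → ℝ} {N : ℝ} (hτ : MonotoneOn τ (Icc 0 N)) {J : Set ℝ}
    (hJ : J.Countable) : {r | r ∈ Ioo 0 N ∧ τ r ∈ J ∧ 0 < deriv τ r}.Countable := by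
  have h1 : {r | r ∈ Ioo 0 N ∧ τ r ∈ J ∧ 0 < deriv τ r} ⊆
      ⋃ t ∈ J, {r | r ∈ Ioo 0 N ∧ τ r = t ∧ 0 < deriv τ r} := by
    rintro r ⟨hr, hrJ, hd⟩
    exact mem_biUnion hrJ ⟨hr, rfl, hd⟩
  refine (hJ.biUnion fun t _ => Set.Subsingleton.countable ?_).mono h1
  have key : ∀ r r', r ∈ Ioo 0 N → r' ∈ Ioo 0 N → τ r = t → τ r' = t → 0 < deriv τ r → ¬ r < r' := by
    intro r r' hr hr' h h' hd hlt
    have h2 : HasDerivWithinAt τ (deriv τ r) (Icc r r') r :=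
      (differentiableAt_of_deriv_ne_zero hd.ne').hasDerivAt.hasDerivWithinAt
    have h3 : HasDerivWithinAt τ 0 (Icc r r') r := by
      refine (hasDerivWithinAt_const r (Icc r r') t).congr (fun s hs => ?_) h
      have hs' : s ∈ Icc 0 N := ⟨hr.1.le.trans hs.1, hs.2.trans hr'.2.le⟩
      exact le_antisymm (h' ▸ hτ hs' (Ioo_subset_Icc_self hr') hs.2)
        (h ▸ hτ (Ioo_subset_Icc_self hr) hs' hs.1)
    have h4 := (uniqueDiffOn_Icc hlt r (left_mem_Icc.2 hlt.le)).eq_deriv _ h2 h3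
    exact hd.ne' h4
  rintro r ⟨hr, h, hd⟩ r' ⟨hr', h', hd'⟩
  rcases lt_trichotomy r r' with hlt | heq | hgt
  · exact absurd hlt (key r r' hr hr' h h' hd)
  · exact heq
  · exact absurd hgt (key r' r hr' hr h' h hd')

/-! ### Lipschitz parametrization of a BV curve -/

section Parametrization

variable {X : Type*} [NormedAddCommGroup X] [NormedSpace ℝ X] [FiniteDimensional ℝ X]
  {T : ℝ} {Ψ₀ Ψ : X → ℝ} {E : ℝ → X → ℝ} {a b : ℝ} {ν : Measure ℝ} [IsFiniteMeasure ν]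

open Classical in
/-- A curve with derivative `g ν` which is stable off a countable set is parametrized by the quantile
function of `ν`; its jumps are filled by segments. -/
theorem distB0_le_lintegral (hΨ₀ : IsGauge Ψ₀) (hΨ : IsViscousPotential Ψ₀ Ψ)
    (ha : 0 ≤ a) (hab : a < b) (hb : b ≤ T) (hν : ν (Ioo a b)ᶜ = 0)
    (hvol : volume.restrict (Ioo a b) ≤ ν) {g : ℝ → X} (hg : StronglyMeasurable g) {K : ℝ≥0}
    (hgK : ∀ t, ‖g t‖ ≤ K) {J : Set ℝ} (hJ : J.Countable) {v : ℝ → X} {x₀ x₁ : X}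
    (hν0 : ∀ t ∈ Ioo a b \ J, ν {t} = 0) (hv : ∀ t ∈ Ioo a b \ J, v t = x₀ + ∫ s in Iio t, g s ∂ν)
    (hstab : ∀ t ∈ Ioo a b \ J, -fderiv ℝ (E t) (v t) ∈ stableSet Ψ₀)
    (hx₁ : x₁ = x₀ + ∫ s, g s ∂ν) {R C : ℝ} (hR : ‖x₀‖ + ∫ s, ‖g s‖ ∂ν ≤ R)
    (hC : ∀ t ∈ Icc 0 T, ∀ x w : X, ‖x‖ ≤ R → contactPotential Ψ w (-fderiv ℝ (E t) x) ≤ C * ‖w‖) :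
    distB0 T Ψ₀ Ψ E a x₀ b x₁ ≤
      ∫⁻ t, (if t ∈ J then ENNReal.ofReal (C * ‖g t‖) else ENNReal.ofReal (Ψ₀ (g t))) ∂ν := by
  have : CompleteSpace X := FiniteDimensional.complete ℝ X
  borelize X
  obtain ⟨τ, hlip, hmono, hτ0, hτN, hmem, hiff⟩ := exists_quantile hab hν hvol
  have hτm : Measurable τ := hlip.continuous.measurable
  have hmap := map_quantile hτm hiff
  set N := ν.real univ with hN
  have hN0 : 0 < N := by
    by_contra! h
    have : N = 0 := le_antisymm h measureReal_nonneg
    rw [this, hτ0] at hτN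
    exact hab.ne hτN
  have hgτ : StronglyMeasurable fun r => g (τ r) := hg.comp_measurable hτm
  have hint : ∀ c d, IntervalIntegrable (fun r => g (τ r)) volume c d := fun c d => by
    rw [intervalIntegrable_iff]
    exact Measure.integrableOn_of_bounded (M := K) measure_Ioc_lt_top.ne
      hgτ.aestronglyMeasurable (Eventually.of_forall fun r => hgK _)
  set y : ℝ → X := fun r => x₀ + ∫ s in (0 : ℝ)..r, g (τ s) with hy
  have hylip : LipschitzWith K y := by
    refine LipschitzWith.of_dist_le_mul fun r s => ?_
    rw [dist_add_left, dist_eq_norm, intervalIntegral.integral_interval_sub_left (hint _ _)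
      (hint _ _), Real.dist_eq]
    exact intervalIntegral.norm_integral_le_of_norm_le_const fun x _ => hgK _
  have hint_map : ∫ r in (0 : ℝ)..N, g (τ r) = ∫ t, g t ∂ν := by
    rw [intervalIntegral.integral_of_le hN0.le, integral_Ioc_eq_integral_Ioo]
    conv_rhs => rw [← hmap]
    exact (integral_map hτm.aemeasurable hg.aestronglyMeasurable).symm
  have hnorm_map : ∫ r in (0 : ℝ)..N, ‖g (τ r)‖ = ∫ t, ‖g t‖ ∂ν := by
    rw [intervalIntegral.integral_of_le hN0.le, integral_Ioc_eq_integral_Ioo]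
    conv_rhs => rw [← hmap]
    exact (integral_map hτm.aemeasurable hg.norm.aestronglyMeasurable).symm
  have hyR : ∀ r ∈ Icc 0 N, ‖y r‖ ≤ R := by
    intro r hr
    refine le_trans (norm_add_le _ _) (le_trans ?_ hR)
    gcongr
    rw [← hnorm_map]
    refine (intervalIntegral.norm_integral_le_integral_norm hr.1).trans ?_
    exact intervalIntegral.integral_mono_interval le_rfl hr.1 hr.2
      (Eventually.of_forall fun _ => norm_nonneg _) (hint 0 N).norm
  have hcurve : IsAdmissibleCurve T a x₀ b x₁ 0 N τ y := by
    refine ⟨hN0, ⟨1, hlip.lipschitzOnWith⟩, ⟨K, hylip.lipschitzOnWith⟩, fun r hr =>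
      ⟨ha.trans (hmem r hr).1, (hmem r hr).2.trans hb⟩, ?_, hτ0, by simp [hy], hτN, ?_⟩
    · refine (ae_restrict_iff' measurableSet_Ioo).2 (Eventually.of_forall fun r hr => ?_)
      rw [← derivWithin_of_mem_nhds (Icc_mem_nhds hr.1 hr.2)]
      exact hmono.derivWithin_nonneg
    · rw [hx₁, hy]
      dsimp only
      rw [hint_map]
  refine (distB0_le hcurve).trans ?_
  have hG : Measurable fun t => if t ∈ J then ENNReal.ofReal (C * ‖g t‖)
      else ENNReal.ofReal (Ψ₀ (g t)) :=
    Measurable.ite hJ.measurableSet (hg.norm.measurable.const_mul C).ennreal_ofReal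
      (hΨ₀.continuous.measurable.comp hg.measurable).ennreal_ofReal
  conv_rhs => rw [← hmap]
  rw [lintegral_map hG hτm]
  have hae1 : ∀ᵐ r ∂volume.restrict (Ioo 0 N), τ r ∈ Ioo a b := by
    have h1 : ∀ᵐ t ∂(Measure.map τ (volume.restrict (Ioo 0 N))), t ∈ Ioo a b := by
      rw [hmap]; exact mem_ae_iff.2 hν
    exact ae_of_ae_map hτm.aemeasurable h1
  have hae2 : ∀ᵐ r ∂volume.restrict (Ioo 0 N), HasDerivAt y (g (τ r)) r := by
    refine (ae_restrict_iff' measurableSet_Ioo).2 ?_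
    filter_upwards [(hint 0 N).ae_hasDerivAt_integral] with r hr hr'
    have hmem' : r ∈ uIcc 0 N := by rw [uIcc_of_le hN0.le]; exact Ioo_subset_Icc_self hr'
    exact (hr hmem' 0 (by simp)).const_add x₀
  -- While `τ` sits at a time in `J` the clock stands still for almost every parameter, so only the
  -- finite potential `𝔭` is paid there and no stability is needed.
  have hae3 : ∀ᵐ r ∂volume.restrict (Ioo 0 N), r ∉ {r | r ∈ Ioo 0 N ∧ τ r ∈ J ∧ 0 < deriv τ r} :=
    ae_restrict_of_ae ((countable_deriv_pos_of_mem hmono hJ).ae_notMem _)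
  refine lintegral_mono_ae ?_
  filter_upwards [hae1, hae2, hae3, ae_restrict_mem measurableSet_Ioo] with r h1 h2 h3 h4
  have h4' := Ioo_subset_Icc_self h4
  rw [h2.deriv]
  by_cases hrJ : τ r ∈ J
  · rw [if_pos hrJ, dissipationB0_of_not_pos fun h => h3 ⟨h4, hrJ, h⟩]
    exact ENNReal.ofReal_le_ofReal (hC _ (hcurve.mem_Icc r h4') _ _ (hyR r h4'))
  · have hyv : y r = v (τ r) := by
      rw [hv _ ⟨h1, hrJ⟩, hy]
      dsimp only
      rw [integral_comp_quantile hτm hiff hg h4 (hν0 _ ⟨h1, hrJ⟩)]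
    rw [if_neg hrJ, hyv, dissipationB0_of_stable hΨ (hstab _ ⟨h1, hrJ⟩)]

end Parametrization

end RateIndep

namespace RateIndep

/-! ### The upper bound for `varB0` -/

section Upper

variable {X : Type*} [NormedAddCommGroup X] [NormedSpace ℝ X] [FiniteDimensional ℝ X]
  {T : ℝ} {Ψ₀ Ψ : X → ℝ} {E : ℝ → X → ℝ} {u : ℝ → X}

theorem norm_derivMeasure_singleton_le (t : ℝ) :
    ‖derivMeasure T u {t}‖ ≤ (derivMeasure T u).variation.real {t} := by
  have := isFiniteMeasure_variation (derivMeasure T u)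
  rw [Measure.real, ← toReal_enorm]
  exact ENNReal.toReal_mono (measure_ne_top _ _) (VectorMeasure.enorm_measure_le_variation _ _)

/-- The derivative of `u` on `(a,b)` has a bounded density with respect to a measure that carries no
mass outside of the jumps, apart from the diffuse reference measure. -/
theorem exists_bounded_density (hT : 0 < T) (hu : BoundedVariationOn u (Icc 0 T)) :
    ∃ (K : ℝ≥0) (g : ℝ → X), StronglyMeasurable g ∧ (∀ t, ‖g t‖ ≤ K) ∧
      (∀ᵐ t ∂(refMeasure T u), g t = diffuseDensity T u t) ∧
      ∀ a b, 0 ≤ a → b ≤ T → ∀ A, MeasurableSet A →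
        ∫ t in A, g t ∂((refMeasure T u).restrict (Ioo a b) +
          (derivMeasure T u).variation.restrict (jumpSet T u ∩ Ioo a b)) =
        derivMeasure T u (A ∩ Ioo a b) := by
  classical
  borelize X
  have := isFiniteMeasure_refMeasure (T := T) (u := u)
  have := isFiniteMeasure_variation (derivMeasure T u)
  have hJ := countable_jumpSet hT hu
  have hJm := measurableSet_jumpSet hT hu
  obtain ⟨K, hK⟩ := exists_norm_diffuseDensity_le (T := T) (u := u)
  set m := (derivMeasure T u).variation with hm
  set h : ℝ → X := fun t => if ‖diffuseDensity T u t‖ ≤ max K 1 then diffuseDensity T u t else 0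
    with hh
  -- At a jump the density is the jump divided by the variation of the atom, hence of norm at most
  -- `1`; this explains `max K 1`.
  set g : ℝ → X := fun t => if t ∈ jumpSet T u then (m.real {t})⁻¹ • derivMeasure T u {t} else h t
    with hg
  have hhm : Measurable h := Measurable.ite
    (measurableSet_le measurable_diffuseDensity.norm measurable_const) measurable_diffuseDensity
    measurable_const
  have hgm : Measurable g := by
    refine hhm.measurable_of_countable_ne (hJ.mono ?_)
    intro t ht
    by_contra hcon
    exact ht (if_neg hcon).symm
  have hgae : ∀ᵐ t ∂(refMeasure T u), g t = diffuseDensity T u t := by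
    have h1 : ∀ᵐ t ∂(refMeasure T u), t ∉ jumpSet T u :=
      measure_eq_zero_iff_ae_notMem.1 (refMeasure_jumpSet hT hu)
    filter_upwards [hK, h1] with t ht ht1
    simp only [hg, hh]
    rw [if_neg ht1, if_pos (ht.trans (le_max_left _ _))]
  have hgK : ∀ t, ‖g t‖ ≤ max K 1 := by
    intro t
    simp only [hg, hh]
    split_ifs with h1 h2
    · refine le_trans ?_ (le_max_right _ _)
      rw [norm_smul, norm_inv, Real.norm_of_nonneg measureReal_nonneg]
      exact inv_mul_le_one_of_le₀ (norm_derivMeasure_singleton_le t) measureReal_nonneg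
    · exact h2
    · rw [norm_zero]
      exact zero_le_one.trans (le_max_right _ _)
  refine ⟨⟨max K 1, zero_le_one.trans (le_max_right _ _)⟩, g, hgm.stronglyMeasurable, hgK, hgae,
    fun a b ha hb A hA => ?_⟩
  have hint : ∀ (ν : Measure ℝ) [IsFiniteMeasure ν], Integrable g ν := fun ν _ =>
    Integrable.of_bound hgm.aestronglyMeasurable _ (Eventually.of_forall hgK)
  have hAm := hA.inter (measurableSet_Ioo (a := a) (b := b))
  have hsub : A ∩ Ioo a b ⊆ Ioo 0 T := inter_subset_right.trans (Ioo_subset_Ioo ha hb)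
  rw [Measure.restrict_add, Measure.restrict_restrict hA, Measure.restrict_restrict hA,
    integral_add_measure (hint _) (hint _), derivMeasure_eq_add hT hu hAm hsub]
  congr 1
  · rw [← setIntegral_diffuseDensity hAm]
    exact integral_congr_ae (ae_restrict_of_ae hgae)
  · rw [show A ∩ (jumpSet T u ∩ Ioo a b) = A ∩ Ioo a b ∩ jumpSet T u by
      rw [inter_comm (jumpSet T u), inter_assoc]]
    have hc : (A ∩ Ioo a b ∩ jumpSet T u).Countable := hJ.mono inter_subset_right
    rw [setIntegral_countable _ hc (hint _).integrableOn, derivMeasure_countable hc]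
    refine tsum_congr fun t => ?_
    simp only [hg]
    rw [if_pos t.2.2]
    rcases eq_or_ne (m.real {(t : ℝ)}) 0 with h0 | h0
    · have := norm_derivMeasure_singleton_le (T := T) (u := u) (t : ℝ)
      rw [← hm, h0] at this
      rw [h0, zero_smul, norm_le_zero_iff.1 this]
    · rw [smul_inv_smul₀ h0]

/-- The cost between `u(a₊)` and `u(b₋)` is controlled by the diffuse variation and the size of the
jumps. -/
theorem exists_distB0_right_left_le (hT : 0 < T) (hΨ₀ : IsGauge Ψ₀) (hΨ : IsViscousPotential Ψ₀ Ψ)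
    (hE : IsAdmissibleEnergy T E) (hu : BoundedVariationOn u (Icc 0 T)) :
    ∃ C : ℝ, ∀ a b, 0 ≤ a → a < b → b ≤ T →
      (∀ t ∈ Ioo a b \ jumpSet T u, -fderiv ℝ (E t) (u t) ∈ stableSet Ψ₀) →
      distB0 T Ψ₀ Ψ E a (right T u a) b (left T u b) ≤ diffuseVar T Ψ₀ u a b +
        ENNReal.ofReal C * (derivMeasure T u).variation (jumpSet T u ∩ Ioo a b) := by
  classical
  borelize X
  have := isFiniteMeasure_refMeasure (T := T) (u := u)
  have := isFiniteMeasure_variation (derivMeasure T u)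
  have hJ := countable_jumpSet hT hu
  have hJm := measurableSet_jumpSet hT hu
  obtain ⟨K, g, hgm, hgK, hgae, hgint⟩ := exists_bounded_density hT hu
  set m := (derivMeasure T u).variation with hm
  obtain ⟨R, hR0, hR⟩ := exists_norm_bound hT hu
  -- The radius bounds the starting point plus the length of the whole curve, which is at most `K`
  -- times the mass of `ν`.
  obtain ⟨C, hC0, hC, -⟩ := exists_distB0_segment_le hT hΨ₀ hΨ hE
    (R + K * ((refMeasure T u).real univ + m.real univ))
  refine ⟨C * K, fun a b ha hab hb hst => ?_⟩
  set ν := (refMeasure T u).restrict (Ioo a b) + m.restrict (jumpSet T u ∩ Ioo a b) with hν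
  have hνc : ν (Ioo a b)ᶜ = 0 := by
    rw [hν, Measure.add_apply, Measure.restrict_apply measurableSet_Ioo.compl,
      Measure.restrict_apply measurableSet_Ioo.compl, compl_inter_self, measure_empty, zero_add]
    refine measure_mono_null ?_ measure_empty (μ := m)
    rintro t ⟨h1, h2⟩
    exact absurd h2.2 h1
  have hvol : volume.restrict (Ioo a b) ≤ ν := by
    refine le_trans ?_ (Measure.le_add_right le_rfl)
    have := Measure.restrict_mono (subset_refl (Ioo a b))
      (volume_restrict_le_refMeasure (T := T) (u := u))
    rwa [Measure.restrict_restrict measurableSet_Ioo,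
      inter_eq_left.2 (Ioo_subset_Ioo ha hb)] at this
  have hνreal : ν.real univ ≤ (refMeasure T u).real univ + m.real univ := by
    rw [Measure.real, Measure.real, Measure.real,
      ← ENNReal.toReal_add (measure_ne_top _ _) (measure_ne_top _ _)]
    refine ENNReal.toReal_mono (by finiteness) ?_
    rw [hν, Measure.add_apply]
    exact add_le_add (Measure.restrict_apply_le _ _) (Measure.restrict_apply_le _ _)
  have hkey : ∀ t, a < t → t ≤ b → right T u a + ∫ s in Iio t, g s ∂ν = left T u t := by
    intro t hat htb
    rw [hgint a b ha hb _ measurableSet_Iio, show Iio t ∩ Ioo a b = Ioo a t from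
      Set.ext fun s => ⟨fun h => ⟨h.2.1, h.1⟩, fun h => ⟨h.2, h.1, h.2.trans_le htb⟩⟩,
      derivMeasure_Ioo hT hu hat, add_sub_cancel]
  refine (distB0_le_lintegral (ν := ν) (g := g) (K := K) (J := jumpSet T u) (v := u)
    (R := R + K * ((refMeasure T u).real univ + m.real univ)) (C := C) hΨ₀ hΨ ha hab hb hνc hvol
    hgm hgK hJ ?_ ?_ hst ?_ ?_ hC).trans ?_
  · rintro t ⟨ht, htJ⟩
    rw [hν, Measure.add_apply, Measure.restrict_apply (measurableSet_singleton t),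
      Measure.restrict_apply (measurableSet_singleton t), add_eq_zero]
    refine ⟨measure_mono_null inter_subset_left (refMeasure_singleton hT hu t), ?_⟩
    refine measure_mono_null ?_ measure_empty (μ := m)
    rintro s ⟨h1, h2⟩
    rw [mem_singleton_iff.1 h1] at h2
    exact absurd h2.1 htJ
  · rintro t ⟨ht, htJ⟩
    rw [hkey t ht.1 ht.2.le]
    exact (left_right_of_notMem_jumpSet ⟨ha.trans ht.1.le, ht.2.le.trans hb⟩ htJ).1.symm
  · rw [← hkey b hab le_rfl]
    congr 1
    conv_rhs => rw [← setIntegral_univ]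
    rw [hgint a b ha hb _ measurableSet_Iio, hgint a b ha hb _ MeasurableSet.univ, univ_inter,
      inter_eq_right.2 Ioo_subset_Iio_self]
  · have h1 := norm_integral_le_of_norm_le_const (μ := ν) (f := fun s => ‖g s‖) (C := K)
      (Eventually.of_forall fun s => by rw [norm_norm]; exact hgK s)
    rw [Real.norm_of_nonneg (integral_nonneg fun _ => norm_nonneg _)] at h1
    refine add_le_add (norm_right_le hT hu hR ⟨ha, hab.trans_le hb⟩) (h1.trans ?_)
    gcongr
  · rw [hν, lintegral_add_measure]
    refine add_le_add (le_of_eq ?_) ?_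
    · refine lintegral_congr_ae ?_
      have h1 : ∀ᵐ t ∂(refMeasure T u), t ∉ jumpSet T u :=
        measure_eq_zero_iff_ae_notMem.1 (refMeasure_jumpSet hT hu)
      filter_upwards [ae_restrict_of_ae hgae, ae_restrict_of_ae h1] with t h2 h3
      rw [if_neg h3, h2]
    · calc _ ≤ ∫⁻ _ in jumpSet T u ∩ Ioo a b, ENNReal.ofReal (C * K) ∂m := by
            refine setLIntegral_mono measurable_const fun t ht => ?_
            rw [if_pos ht.1]
            exact ENNReal.ofReal_le_ofReal (mul_le_mul_of_nonneg_left (hgK t) hC0)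
        _ = _ := setLIntegral_const _ _

theorem diffuseVar_add_le {a b c : ℝ} (hac : a ≤ c) (hcb : c ≤ b) :
    diffuseVar T Ψ₀ u a c + diffuseVar T Ψ₀ u c b ≤ diffuseVar T Ψ₀ u a b := by
  have hd : Disjoint (Ioo a c) (Ioo c b) :=
    disjoint_left.2 fun t h1 h2 => lt_asymm h1.2 h2.1
  rw [diffuseVar, diffuseVar, ← lintegral_union measurableSet_Ioo hd]
  exact lintegral_mono_set (union_subset (Ioo_subset_Ioo_right hcb) (Ioo_subset_Ioo_left hac))

/-- The cost of passing through the jump of `u` at `t`. -/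
noncomputable def jumpCost (T : ℝ) (Ψ : X → ℝ) (E : ℝ → X → ℝ) (u : ℝ → X) (t : ℝ) : ℝ≥0∞ :=
  finslerCost Ψ E t (left T u t) (u t) + finslerCost Ψ E t (u t) (right T u t)

theorem distB0_left_right_le (hT : 0 < T) (hΨ₀ : IsGauge Ψ₀) (hΨ : IsViscousPotential Ψ₀ Ψ)
    (hE : IsAdmissibleEnergy T E) {t : ℝ} (ht : t ∈ Icc 0 T) :
    distB0 T Ψ₀ Ψ E t (left T u t) t (right T u t) ≤ jumpCost T Ψ E u t := by
  rw [jumpCost, finslerCost_eq_distB0 hT hΨ₀ hΨ hE ht, finslerCost_eq_distB0 hT hΨ₀ hΨ hE ht]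
  exact distB0_triangle _ _ _ _ _ _

/-- The jumps in `F` are crossed at their true cost, all the others by segments. It matters that `C`
does not depend on `F`, so that the last term tends to zero as `F` exhausts the jumps. The induction
splits the interval at the last point of `F`. -/
theorem exists_distB0_right_left_le_sum (hT : 0 < T) (hΨ₀ : IsGauge Ψ₀)
    (hΨ : IsViscousPotential Ψ₀ Ψ) (hE : IsAdmissibleEnergy T E)
    (hu : BoundedVariationOn u (Icc 0 T)) :
    ∃ C : ℝ, ∀ (F : Finset ℝ) (a b : ℝ), 0 ≤ a → a < b → b ≤ T → (∀ t ∈ F, t ∈ Ioo a b) →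
      (∀ t ∈ Ioo a b \ jumpSet T u, -fderiv ℝ (E t) (u t) ∈ stableSet Ψ₀) →
      distB0 T Ψ₀ Ψ E a (right T u a) b (left T u b) ≤
        diffuseVar T Ψ₀ u a b + ∑ t ∈ F, jumpCost T Ψ E u t +
        ENNReal.ofReal C * (derivMeasure T u).variation ((jumpSet T u ∩ Ioo a b) \ F) := by
  obtain ⟨C, hC⟩ := exists_distB0_right_left_le hT hΨ₀ hΨ hE hu
  have hJm := measurableSet_jumpSet hT hu
  refine ⟨C, fun F => ?_⟩
  induction F using Finset.induction_on_max with
  | empty =>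
    intro a b ha hab hb _ hst
    simpa using hC a b ha hab hb hst
  | insert t F htF ih =>
    intro a b ha hab hb hF hst
    have ht := hF t (Finset.mem_insert_self _ _)
    have htT : t ∈ Icc 0 T := ⟨ha.trans ht.1.le, ht.2.le.trans hb⟩
    have h1 := ih a t ha ht.1 htT.2
      (fun s hs => ⟨(hF s (Finset.mem_insert_of_mem hs)).1, htF s hs⟩)
      (fun s hs => hst s ⟨⟨hs.1.1, hs.1.2.trans ht.2⟩, hs.2⟩)
    have h2 := hC t b htT.1 ht.2 hb (fun s hs => hst s ⟨⟨ht.1.trans hs.1.1, hs.1.2⟩, hs.2⟩)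
    have h3 : distB0 T Ψ₀ Ψ E a (right T u a) b (left T u b) ≤
        distB0 T Ψ₀ Ψ E a (right T u a) t (left T u t) +
          (jumpCost T Ψ E u t + distB0 T Ψ₀ Ψ E t (right T u t) b (left T u b)) :=
      (distB0_triangle _ t _ _ (left T u t) _).trans (add_le_add le_rfl
        ((distB0_triangle _ t _ _ (right T u t) _).trans
          (add_le_add (distB0_left_right_le hT hΨ₀ hΨ hE htT) le_rfl)))
    have h4 : (derivMeasure T u).variation ((jumpSet T u ∩ Ioo a t) \ F) +
        (derivMeasure T u).variation (jumpSet T u ∩ Ioo t b) ≤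
        (derivMeasure T u).variation ((jumpSet T u ∩ Ioo a b) \ ↑(insert t F)) := by
      rw [← measure_union _ (hJm.inter measurableSet_Ioo)]
      · refine measure_mono ?_
        rintro s (⟨⟨hsJ, hs⟩, hsF⟩ | ⟨hsJ, hs⟩)
        · refine ⟨⟨hsJ, hs.1, hs.2.trans ht.2⟩, fun h => ?_⟩
          rcases Finset.mem_insert.1 (Finset.mem_coe.1 h) with rfl | h
          · exact lt_irrefl _ hs.2
          · exact hsF h
        · refine ⟨⟨hsJ, ht.1.trans hs.1, hs.2⟩, fun h => ?_⟩
          rcases Finset.mem_insert.1 (Finset.mem_coe.1 h) with rfl | h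
          · exact lt_irrefl _ hs.1
          · exact lt_asymm hs.1 (htF s h)
      · exact disjoint_left.2 fun s hs hs' => lt_asymm hs.1.2.2 hs'.2.1
    rw [Finset.sum_insert fun h => lt_irrefl _ (htF t h)]
    calc _ ≤ _ := h3
      _ ≤ _ := add_le_add h1 (add_le_add le_rfl h2)
      _ = diffuseVar T Ψ₀ u a t + diffuseVar T Ψ₀ u t b +
          (jumpCost T Ψ E u t + ∑ s ∈ F, jumpCost T Ψ E u s) +
          ENNReal.ofReal C * ((derivMeasure T u).variation ((jumpSet T u ∩ Ioo a t) \ F) +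
          (derivMeasure T u).variation (jumpSet T u ∩ Ioo t b)) := by ring
      _ ≤ _ := by
        gcongr
        exact diffuseVar_add_le ht.1.le ht.2.le

theorem pVar_eq {a b : ℝ} (hab : a < b) : pVar T Ψ₀ Ψ E u a b = diffuseVar T Ψ₀ u a b +
    (finslerCost Ψ E a (u a) (right T u a) + finslerCost Ψ E b (left T u b) (u b) +
      ∑' t : ↥(jumpSet T u ∩ Ioo a b), jumpCost T Ψ E u t) := by
  rw [pVar, if_pos hab]; rfl

theorem distB0_le_pVar (hT : 0 < T) (hΨ₀ : IsGauge Ψ₀) (hΨ : IsViscousPotential Ψ₀ Ψ)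
    (hE : IsAdmissibleEnergy T E) (hu : BoundedVariationOn u (Icc 0 T)) {a b : ℝ} (ha : 0 ≤ a)
    (hab : a < b) (hb : b ≤ T)
    (hst : ∀ t ∈ Ioo a b \ jumpSet T u, -fderiv ℝ (E t) (u t) ∈ stableSet Ψ₀) :
    distB0 T Ψ₀ Ψ E a (u a) b (u b) ≤ pVar T Ψ₀ Ψ E u a b := by
  classical
  have haT : a ∈ Icc 0 T := ⟨ha, hab.le.trans hb⟩
  have hbT : b ∈ Icc 0 T := ⟨ha.trans hab.le, hb⟩
  have := isFiniteMeasure_variation (derivMeasure T u)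
  set m := (derivMeasure T u).variation with hm
  obtain ⟨C, hC⟩ := exists_distB0_right_left_le_sum hT hΨ₀ hΨ hE hu
  set S := jumpSet T u ∩ Ioo a b with hS
  have hScount : S.Countable := (countable_jumpSet hT hu).mono inter_subset_left
  have : Countable S := hScount.to_subtype
  have hsum : ∑' t : S, m {(t : ℝ)} ≠ ⊤ := by
    have h1 : m (⋃ t : S, {(t : ℝ)}) = ∑' t : S, m {(t : ℝ)} :=
      measure_iUnion (fun s t hst => by
        simpa [Function.onFun, Subtype.ext_iff] using hst) fun t => measurableSet_singleton _
    rw [← h1]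
    exact measure_ne_top _ _
  have hmid : distB0 T Ψ₀ Ψ E a (right T u a) b (left T u b) ≤
      diffuseVar T Ψ₀ u a b + ∑' t : S, jumpCost T Ψ E u t := by
    -- The atoms at the jump points are summable, so the mass outside `F` vanishes as the finite set
    -- `F` grows.
    have h0 := ENNReal.tendsto_tsum_compl_atTop_zero hsum
    have h1 : Tendsto (fun F : Finset S => diffuseVar T Ψ₀ u a b + ∑' t : S, jumpCost T Ψ E u t +
        ENNReal.ofReal C * ∑' t : {x // x ∉ F}, m {((t : S) : ℝ)}) atTop
        (𝓝 (diffuseVar T Ψ₀ u a b + ∑' t : S, jumpCost T Ψ E u t + ENNReal.ofReal C * 0)) :=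
      tendsto_const_nhds.add (ENNReal.Tendsto.const_mul h0 (Or.inr ENNReal.ofReal_ne_top))
    rw [mul_zero, add_zero] at h1
    refine ge_of_tendsto' h1 fun F => ?_
    refine (hC (F.map (Function.Embedding.subtype _)) a b ha hab hb ?_ hst).trans ?_
    · intro t ht
      obtain ⟨t', -, rfl⟩ := Finset.mem_map.1 ht
      exact t'.2.2
    · rw [Finset.sum_map]
      refine add_le_add (add_le_add le_rfl (ENNReal.sum_le_tsum _)) ?_
      gcongr
      refine (measure_mono ?_).trans (measure_iUnion_le _)
      rintro t ⟨ht, htF⟩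
      refine mem_iUnion.2 ⟨⟨⟨t, ht⟩, fun h => htF ?_⟩, rfl⟩
      simpa using ⟨ht, h⟩
  rw [pVar_eq hab, finslerCost_eq_distB0 hT hΨ₀ hΨ hE haT, finslerCost_eq_distB0 hT hΨ₀ hΨ hE hbT]
  calc _ ≤ distB0 T Ψ₀ Ψ E a (u a) a (right T u a) +
        (distB0 T Ψ₀ Ψ E a (right T u a) b (left T u b) +
          distB0 T Ψ₀ Ψ E b (left T u b) b (u b)) :=
        (distB0_triangle _ a _ _ (right T u a) _).trans
          (add_le_add le_rfl (distB0_triangle _ b _ _ (left T u b) _))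
    _ ≤ _ := add_le_add le_rfl (add_le_add hmid le_rfl)
    _ = _ := by ring

theorem jumpCost_eq_zero (hT : 0 < T) (hΨ₀ : IsGauge Ψ₀) (hΨ : IsViscousPotential Ψ₀ Ψ)
    (hE : IsAdmissibleEnergy T E) {t : ℝ} (ht : t ∈ Icc 0 T) (hJ : t ∉ jumpSet T u) :
    jumpCost T Ψ E u t = 0 := by
  have h := left_right_of_notMem_jumpSet ht hJ
  rw [jumpCost, h.1, h.2, finslerCost_eq_distB0 hT hΨ₀ hΨ hE ht, distB0_self hΨ₀ hΨ ht, add_zero]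

/-- Non-jump points cost nothing, so the sum runs over a set that no longer depends on the jump set
and can be split at a point. -/
theorem tsum_jumpCost_eq (hT : 0 < T) (hΨ₀ : IsGauge Ψ₀) (hΨ : IsViscousPotential Ψ₀ Ψ)
    (hE : IsAdmissibleEnergy T E) {a b : ℝ} (ha : 0 ≤ a) (hb : b ≤ T) :
    ∑' t : ↥(jumpSet T u ∩ Ioo a b), jumpCost T Ψ E u t =
      ∑' t, (Ioo a b).indicator (jumpCost T Ψ E u) t := by
  rw [tsum_subtype (jumpSet T u ∩ Ioo a b) (jumpCost T Ψ E u)]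
  refine tsum_congr fun t => ?_
  by_cases ht : t ∈ Ioo a b
  · rw [indicator_of_mem ht]
    by_cases hJ : t ∈ jumpSet T u
    · exact indicator_of_mem (show t ∈ jumpSet T u ∩ Ioo a b from ⟨hJ, ht⟩) _
    · rw [indicator_of_notMem fun h => hJ h.1, jumpCost_eq_zero hT hΨ₀ hΨ hE
        ⟨ha.trans ht.1.le, ht.2.le.trans hb⟩ hJ]
  · rw [indicator_of_notMem ht, indicator_of_notMem fun h => ht h.2]

theorem diffuseVar_add (hT : 0 < T) (hu : BoundedVariationOn u (Icc 0 T)) {a b c : ℝ}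
    (hac : a < c) (hcb : c < b) :
    diffuseVar T Ψ₀ u a c + diffuseVar T Ψ₀ u c b = diffuseVar T Ψ₀ u a b := by
  have hd : Disjoint (Ioo a c) (Ioo c b) :=
    disjoint_left.2 fun t h1 h2 => lt_asymm h1.2 h2.1
  rw [diffuseVar, diffuseVar, ← lintegral_union measurableSet_Ioo hd]
  refine setLIntegral_congr (eventuallyEq_set.2 ?_)
  filter_upwards [measure_eq_zero_iff_ae_notMem.1 (refMeasure_singleton hT hu c)] with t ht
  refine ⟨fun h => h.elim (fun h => ⟨h.1, h.2.trans hcb⟩) fun h => ⟨hac.trans h.1, h.2⟩, fun h => ?_⟩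
  rcases lt_trichotomy t c with h1 | h1 | h1
  · exact Or.inl ⟨h.1, h1⟩
  · exact absurd h1 ht
  · exact Or.inr ⟨h1, h.2⟩

/-- The two end costs charged at the splitting point `c` are exactly the cost of the jump at `c`,
and the diffuse part does not charge `c`. -/
theorem pVar_add (hT : 0 < T) (hΨ₀ : IsGauge Ψ₀) (hΨ : IsViscousPotential Ψ₀ Ψ)
    (hE : IsAdmissibleEnergy T E) (hu : BoundedVariationOn u (Icc 0 T)) {a b c : ℝ} (ha : 0 ≤ a)
    (hac : a ≤ c) (hcb : c ≤ b) (hb : b ≤ T) :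
    pVar T Ψ₀ Ψ E u a c + pVar T Ψ₀ Ψ E u c b = pVar T Ψ₀ Ψ E u a b := by
  rcases hac.eq_or_lt with rfl | hac
  · simp [pVar]
  rcases hcb.eq_or_lt with rfl | hcb
  · simp [pVar]
  rw [pVar_eq hac, pVar_eq hcb, pVar_eq (hac.trans hcb), ← diffuseVar_add hT hu hac hcb,
    tsum_jumpCost_eq hT hΨ₀ hΨ hE ha (hcb.le.trans hb),
    tsum_jumpCost_eq hT hΨ₀ hΨ hE (ha.trans hac.le) hb, tsum_jumpCost_eq hT hΨ₀ hΨ hE ha hb]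
  have h1 : (Ioo a b).indicator (jumpCost T Ψ E u) = fun t =>
      (Ioo a c).indicator (jumpCost T Ψ E u) t + (({c} : Set ℝ).indicator (jumpCost T Ψ E u) t +
        (Ioo c b).indicator (jumpCost T Ψ E u) t) := by
    funext t
    simp only [indicator, mem_Ioo, mem_singleton_iff]
    rcases lt_trichotomy t c with h | h | h
    · simp [h, h.ne, h.not_gt, h.trans hcb]
    · simp [h, hac, hcb]
    · simp [h, h.ne', h.not_gt, hac.trans h]
  rw [h1, ENNReal.summable.tsum_add ENNReal.summable, ENNReal.summable.tsum_add ENNReal.summable]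
  have h2 : ∑' t, ({c} : Set ℝ).indicator (jumpCost T Ψ E u) t = jumpCost T Ψ E u c := by
    rw [tsum_eq_single c fun t (ht : t ≠ c) => indicator_of_notMem
      (show t ∉ ({c} : Set ℝ) from ht) _, indicator_of_mem (mem_singleton c)]
  rw [h2, jumpCost]
  ring

theorem varB0_le_pVar (hT : 0 < T) (hΨ₀ : IsGauge Ψ₀) (hΨ : IsViscousPotential Ψ₀ Ψ)
    (hE : IsAdmissibleEnergy T E) (hu : BoundedVariationOn u (Icc 0 T)) {a b : ℝ} (ha : 0 ≤ a)
    (hb : b ≤ T)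
    (hst : ∀ t ∈ Ioo a b \ jumpSet T u, -fderiv ℝ (E t) (u t) ∈ stableSet Ψ₀) :
    varB0 T Ψ₀ Ψ E u a b ≤ pVar T Ψ₀ Ψ E u a b := by
  refine varB0_le fun M s hs h0 hM => ?_
  have hmono : ∀ {i j}, i ≤ j → j ≤ M → s i ≤ s j := fun hij hj =>
    hs.monotoneOn (mem_Iic.2 (hij.trans hj)) (mem_Iic.2 hj) hij
  have key : ∀ n ≤ M, ∑ m ∈ Finset.range n,
      distB0 T Ψ₀ Ψ E (s m) (u (s m)) (s (m + 1)) (u (s (m + 1))) ≤ pVar T Ψ₀ Ψ E u a (s n) := by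
    intro n
    induction n with
    | zero => simp
    | succ n ih =>
      intro hn
      have h1 : a ≤ s n := h0 ▸ hmono (Nat.zero_le n) (by omega)
      have h2 : s (n + 1) ≤ b := hM ▸ hmono hn le_rfl
      have h3 : s n < s (n + 1) := hs (mem_Iic.2 (by omega)) (mem_Iic.2 hn) (Nat.lt_succ_self n)
      rw [Finset.sum_range_succ, ← pVar_add hT hΨ₀ hΨ hE hu ha h1 h3.le (h2.trans hb)]
      exact add_le_add (ih (by omega)) (distB0_le_pVar hT hΨ₀ hΨ hE hu (ha.trans h1) h3
        (h2.trans hb) fun t ht => hst t ⟨⟨h1.trans_lt ht.1.1, ht.1.2.trans_le h2⟩, ht.2⟩)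
  exact hM ▸ key M le_rfl

/-- Stability almost everywhere implies stability at every point of continuity. -/
theorem LocallyStableOn.stable (hT : 0 < T) (hE : IsAdmissibleEnergy T E)
    (hu : BoundedVariationOn u (Icc 0 T)) {a b : ℝ} (ha : 0 ≤ a) (hb : b ≤ T)
    (h : LocallyStableOn T Ψ₀ E u (Ioo a b)) {t : ℝ} (ht : t ∈ Ioo a b \ jumpSet T u) :
    -fderiv ℝ (E t) (u t) ∈ stableSet Ψ₀ := by
  have htT : t ∈ Ioo 0 T := Ioo_subset_Ioo ha hb ht.1
  have hcont := continuousAt_of_notMem_jumpSet hT hu htT ht.2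
  have hc2 : Tendsto (fun s => -fderiv ℝ (E s) (u s)) (𝓝 t) (𝓝 (-fderiv ℝ (E t) (u t))) := by
    have h1 := (hE.continuousOn_fderiv hT).continuousAt (x := (t, u t))
      (prod_mem_nhds (Icc_mem_nhds htT.1 htT.2) univ_mem)
    exact (h1.tendsto.comp (continuousAt_id.prodMk hcont)).neg
  refine IsGauge.isClosed_stableSet.mem_of_frequently_of_tendsto ?_ hc2
  have h1 : ∀ᵐ s, s ∈ Ioo a b → -fderiv ℝ (E s) (u s) ∈ stableSet Ψ₀ := by
    filter_upwards [h, (countable_jumpSet hT hu).ae_notMem volume] with s hs hsJ hsI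
    exact hs ⟨hsI, hsJ⟩
  intro hev
  obtain ⟨V, hV, hVo, htV⟩ := eventually_nhds_iff.1 (hev.and (Ioo_mem_nhds ht.1.1 ht.1.2))
  have hnull : volume V = 0 := by
    refine measure_mono_null ?_ (ae_iff.1 h1)
    intro s hs hcon
    exact (hV s hs).1 (hcon (hV s hs).2)
  exact (hVo.measure_pos volume ⟨t, htV⟩).ne' hnull

end Upper

end RateIndep

namespace RateIndep

/-! ### The diffuse variation is controlled by increments -/

/-- A density whose integrals against `μ` are dominated by a measure `κ`, after testing with the
functionals in a separable set, is dominated in the sense of the support function. -/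
theorem lintegral_le_of_forall_functional {X : Type*} [NormedAddCommGroup X] [NormedSpace ℝ X]
    [FiniteDimensional ℝ X] {Ψ₀ : X → ℝ} (hΨ₀ : IsGauge Ψ₀) {μ κ : Measure ℝ} [IsFiniteMeasure μ]
    [IsFiniteMeasure κ] {D : ℝ → X} (hD : Integrable D μ)
    (h : ∀ ξ ∈ stableSet Ψ₀, ∀ S, MeasurableSet S → ξ (∫ t in S, D t ∂μ) ≤ κ.real S) :
    ∫⁻ t, ENNReal.ofReal (Ψ₀ (D t)) ∂μ ≤ κ univ := by
  have : CompleteSpace X := FiniteDimensional.complete ℝ X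
  have : ProperSpace (X →L[ℝ] ℝ) := FiniteDimensional.proper ℝ _
  have hne : Nonempty (stableSet Ψ₀) := by
    obtain ⟨ξ, hξ, -⟩ := hΨ₀.exists_dual 0
    exact ⟨⟨ξ, hξ⟩⟩
  set f : ℝ → ℝ := fun t => (κ.rnDeriv μ t).toReal with hf
  have hfint : Integrable f μ := Measure.integrable_toReal_rnDeriv
  -- On `S₀`, which carries `μ`, the measure `κ` is absolutely continuous, so testing within `S₀`
  -- involves only the density of `κ`.
  obtain ⟨S₀, hS₀, hs, hμ⟩ := Measure.mutuallySingular_singularPart κ μ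
  have key : ∀ ξ : stableSet Ψ₀, (fun t => (ξ : X →L[ℝ] ℝ) (D t)) ≤ᵐ[μ] f := by
    intro ξ
    refine ae_le_of_forall_setIntegral_le ((ξ : X →L[ℝ] ℝ).integrable_comp hD) hfint
      fun S hS _ => ?_
    have hSS : μ.restrict S = μ.restrict (S ∩ S₀) := by
      refine Measure.restrict_congr_set (eventuallyEq_set.2 ?_)
      filter_upwards [measure_eq_zero_iff_ae_notMem.1 hμ] with t ht
      exact ⟨fun h => ⟨h, not_not.1 ht⟩, fun h => h.1⟩
    rw [hSS, ContinuousLinearMap.integral_comp_comm _ hD.integrableOn]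
    refine (h ξ ξ.2 _ (hS.inter hS₀)).trans (le_of_eq ?_)
    have h1 : κ (S ∩ S₀) = ∫⁻ t in S ∩ S₀, κ.rnDeriv μ t ∂μ := by
      conv_lhs => rw [κ.haveLebesgueDecomposition_add μ]
      rw [Measure.add_apply, measure_mono_null inter_subset_right hs, zero_add,
        withDensity_apply _ (hS.inter hS₀)]
    rw [integral_toReal (Measure.measurable_rnDeriv κ μ).aemeasurable
      (ae_restrict_of_ae (Measure.rnDeriv_lt_top κ μ)), Measure.real, h1]
  have hall : ∀ᵐ t ∂μ, ENNReal.ofReal (Ψ₀ (D t)) ≤ κ.rnDeriv μ t := by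
    -- A dense sequence of functionals gives a single null set; by continuity the bound extends to
    -- the functional realizing `Ψ₀ (D t)`.
    filter_upwards [ae_all_iff.2 fun n => key (TopologicalSpace.denseSeq (stableSet Ψ₀) n),
      Measure.rnDeriv_lt_top κ μ] with t ht htop
    rw [← ENNReal.ofReal_toReal htop.ne]
    refine ENNReal.ofReal_le_ofReal ?_
    obtain ⟨ξ, hξ, heq⟩ := hΨ₀.exists_dual (D t)
    rw [← heq]
    refine DenseRange.induction_on (TopologicalSpace.denseRange_denseSeq (stableSet Ψ₀))
      (p := fun ξ => (ξ : X →L[ℝ] ℝ) (D t) ≤ f t) ⟨ξ, hξ⟩ ?_ ht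
    exact isClosed_le ((ContinuousLinearMap.apply ℝ ℝ (D t)).continuous.comp continuous_subtype_val)
      continuous_const
  calc _ ≤ ∫⁻ t, κ.rnDeriv μ t ∂μ := lintegral_mono_ae hall
    _ ≤ κ univ := by
      rw [← setLIntegral_univ]
      exact Measure.setLIntegral_rnDeriv_le _

section Lower

variable {X : Type*} [NormedAddCommGroup X] [NormedSpace ℝ X] [FiniteDimensional ℝ X]
  {T : ℝ} {Ψ₀ Ψ : X → ℝ} {E : ℝ → X → ℝ} {u : ℝ → X}

/-- A bound of the increments of `u` by those of a monotone function `V`, in the direction `ξ`, passes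
to the derivatives. -/
theorem derivMeasure_le_stieltjes (hT : 0 < T) (hu : BoundedVariationOn u (Icc 0 T)) {V : ℝ → ℝ}
    (hV : Monotone V) {ξ : X →L[ℝ] ℝ} {a b : ℝ} (ha : 0 ≤ a) (hb : b ≤ T)
    (h : ∀ s t, a ≤ s → s ≤ t → t ≤ b → ξ (u t - u s) ≤ V t - V s) {a' b' : ℝ} (ha' : a < a')
    (hab' : a' ≤ b') (hb' : b' < b) {S : Set ℝ} (hS : MeasurableSet S) (hSsub : S ⊆ Ioc a' b') :
    ξ (derivMeasure T u S) ≤ hV.stieltjesFunction.measure.real S := by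
  set cl : ℝ → ℝ := fun t => max a (min t b) with hcl
  have hab : a ≤ b := (ha'.le.trans hab').trans hb'.le
  have hclmono : Monotone cl := fun s t hst => max_le_max le_rfl (min_le_min hst le_rfl)
  have hclmem : ∀ t, cl t ∈ Icc a b := fun t => ⟨le_max_left _ _, max_le hab (min_le_right _ _)⟩
  have hcleq : ∀ t ∈ Ioo a b, cl t = t := fun t ht => by
    simp only [hcl]
    rw [min_eq_left ht.2.le, max_eq_right ht.1.le]
  -- The defect `V - ξ ∘ u` is nondecreasing, and inside `(a,b)` its Stieltjes measure is `dV -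
  -- ξ(du)`. Nonnegativity of that measure is the claim.
  set G : ℝ → ℝ := fun t => V (cl t) - ξ (u (cl t)) with hG
  have hGmono : Monotone G := by
    intro s t hst
    have := h (cl s) (cl t) (hclmem s).1 (hclmono hst) (hclmem t).2
    rw [map_sub] at this
    simp only [hG]
    linarith
  have hGlim : ∀ t ∈ Ioo a b, hGmono.stieltjesFunction t =
      hV.stieltjesFunction t - ξ (right T u t) := by
    intro t ht
    rw [Monotone.stieltjesFunction_eq, Monotone.stieltjesFunction_eq]
    have h1 := (hV.tendsto_rightLim t).sub
      ((ξ.continuous.tendsto _).comp (tendsto_right hT hu ⟨ha.trans ht.1.le, ht.2.trans_le hb⟩))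
    refine tendsto_nhds_unique (hGmono.tendsto_rightLim t) (h1.congr' ?_)
    filter_upwards [Ioo_mem_nhdsGT ht.2] with s hs
    simp only [hG, Function.comp, hcleq s ⟨ht.1.trans hs.1, hs.2⟩]
  have hIoc : ∀ c d, a' ≤ c → c ≤ d → d ≤ b' → hGmono.stieltjesFunction.measure.real (Ioc c d) =
      hV.stieltjesFunction.measure.real (Ioc c d) - ξ (derivMeasure T u (Ioc c d)) := by
    intro c d hc hcd hd
    rw [Measure.real, Measure.real, StieltjesFunction.measure_Ioc, StieltjesFunction.measure_Ioc,
      ENNReal.toReal_ofReal (sub_nonneg.2 (hGmono.stieltjesFunction.mono hcd)),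
      ENNReal.toReal_ofReal (sub_nonneg.2 (hV.stieltjesFunction.mono hcd)),
      hGlim c ⟨ha'.trans_le hc, (hcd.trans hd).trans_lt hb'⟩,
      hGlim d ⟨ha'.trans_le (hc.trans hcd), hd.trans_lt hb'⟩, derivMeasure_Ioc hT hu hcd, map_sub]
    ring
  have hfin : ∀ f : StieltjesFunction ℝ, IsFiniteMeasure (f.measure.restrict (Ioc a' b')) :=
    fun f => ⟨by rw [Measure.restrict_apply_univ]; exact measure_Ioc_lt_top⟩
  have := hfin hGmono.stieltjesFunction
  have := hfin hV.stieltjesFunction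
  obtain ⟨D, hD⟩ : ∃ D : SignedMeasure ℝ, ∀ A, MeasurableSet A →
      D A = ξ (derivMeasure T u (A ∩ Ioc a' b')) :=
    ⟨((derivMeasure T u).restrict (Ioc a' b')).mapRange (ξ : X →+ ℝ) ξ.continuous, fun A hA =>
      congrArg ξ (VectorMeasure.restrict_apply _ measurableSet_Ioc hA)⟩
  have hvec : (hGmono.stieltjesFunction.measure.restrict (Ioc a' b')).toSignedMeasure =
      (hV.stieltjesFunction.measure.restrict (Ioc a' b')).toSignedMeasure -
        D := by
    have happ : ∀ c d, c ≤ d → (hGmono.stieltjesFunction.measure.restrict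
          (Ioc a' b')).toSignedMeasure (Ioc c d) =
        ((hV.stieltjesFunction.measure.restrict (Ioc a' b')).toSignedMeasure -
        D)
          (Ioc c d) := by
      intro c d hcd
      rw [sub_apply, Measure.toSignedMeasure_apply_measurable measurableSet_Ioc,
        Measure.toSignedMeasure_apply_measurable measurableSet_Ioc, hD _ measurableSet_Ioc,
        measureReal_restrict_apply measurableSet_Ioc, measureReal_restrict_apply measurableSet_Ioc,
        Ioc_inter_Ioc]
      rcases le_total (c ⊔ a') (d ⊓ b') with hle | hle
      · exact hIoc _ _ le_sup_right hle inf_le_right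
      · rw [Ioc_eq_empty (not_lt.2 hle)]
        simp
    refine VectorMeasure.ext_of_generateFrom _ ?_
      ((BorelSpace.measurable_eq (α := ℝ)).trans (borel_eq_generateFrom_Ioc ℝ))
      (by simpa using isPiSystem_Ioc (id : ℝ → ℝ) (id : ℝ → ℝ)) ?_
    · rintro - ⟨l, r, hlr, rfl⟩
      exact happ l r hlr.le
    · have h1 := happ a' b' hab'
      rw [sub_apply, Measure.toSignedMeasure_apply_measurable measurableSet_Ioc,
        Measure.toSignedMeasure_apply_measurable measurableSet_Ioc, hD _ measurableSet_Ioc,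
        measureReal_restrict_apply measurableSet_Ioc,
        measureReal_restrict_apply measurableSet_Ioc, inter_self] at h1
      rw [sub_apply, Measure.toSignedMeasure_apply_measurable MeasurableSet.univ,
        Measure.toSignedMeasure_apply_measurable MeasurableSet.univ, hD _ MeasurableSet.univ,
        measureReal_restrict_apply MeasurableSet.univ,
        measureReal_restrict_apply MeasurableSet.univ, univ_inter]
      exact h1
  have h1 := congrArg (fun m : SignedMeasure ℝ => m S) hvec
  rw [sub_apply, Measure.toSignedMeasure_apply_measurable hS,
    Measure.toSignedMeasure_apply_measurable hS, hD _ hS, measureReal_restrict_apply hS,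
    measureReal_restrict_apply hS, inter_eq_left.2 hSsub] at h1
  have h2 := measureReal_nonneg (μ := hGmono.stieltjesFunction.measure) (s := S)
  linarith

/-- Every `ξ ∈ K*` satisfies `ξ(du) ≤ dV` as measures; restricting to the complement of the jumps
and optimizing over `ξ` at each point produces `Ψ₀` of the diffuse density. -/
theorem diffuseVar_le_of_increments (hT : 0 < T) (hΨ₀ : IsGauge Ψ₀)
    (hu : BoundedVariationOn u (Icc 0 T)) {a b : ℝ} (ha : 0 ≤ a) (hab : a < b) (hb : b ≤ T)
    {V : ℝ → ℝ} (h : ∀ s t, a ≤ s → s ≤ t → t ≤ b → Ψ₀ (u t - u s) ≤ V t - V s) :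
    diffuseVar T Ψ₀ u a b ≤ ENNReal.ofReal (V b - V a) := by
  have := isFiniteMeasure_refMeasure (T := T) (u := u)
  have hJm := measurableSet_jumpSet hT hu
  set cl : ℝ → ℝ := fun t => max a (min t b) with hcl
  have hclmono : Monotone cl := fun s t hst => max_le_max le_rfl (min_le_min hst le_rfl)
  have hclmem : ∀ t, cl t ∈ Icc a b := fun t =>
    ⟨le_max_left _ _, max_le hab.le (min_le_right _ _)⟩
  have hcleq : ∀ t ∈ Icc a b, cl t = t := fun t ht => by
    simp only [hcl]
    rw [min_eq_left ht.2, max_eq_right ht.1]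
  have hV : Monotone fun t => V (cl t) := fun s t hst => by
    have := h _ _ (hclmem s).1 (hclmono hst) (hclmem t).2
    have h2 := hΨ₀.nonneg (u (cl t) - u (cl s))
    dsimp only
    linarith
  have hsub : ∀ a' b', a < a' → a' ≤ b' → b' < b →
      ∫⁻ t in Ioc a' b', ENNReal.ofReal (Ψ₀ (diffuseDensity T u t)) ∂(refMeasure T u) ≤
        ENNReal.ofReal (V b - V a) := by
    intro a' b' ha' hab' hb'
    have : IsFiniteMeasure (hV.stieltjesFunction.measure.restrict (Ioc a' b')) :=
      ⟨by rw [Measure.restrict_apply_univ]; exact measure_Ioc_lt_top⟩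
    refine (lintegral_le_of_forall_functional hΨ₀ (μ := (refMeasure T u).restrict (Ioc a' b'))
      (κ := hV.stieltjesFunction.measure.restrict (Ioc a' b'))
      integrable_diffuseDensity.integrableOn fun ξ hξ S hS => ?_).trans ?_
    · rw [Measure.restrict_restrict hS, setIntegral_diffuseDensity (hS.inter measurableSet_Ioc),
        diffuseDeriv_apply hT hu (hS.inter measurableSet_Ioc), measureReal_restrict_apply hS]
      refine (derivMeasure_le_stieltjes hT hu hV ha hb (fun s t hs hst ht => ?_) ha' hab' hb'
        ((hS.inter measurableSet_Ioc).inter (measurableSet_Ioo.diff hJm))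
        (inter_subset_left.trans inter_subset_right)).trans ?_
      · rw [hcleq s ⟨hs, hst.trans ht⟩, hcleq t ⟨hs.trans hst, ht⟩]
        exact (hξ _).trans (h s t hs hst ht)
      · refine measureReal_mono inter_subset_left ?_
        exact ((measure_mono inter_subset_right).trans_lt measure_Ioc_lt_top).ne
    · rw [Measure.restrict_apply_univ, StieltjesFunction.measure_Ioc, Monotone.stieltjesFunction_eq,
        Monotone.stieltjesFunction_eq]
      refine ENNReal.ofReal_le_ofReal (sub_le_sub ?_ ?_)
      · have := hV.rightLim_le hb'
        rwa [hcleq b (right_mem_Icc.2 hab.le)] at this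
      · have := (hV ha'.le).trans (hV.le_rightLim le_rfl)
        dsimp only at this
        rwa [hcleq a (left_mem_Icc.2 hab.le)] at this
  -- The comparison holds on intervals compactly inside `(a,b)`, where the right limits of `V` lie
  -- between `V a` and `V b`; the open interval is exhausted by them.
  obtain ⟨α, hαanti, hαmem, hα⟩ := exists_seq_strictAnti_tendsto' (left_lt_add_div_two.2 hab)
  obtain ⟨β, hβmono, hβmem, hβ⟩ := exists_seq_strictMono_tendsto' (add_div_two_lt_right.2 hab)
  have hunion : Ioo a b = ⋃ n, Ioc (α n) (β n) := by
    ext t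
    simp only [mem_iUnion]
    constructor
    · intro ht
      obtain ⟨n, hn1, hn2⟩ := ((hα.eventually_lt_const ht.1).and
        (hβ.eventually_const_lt ht.2)).exists
      exact ⟨n, hn1, hn2.le⟩
    · rintro ⟨n, hn⟩
      exact ⟨(hαmem n).1.trans hn.1, hn.2.trans_lt (hβmem n).2⟩
  have hmono : Monotone fun n => Ioc (α n) (β n) := fun m n hmn =>
    Ioc_subset_Ioc (hαanti.antitone hmn) (hβmono.monotone hmn)
  rw [diffuseVar, hunion, setLIntegral_iUnion_of_directed _ hmono.directed_le]
  exact iSup_le fun n => hsub _ _ (hαmem n).1 ((hαmem n).2.trans (hβmem n).1).le (hβmem n).2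

/-! ### Finiteness of `pVar` -/

theorem diffuseVar_lt_top (hΨ₀ : IsGauge Ψ₀) (a b : ℝ) : diffuseVar T Ψ₀ u a b < ⊤ := by
  obtain ⟨C, hC0, hC⟩ := hΨ₀.exists_le_norm
  have h1 : Integrable (fun t => C * ‖diffuseDensity T u t‖) (refMeasure T u) :=
    integrable_diffuseDensity.norm.const_mul C
  calc diffuseVar T Ψ₀ u a b ≤ ∫⁻ t, ENNReal.ofReal (Ψ₀ (diffuseDensity T u t)) ∂(refMeasure T u) :=
        setLIntegral_le_lintegral _ _
    _ ≤ ∫⁻ t, ENNReal.ofReal (C * ‖diffuseDensity T u t‖) ∂(refMeasure T u) :=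
        lintegral_mono fun t => ENNReal.ofReal_le_ofReal (hC _)
    _ < ⊤ := h1.lintegral_lt_top

/-- Segments bound the cost of each jump by its size, and the sizes sum to at most the pointwise
variation; the diffuse density is integrable. No stability is involved, which is why equality with
`varB0` implies that `varB0` is finite. -/
theorem pVar_lt_top (hT : 0 < T) (hΨ₀ : IsGauge Ψ₀) (hΨ : IsViscousPotential Ψ₀ Ψ)
    (hE : IsAdmissibleEnergy T E) (hu : BoundedVariationOn u (Icc 0 T)) {a b : ℝ} (ha : 0 ≤ a)
    (hb : b ≤ T) : pVar T Ψ₀ Ψ E u a b < ⊤ := by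
  rcases le_or_gt b a with hab | hab
  · simp [pVar, hab.not_gt]
  obtain ⟨R, hR0, hR⟩ := exists_norm_bound hT hu
  obtain ⟨C, hC0, -, hC⟩ := exists_distB0_segment_le hT hΨ₀ hΨ hE R
  have hcost : ∀ t ∈ Icc 0 T, ∀ x y : X, ‖x‖ ≤ R → ‖y‖ ≤ R →
      finslerCost Ψ E t x y ≤ ENNReal.ofReal (C * ‖y - x‖) := fun t ht x y hx hy => by
    rw [finslerCost_eq_distB0 hT hΨ₀ hΨ hE ht]
    exact hC t ht x y hx hy
  have haT : a ∈ Icc 0 T := ⟨ha, hab.le.trans hb⟩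
  have hbT : b ∈ Icc 0 T := ⟨ha.trans hab.le, hb⟩
  have hjump : ∀ t ∈ Ioo a b, jumpCost T Ψ E u t ≤ ENNReal.ofReal C *
      (edist (constExtend T u t) (left T u t) + edist (constExtend T u t) (right T u t)) := by
    intro t ht
    have htT : t ∈ Icc 0 T := ⟨ha.trans ht.1.le, ht.2.le.trans hb⟩
    have hl := norm_left_le hT hu hR (t := t) ⟨ha.trans_lt ht.1, htT.2⟩
    have hr := norm_right_le hT hu hR (t := t) ⟨htT.1, ht.2.trans_le hb⟩
    rw [constExtend_of_mem u htT, mul_add, edist_comm (u t) (right T u t), edist_dist, edist_dist,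
      dist_eq_norm, dist_eq_norm, ← ENNReal.ofReal_mul hC0, ← ENNReal.ofReal_mul hC0]
    exact add_le_add (hcost t htT _ _ hl (hR t htT)) (hcost t htT _ _ (hR t htT) hr)
  have hsum : ∑' t : ↥(jumpSet T u ∩ Ioo a b), jumpCost T Ψ E u t ≤
      ENNReal.ofReal C * eVariationOn (constExtend T u) univ := by
    rw [ENNReal.tsum_eq_iSup_sum]
    refine iSup_le fun F => ?_
    refine (Finset.sum_le_sum fun (t : ↥(jumpSet T u ∩ Ioo a b)) _ => hjump t t.2.2).trans ?_
    rw [← Finset.mul_sum]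
    gcongr
    have := sum_edist_jump_le hT hu (F.map (Function.Embedding.subtype _))
    rwa [Finset.sum_map] at this
  rw [pVar_eq hab]
  refine ENNReal.add_lt_top.2 ⟨diffuseVar_lt_top hΨ₀ a b, ENNReal.add_lt_top.2
    ⟨ENNReal.add_lt_top.2 ⟨?_, ?_⟩, ?_⟩⟩
  · exact (hcost a haT _ _ (hR a haT) (norm_right_le hT hu hR ⟨ha, hab.trans_le hb⟩)).trans_lt
      ENNReal.ofReal_lt_top
  · exact (hcost b hbT _ _ (norm_left_le hT hu hR ⟨ha.trans_lt hab, hb⟩) (hR b hbT)).trans_lt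
      ENNReal.ofReal_lt_top
  · exact hsum.trans_lt (ENNReal.mul_lt_top ENNReal.ofReal_lt_top
      (boundedVariationOn_constExtend hT hu).lt_top)

end Lower

end RateIndep

namespace RateIndep

/-! ### The lower bound for `varB0` -/

section LowerBound

variable {X : Type*} [NormedAddCommGroup X] [NormedSpace ℝ X] [FiniteDimensional ℝ X]
  {T : ℝ} {Ψ₀ Ψ : X → ℝ} {E : ℝ → X → ℝ} {u : ℝ → X} {a b : ℝ}

/-- The dominating monotone function is `t ↦ varB0 T Ψ₀ Ψ E u a t`, by superadditivity. -/
theorem diffuseVar_le_varB0 (hT : 0 < T) (hΨ₀ : IsGauge Ψ₀) (hΨ : IsViscousPotential Ψ₀ Ψ)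
    (hu : BoundedVariationOn u (Icc 0 T)) (ha : 0 ≤ a) (hab : a < b) (hb : b ≤ T)
    (hfin : varB0 T Ψ₀ Ψ E u a b < ⊤) :
    diffuseVar T Ψ₀ u a b ≤ varB0 T Ψ₀ Ψ E u a b := by
  have hlt : ∀ t, a ≤ t → t ≤ b → varB0 T Ψ₀ Ψ E u a t ≠ ⊤ := fun t hat htb =>
    ((varB0_mono le_rfl hat htb).trans_lt hfin).ne
  refine (diffuseVar_le_of_increments hT hΨ₀ hu ha hab hb
    (V := fun t => (varB0 T Ψ₀ Ψ E u a t).toReal) fun s t hs hst ht => ?_).trans ?_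
  · rcases hst.eq_or_lt with rfl | hlt'
    · simp [hΨ₀.map_zero]
    · have h1 : varB0 T Ψ₀ Ψ E u a s + ENNReal.ofReal (Ψ₀ (u t - u s)) ≤ varB0 T Ψ₀ Ψ E u a t :=
        (add_le_add le_rfl ((gauge_sub_le_distB0 hΨ₀ hΨ).trans (distB0_le_varB0 hlt'))).trans
          (varB0_add_le hs hst)
      have h2 := ENNReal.toReal_mono (hlt t (hs.trans hst) ht) h1
      rw [ENNReal.toReal_add (hlt s hs (hst.trans ht)) ENNReal.ofReal_ne_top,
        ENNReal.toReal_ofReal (hΨ₀.nonneg _)] at h2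
      linarith
  · simp only [varB0_self, ENNReal.toReal_zero, sub_zero]
    rw [ENNReal.ofReal_toReal hfin.ne]

theorem ge_of_forall_one_add_mul {L V : ℝ≥0∞}
    (h : ∀ η : ℝ, 0 < η → L ≤ ENNReal.ofReal (1 + η) * V) : L ≤ V := by
  have h1 : Tendsto (fun η : ℝ => ENNReal.ofReal (1 + η)) (𝓝[>] 0) (𝓝 1) := by
    have : Tendsto (fun η : ℝ => ENNReal.ofReal (1 + η)) (𝓝 0) (𝓝 (ENNReal.ofReal (1 + 0))) :=
      (ENNReal.continuous_ofReal.comp (continuous_const.add continuous_id)).tendsto 0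
    rw [add_zero, ENNReal.ofReal_one] at this
    exact this.mono_left nhdsWithin_le_nhds
  have h2 : Tendsto (fun η : ℝ => ENNReal.ofReal (1 + η) * V) (𝓝[>] 0) (𝓝 (1 * V)) :=
    ENNReal.Tendsto.mul_const h1 (Or.inl one_ne_zero)
  rw [one_mul] at h2
  refine ge_of_tendsto h2 ?_
  filter_upwards [self_mem_nhdsWithin] with η hη using h η hη

/-- Cut at `α n ↓ a` and `β n ↑ b`. The two short end steps, frozen at `a` and at `b`, converge to
the end jump costs up to the factor `1 + η`; the middle piece dominates the diffuse variation, which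
increases to that of `(a,b)`. -/
theorem add_diffuseVar_add_le_varB0 (hT : 0 < T) (hΨ₀ : IsGauge Ψ₀)
    (hΨ : IsViscousPotential Ψ₀ Ψ) (hE : IsAdmissibleEnergy T E)
    (hu : BoundedVariationOn u (Icc 0 T)) (ha : 0 ≤ a) (hab : a < b) (hb : b ≤ T)
    (hfin : varB0 T Ψ₀ Ψ E u a b < ⊤) :
    distB0 T Ψ₀ Ψ E a (u a) a (right T u a) + diffuseVar T Ψ₀ u a b +
      distB0 T Ψ₀ Ψ E b (left T u b) b (u b) ≤ varB0 T Ψ₀ Ψ E u a b := by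
  refine ge_of_forall_one_add_mul fun η hη => ?_
  have haT : a ∈ Icc 0 T := ⟨ha, hab.le.trans hb⟩
  have hbT : b ∈ Icc 0 T := ⟨ha.trans hab.le, hb⟩
  obtain ⟨R₀, hR₀, hR₀u⟩ := exists_norm_bound hT hu
  set R := max R₀ ((varB0 T Ψ₀ Ψ E u a b).toReal + 1) with hR
  have hRu : ∀ t ∈ Icc 0 T, ‖u t‖ ≤ R := fun t ht => (hR₀u t ht).trans (le_max_left _ _)
  have hRvar : varB0 T Ψ₀ Ψ E u a b < ENNReal.ofReal R := by
    rw [← ENNReal.ofReal_toReal hfin.ne]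
    exact (ENNReal.ofReal_lt_ofReal_iff (lt_max_of_lt_right (by positivity))).2
        ((lt_add_one _).trans_le (le_max_right _ _))
  obtain ⟨C, hC0, -, hC⟩ := exists_distB0_segment_le hT hΨ₀ hΨ hE R
  obtain ⟨δ, hδ, hfreeze⟩ := exists_freeze hT hΨ₀ hΨ hE R hη
  obtain ⟨α, hαanti, hαmem, hα⟩ := exists_seq_strictAnti_tendsto' (left_lt_add_div_two.2 hab)
  obtain ⟨β, hβmono, hβmem, hβ⟩ := exists_seq_strictMono_tendsto' (add_div_two_lt_right.2 hab)
  have hαβ : ∀ n, α n < β n := fun n => (hαmem n).2.trans (hβmem n).1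
  have hunion : Ioo a b = ⋃ n, Ioo (α n) (β n) := by
    ext t
    simp only [mem_iUnion]
    constructor
    · intro ht
      exact ((hα.eventually_lt_const ht.1).and (hβ.eventually_const_lt ht.2)).exists
    · rintro ⟨n, hn⟩
      exact ⟨(hαmem n).1.trans hn.1, hn.2.trans (hβmem n).2⟩
  have hmono : Monotone fun n => Ioo (α n) (β n) := fun m n hmn =>
    Ioo_subset_Ioo (hαanti.antitone hmn) (hβmono.monotone hmn)
  have hdiff : Tendsto (fun n => diffuseVar T Ψ₀ u (α n) (β n)) atTop
      (𝓝 (diffuseVar T Ψ₀ u a b)) := by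
    have h1 := tendsto_measure_iUnion_atTop (μ := (refMeasure T u).withDensity
      fun t => ENNReal.ofReal (Ψ₀ (diffuseDensity T u t))) hmono
    rw [← hunion, withDensity_apply _ measurableSet_Ioo] at h1
    refine h1.congr fun n => ?_
    rw [Function.comp, withDensity_apply _ measurableSet_Ioo]
    rfl
  have hα' : Tendsto (fun n => u (α n)) atTop (𝓝 (right T u a)) :=
    (tendsto_right hT hu ⟨ha, hab.trans_le hb⟩).comp
      (tendsto_nhdsWithin_iff.2 ⟨hα, Eventually.of_forall fun n => (hαmem n).1⟩)
  have hβ' : Tendsto (fun n => u (β n)) atTop (𝓝 (left T u b)) :=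
    (tendsto_left hT hu ⟨ha.trans_lt hab, hb⟩).comp
      (tendsto_nhdsWithin_iff.2 ⟨hβ, Eventually.of_forall fun n => (hβmem n).2⟩)
  have hαe : Tendsto (fun n => ENNReal.ofReal (C * ‖right T u a - u (α n)‖)) atTop (𝓝 0) := by
    have h1 := ((tendsto_const_nhds (x := right T u a)).sub hα').norm.const_mul C
    rw [sub_self, norm_zero, mul_zero] at h1
    simpa using ENNReal.tendsto_ofReal h1
  have hβe : Tendsto (fun n => ENNReal.ofReal (C * ‖u (β n) - left T u b‖)) atTop (𝓝 0) := by
    have h1 := (hβ'.sub (tendsto_const_nhds (x := left T u b))).norm.const_mul C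
    rw [sub_self, norm_zero, mul_zero] at h1
    simpa using ENNReal.tendsto_ofReal h1
  have hlim : Tendsto (fun n => ENNReal.ofReal (1 + η) * varB0 T Ψ₀ Ψ E u a b +
      (ENNReal.ofReal (C * ‖right T u a - u (α n)‖) +
        ENNReal.ofReal (C * ‖u (β n) - left T u b‖))) atTop
      (𝓝 (ENNReal.ofReal (1 + η) * varB0 T Ψ₀ Ψ E u a b + (0 + 0))) :=
    tendsto_const_nhds.add (hαe.add hβe)
  rw [add_zero, add_zero] at hlim
  refine le_of_tendsto_of_tendsto ((tendsto_const_nhds.add hdiff).add tendsto_const_nhds) hlim ?_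
  filter_upwards [hα.eventually_lt_const (lt_add_of_pos_right a hδ),
    hβ.eventually_const_lt (sub_lt_self b hδ)] with n hn1 hn2
  have hαb : α n < b := (hαβ n).trans (hβmem n).2
  have haβ : a < β n := (hαmem n).1.trans (hαβ n)
  have hαT : α n ∈ Icc 0 T := ⟨ha.trans (hαmem n).1.le, hαb.le.trans hb⟩
  have hβT : β n ∈ Icc 0 T := ⟨ha.trans haβ.le, (hβmem n).2.le.trans hb⟩
  have h1 : distB0 T Ψ₀ Ψ E a (u a) (α n) (u (α n)) + diffuseVar T Ψ₀ u (α n) (β n) +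
      distB0 T Ψ₀ Ψ E (β n) (u (β n)) b (u b) ≤ varB0 T Ψ₀ Ψ E u a b := by
    have h2 : varB0 T Ψ₀ Ψ E u (α n) (β n) ≤ varB0 T Ψ₀ Ψ E u a b :=
      varB0_mono (hαmem n).1.le (hαβ n).le (hβmem n).2.le
    calc _ ≤ varB0 T Ψ₀ Ψ E u a (α n) + varB0 T Ψ₀ Ψ E u (α n) (β n) +
          varB0 T Ψ₀ Ψ E u (β n) b :=
          add_le_add (add_le_add (distB0_le_varB0 (hαmem n).1) (diffuseVar_le_varB0 hT hΨ₀ hΨ hu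
            hαT.1 (hαβ n) hβT.2 (h2.trans_lt hfin))) (distB0_le_varB0 (hβmem n).2)
      _ ≤ varB0 T Ψ₀ Ψ E u a (β n) + varB0 T Ψ₀ Ψ E u (β n) b :=
          add_le_add (varB0_add_le (hαmem n).1.le (hαβ n).le) le_rfl
      _ ≤ _ := varB0_add_le haβ.le (hβmem n).2.le
  have h3 : distB0 T Ψ₀ Ψ E a (u a) a (right T u a) ≤
      ENNReal.ofReal (1 + η) * distB0 T Ψ₀ Ψ E a (u a) (α n) (u (α n)) +
        ENNReal.ofReal (C * ‖right T u a - u (α n)‖) := by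
    refine (distB0_triangle a a a _ (u (α n)) _).trans (add_le_add ?_ ?_)
    · refine hfreeze a a (α n) _ _ ha le_rfl (hαmem n).1.le hαT.2 (by linarith) (hRu a haT) ?_
      exact ((le_self_add.trans (le_self_add.trans h1))).trans_lt hRvar
    · exact hC a haT _ _ (hRu _ hαT) (norm_right_le hT hu hRu ⟨ha, hab.trans_le hb⟩)
  have h4 : distB0 T Ψ₀ Ψ E b (left T u b) b (u b) ≤
      ENNReal.ofReal (1 + η) * distB0 T Ψ₀ Ψ E (β n) (u (β n)) b (u b) +
        ENNReal.ofReal (C * ‖u (β n) - left T u b‖) := by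
    refine (distB0_triangle b b b _ (u (β n)) _).trans ?_
    rw [add_comm]
    refine add_le_add ?_ ?_
    · refine hfreeze (β n) b b _ _ hβT.1 (hβmem n).2.le le_rfl hb (by linarith) (hRu _ hβT) ?_
      exact (le_add_self.trans h1).trans_lt hRvar
    · exact hC b hbT _ _ (norm_left_le hT hu hRu ⟨ha.trans_lt hab, hb⟩) (hRu _ hβT)
  have h5 : diffuseVar T Ψ₀ u (α n) (β n) ≤
      ENNReal.ofReal (1 + η) * diffuseVar T Ψ₀ u (α n) (β n) :=
    le_mul_of_one_le_left zero_le (by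
      rw [← ENNReal.ofReal_one]; exact ENNReal.ofReal_le_ofReal (by linarith))
  calc _ ≤ _ := add_le_add (add_le_add h3 h5) h4
    _ = ENNReal.ofReal (1 + η) * (distB0 T Ψ₀ Ψ E a (u a) (α n) (u (α n)) +
          diffuseVar T Ψ₀ u (α n) (β n) + distB0 T Ψ₀ Ψ E (β n) (u (β n)) b (u b)) +
        (ENNReal.ofReal (C * ‖right T u a - u (α n)‖) +
          ENNReal.ofReal (C * ‖u (β n) - left T u b‖)) := by ring
    _ ≤ _ := by gcongr

/-- Splitting at the largest jump time, the right end cost of one piece and the left end cost of the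
next together form the cost of that jump. -/
theorem add_sum_jumpCost_le_varB0 (hT : 0 < T) (hΨ₀ : IsGauge Ψ₀)
    (hΨ : IsViscousPotential Ψ₀ Ψ) (hE : IsAdmissibleEnergy T E)
    (hu : BoundedVariationOn u (Icc 0 T)) (F : Finset ℝ) {b : ℝ} (ha : 0 ≤ a) (hab : a < b)
    (hb : b ≤ T) (hfin : varB0 T Ψ₀ Ψ E u a b < ⊤) (hF : ∀ t ∈ F, t ∈ Ioo a b) :
    distB0 T Ψ₀ Ψ E a (u a) a (right T u a) + diffuseVar T Ψ₀ u a b +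
      distB0 T Ψ₀ Ψ E b (left T u b) b (u b) + ∑ t ∈ F, jumpCost T Ψ E u t ≤
      varB0 T Ψ₀ Ψ E u a b := by
  induction F using Finset.induction_on_max generalizing b with
  | empty => simpa using add_diffuseVar_add_le_varB0 hT hΨ₀ hΨ hE hu ha hab hb hfin
  | insert t F htF ih =>
    have ht := hF t (Finset.mem_insert_self _ _)
    have htT : t ∈ Icc 0 T := ⟨ha.trans ht.1.le, ht.2.le.trans hb⟩
    have h1 := ih ht.1 htT.2 ((varB0_mono le_rfl ht.1.le ht.2.le).trans_lt hfin)
      fun s hs => ⟨(hF s (Finset.mem_insert_of_mem hs)).1, htF s hs⟩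
    have h2 := add_diffuseVar_add_le_varB0 hT hΨ₀ hΨ hE hu htT.1 ht.2 hb
      ((varB0_mono ht.1.le ht.2.le le_rfl).trans_lt hfin)
    rw [Finset.sum_insert fun h => lt_irrefl _ (htF t h), ← diffuseVar_add hT hu ht.1 ht.2]
    refine le_trans (le_of_eq ?_) ((add_le_add h1 h2).trans (varB0_add_le ht.1.le ht.2.le))
    rw [jumpCost, finslerCost_eq_distB0 hT hΨ₀ hΨ hE htT, finslerCost_eq_distB0 hT hΨ₀ hΨ hE htT]
    ring

theorem pVar_le_varB0 (hT : 0 < T) (hΨ₀ : IsGauge Ψ₀)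
    (hΨ : IsViscousPotential Ψ₀ Ψ) (hE : IsAdmissibleEnergy T E)
    (hu : BoundedVariationOn u (Icc 0 T)) (ha : 0 ≤ a) (hb : b ≤ T) :
    pVar T Ψ₀ Ψ E u a b ≤ varB0 T Ψ₀ Ψ E u a b := by
  rcases le_or_gt b a with hab | hab
  · simp [pVar, hab.not_gt]
  by_cases hfin : varB0 T Ψ₀ Ψ E u a b < ⊤
  swap
  · rw [not_lt_top_iff.1 hfin]
    exact le_top
  rw [pVar_eq hab, finslerCost_eq_distB0 hT hΨ₀ hΨ hE ⟨ha, hab.le.trans hb⟩,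
    finslerCost_eq_distB0 hT hΨ₀ hΨ hE ⟨ha.trans hab.le, hb⟩, ← add_assoc, ← add_assoc,
    add_comm (diffuseVar T Ψ₀ u a b)]
  refine le_of_tendsto' (tendsto_const_nhds.add ENNReal.summable.hasSum) fun F => ?_
  have h1 := add_sum_jumpCost_le_varB0 hT hΨ₀ hΨ hE hu (F.map (Function.Embedding.subtype _)) ha hab
    hb hfin fun t ht => by
      obtain ⟨t', -, rfl⟩ := Finset.mem_map.1 ht
      exact t'.2.2
  rwa [Finset.sum_map] at h1

theorem LocallyStableOn.of_varB0_lt_top (hT : 0 < T) (hΨ₀ : IsGauge Ψ₀)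
    (hΨ : IsViscousPotential Ψ₀ Ψ) (hE : IsAdmissibleEnergy T E)
    (hu : BoundedVariationOn u (Icc 0 T)) (ha : 0 ≤ a) (hb : b ≤ T)
    (hfin : varB0 T Ψ₀ Ψ E u a b < ⊤) : LocallyStableOn T Ψ₀ E u (Ioo a b) :=
  Eventually.of_forall fun _ ht => stable_of_varB0_lt_top hT hΨ₀ hΨ hE hu ha hb hfin ht.1 ht.2

theorem pVar_eq_varB0 (hT : 0 < T) (hΨ₀ : IsGauge Ψ₀)
    (hΨ : IsViscousPotential Ψ₀ Ψ) (hE : IsAdmissibleEnergy T E)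
    (hu : BoundedVariationOn u (Icc 0 T)) (ha : 0 ≤ a) (hb : b ≤ T)
    (hst : LocallyStableOn T Ψ₀ E u (Ioo a b)) :
    pVar T Ψ₀ Ψ E u a b = varB0 T Ψ₀ Ψ E u a b :=
  le_antisymm (pVar_le_varB0 hT hΨ₀ hΨ hE hu ha hb)
    (varB0_le_pVar hT hΨ₀ hΨ hE hu ha hb fun _ ht => hst.stable hT hE hu ha hb ht)

end LowerBound

end RateIndep

namespace RateIndep

/-! ### The energy estimate and the characterizations of BV solutions -/

theorem IsAdmissibleEnergy.integral_dtE {X : Type*} [NormedAddCommGroup X]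
    [NormedSpace ℝ X] {T : ℝ} {E : ℝ → X → ℝ} (hT : 0 < T) (hE : IsAdmissibleEnergy T E)
    {p q : ℝ}
    (hp : 0 ≤ p) (hpq : p ≤ q) (hq : q ≤ T) (x : X) :
    IntervalIntegrable (fun r => dtE T E r x) volume p q ∧
      ∫ r in p..q, dtE T E r x = E q x - E p x := by
  have hsub : Icc p q ⊆ Icc 0 T := Icc_subset_Icc hp hq
  have hcont : ContinuousOn (fun r => dtE T E r x) (Icc p q) :=
    (hE.continuousOn_dtE hT).comp (continuousOn_id.prodMk continuousOn_const)
      fun r hr => ⟨hsub hr, mem_univ _⟩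
  have hint : IntervalIntegrable (fun r => dtE T E r x) volume p q :=
    ContinuousOn.intervalIntegrable (by rwa [uIcc_of_le hpq])
  refine ⟨hint, intervalIntegral.integral_eq_sub_of_hasDerivAt_of_le
    (f := fun s => E s x) hpq ?_ ?_ hint⟩
  · exact fun r hr => ((hE.hasDerivWithinAt_dtE hT (hsub hr) x).continuousWithinAt).mono hsub
  · exact fun r hr => (hE.hasDerivWithinAt_dtE hT (hsub (Ioo_subset_Icc_self hr)) x).hasDerivAt
      (Icc_mem_nhds (hp.trans_lt hr.1) (hr.2.trans_le hq))

section Energy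

variable {X : Type*} [NormedAddCommGroup X] [NormedSpace ℝ X] [FiniteDimensional ℝ X]
  {T : ℝ} {Ψ₀ Ψ : X → ℝ} {E : ℝ → X → ℝ} {u : ℝ → X}

/-- Uniform continuity in linear form: beyond distance `δ` the trivial bound `2 * M` is absorbed in
the slope. The linear term can later be compared with the variation of `u`. -/
theorem IsAdmissibleEnergy.exists_dtE_sub_le (hT : 0 < T) (hE : IsAdmissibleEnergy T E) (R : ℝ)
    {ε : ℝ} (hε : 0 < ε) : ∃ K : ℝ, 0 ≤ K ∧ ∀ t ∈ Icc 0 T, ∀ x y : X, ‖x‖ ≤ R → ‖y‖ ≤ R →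
      |dtE T E t x - dtE T E t y| ≤ ε + K * ‖x - y‖ := by
  obtain ⟨M, hM0, hM⟩ := hE.exists_bound_dtE hT R
  have hc : IsCompact (Icc 0 T ×ˢ Metric.closedBall (0 : X) R) :=
    isCompact_Icc.prod (isCompact_closedBall 0 R)
  have huc := hc.uniformContinuousOn_of_continuous
    ((hE.continuousOn_dtE hT).mono (prod_mono le_rfl (subset_univ _)))
  obtain ⟨δ, hδ, h⟩ := Metric.uniformContinuousOn_iff.1 huc ε hε
  refine ⟨2 * M / δ, by positivity, fun t ht x y hx hy => ?_⟩
  rcases lt_or_ge ‖x - y‖ δ with hlt | hge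
  · have h1 := h (t, x) ⟨ht, by simpa using hx⟩ (t, y) ⟨ht, by simpa using hy⟩
      (by rw [Prod.dist_eq, dist_self, dist_eq_norm]; exact max_lt hδ hlt)
    rw [Real.dist_eq] at h1
    have : 0 ≤ 2 * M / δ * ‖x - y‖ := by positivity
    linarith
  · have h1 : |dtE T E t x - dtE T E t y| ≤ 2 * M := by
      have h2 := hM t ht x hx
      have h3 := hM t ht y hy
      rw [Real.norm_eq_abs] at h2 h3
      exact (abs_sub _ _).trans (by linarith)
    have h2 : 2 * M ≤ 2 * M / δ * ‖x - y‖ := by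
      rw [div_mul_eq_mul_div, le_div_iff₀ hδ]
      gcongr
    linarith

theorem intervalIntegrable_dtE (hT : 0 < T) (hE : IsAdmissibleEnergy T E)
    (hu : BoundedVariationOn u (Icc 0 T)) {s t : ℝ} (hs : s ∈ Icc 0 T) (ht : t ∈ Icc 0 T) :
    IntervalIntegrable (fun r => dtE T E r (u r)) volume s t := by
  obtain ⟨R, -, hR⟩ := exists_norm_bound hT hu
  obtain ⟨M, -, hM⟩ := hE.exists_bound_dtE hT R
  have hcl : ∀ r, max 0 (min r T) ∈ Icc 0 T := fun r =>
    ⟨le_max_left _ _, max_le hT.le (min_le_right _ _)⟩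
  have hF : Continuous fun q : ℝ × X => dtE T E (max 0 (min q.1 T)) q.2 :=
    (hE.continuousOn_dtE hT).comp_continuous
      ((continuous_const.max (continuous_fst.min continuous_const)).prodMk continuous_snd)
      fun q => ⟨hcl q.1, mem_univ _⟩
  -- Clamping the time turns the integrand into a globally continuous function composed with a
  -- measurable curve.
  have hmeas : StronglyMeasurable fun r => dtE T E (max 0 (min r T)) (constExtend T u r) :=
    hF.comp_stronglyMeasurable
      (stronglyMeasurable_id.prodMk (stronglyMeasurable_constExtend hT hu))
  have hint : IntegrableOn (fun r => dtE T E (max 0 (min r T)) (constExtend T u r)) (Icc 0 T) :=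
    Measure.integrableOn_of_bounded (M := M) measure_Icc_lt_top.ne hmeas.aestronglyMeasurable
      (Eventually.of_forall fun r => hM _ (hcl r) _ (hR _ (hcl r)))
  have hint2 : IntegrableOn (fun r => dtE T E r (u r)) (Icc 0 T) := by
    refine hint.congr_fun (fun r hr => ?_) measurableSet_Icc
    simp only [constExtend_of_mem u hr, min_eq_left hr.2, max_eq_right hr.1]
  rw [intervalIntegrable_iff]
  exact hint2.mono_set (uIoc_subset_uIcc.trans (uIcc_subset_Icc hs ht))

/-- The energy estimate on short intervals, up to a small error. -/
theorem exists_energy_step (hT : 0 < T) (hΨ₀ : IsGauge Ψ₀)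
    (hΨ : IsViscousPotential Ψ₀ Ψ) (hE : IsAdmissibleEnergy T E)
    (hu : BoundedVariationOn u (Icc 0 T)) {s t : ℝ} (hs : 0 ≤ s) (ht : t ≤ T)
    (hfin : varB0 T Ψ₀ Ψ E u s t < ⊤) {η : ℝ} (hη : 0 < η) :
    ∃ δ : ℝ, 0 < δ ∧ ∀ p q, s ≤ p → p ≤ q → q ≤ t → q - p < δ →
      E p (u p) - E q (u q) + ∫ r in p..q, dtE T E r (u r) ≤
        (1 + 2 * η) * (varB0 T Ψ₀ Ψ E u p q).toReal + η * (q - p) := by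
  obtain ⟨c, hc, hcle⟩ := hΨ₀.exists_norm_le
  obtain ⟨R₀, hR₀, hR₀u⟩ := exists_norm_bound hT hu
  set R := max R₀ ((varB0 T Ψ₀ Ψ E u s t).toReal + 1) with hR
  have hRu : ∀ t ∈ Icc 0 T, ‖u t‖ ≤ R := fun t ht => (hR₀u t ht).trans (le_max_left _ _)
  have hRvar : varB0 T Ψ₀ Ψ E u s t < ENNReal.ofReal R := by
    rw [← ENNReal.ofReal_toReal hfin.ne]
    exact (ENNReal.ofReal_lt_ofReal_iff (lt_max_of_lt_right (by positivity))).2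
      ((lt_add_one _).trans_le (le_max_right _ _))
  obtain ⟨δ, hδ, hfreeze⟩ := exists_freeze hT hΨ₀ hΨ hE R hη
  obtain ⟨K, hK0, hK⟩ := hE.exists_dtE_sub_le hT R hη
  -- The second bound absorbs the error `(q - p) * K * (w / c)` of replacing `u r` by `u q` in the
  -- power into `η * w`.
  refine ⟨min δ (η * c / (K + 1)), lt_min hδ (by positivity), fun p q hp hpq hq hlt => ?_⟩
  set w := (varB0 T Ψ₀ Ψ E u p q).toReal with hw
  have hw0 : 0 ≤ w := ENNReal.toReal_nonneg
  have hpT : p ∈ Icc 0 T := ⟨hs.trans hp, (hpq.trans hq).trans ht⟩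
  have hqT : q ∈ Icc 0 T := ⟨hpT.1.trans hpq, hq.trans ht⟩
  rcases hpq.eq_or_lt with rfl | hpq'
  · simp only [sub_self, intervalIntegral.integral_same, add_zero, mul_zero]
    positivity
  have hle : varB0 T Ψ₀ Ψ E u p q ≤ varB0 T Ψ₀ Ψ E u s t := varB0_mono hp hpq hq
  have hne : varB0 T Ψ₀ Ψ E u p q ≠ ⊤ := (hle.trans_lt hfin).ne
  -- The step is decomposed into a move from `u p` to `u q` at the frozen time `p`, followed by the
  -- passage of time at the fixed state `u q`.
  have h1 : E p (u p) - E p (u q) ≤ (1 + η) * w := by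
    rw [← ENNReal.ofReal_le_ofReal_iff (by positivity), ENNReal.ofReal_mul (by positivity),
      hw, ENNReal.ofReal_toReal hne]
    have h2 := distB0_le_varB0 (T := T) (Ψ₀ := Ψ₀) (Ψ := Ψ) (E := E) (u := u) hpq'
    calc _ ≤ distB0 T Ψ₀ Ψ E p (u p) p (u q) := energy_sub_le_distB0 hT hΨ hE hpT _ _
      _ ≤ ENNReal.ofReal (1 + η) * distB0 T Ψ₀ Ψ E p (u p) q (u q) :=
        hfreeze p p q _ _ hpT.1 le_rfl hpq hqT.2 (hlt.trans_le (min_le_left _ _)) (hRu p hpT)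
          ((h2.trans hle).trans_lt hRvar)
      _ ≤ _ := by gcongr
  have hdist : ∀ r ∈ Icc p q, ‖u r - u q‖ ≤ w / c := by
    intro r hr
    rw [le_div_iff₀ hc, norm_sub_rev, mul_comm]
    refine (hcle _).trans ?_
    rcases hr.2.eq_or_lt with rfl | hrq
    · rwa [sub_self, hΨ₀.map_zero]
    · rw [← ENNReal.ofReal_le_ofReal_iff hw0, hw, ENNReal.ofReal_toReal hne]
      exact ((gauge_sub_le_distB0 hΨ₀ hΨ).trans (distB0_le_varB0 hrq)).trans
        (varB0_mono hr.1 hrq.le le_rfl)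
  obtain ⟨hint, hFTC⟩ := hE.integral_dtE hT hpT.1 hpq hqT.2 (u q)
  have h2 : ∫ r in p..q, dtE T E r (u r) ≤
      ∫ r in p..q, (dtE T E r (u q) + (η + K * (w / c))) := by
    refine intervalIntegral.integral_mono_on hpq (intervalIntegrable_dtE hT hE hu hpT hqT)
      (hint.add intervalIntegrable_const) fun r hr => ?_
    have hrT : r ∈ Icc 0 T := ⟨hpT.1.trans hr.1, hr.2.trans hqT.2⟩
    have h3 := (le_abs_self _).trans (hK r hrT (u r) (u q) (hRu r hrT) (hRu q hqT))
    have h4 : K * ‖u r - u q‖ ≤ K * (w / c) := by gcongr; exact hdist r hr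
    linarith
  rw [intervalIntegral.integral_add hint intervalIntegrable_const, hFTC,
    intervalIntegral.integral_const, smul_eq_mul] at h2
  have h3 : (q - p) * (K * (w / c)) ≤ η * w := by
    have h4 : (q - p) * (K + 1) ≤ η * c := by
      rw [← le_div_iff₀ (by positivity)]
      exact (hlt.trans_le (min_le_right _ _)).le
    have h5 : (q - p) * K ≤ η * c := by nlinarith
    calc (q - p) * (K * (w / c)) = (q - p) * K * (w / c) := by ring
      _ ≤ η * c * (w / c) := by gcongr
      _ = η * w := by field_simp
  nlinarith

/-- The dissipation bounds the loss of energy from below (chain rule inequality). -/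
theorem energy_le_varB0 (hT : 0 < T) (hΨ₀ : IsGauge Ψ₀)
    (hΨ : IsViscousPotential Ψ₀ Ψ) (hE : IsAdmissibleEnergy T E)
    (hu : BoundedVariationOn u (Icc 0 T)) {s t : ℝ} (hs : 0 ≤ s) (hst : s ≤ t) (ht : t ≤ T)
    (hfin : varB0 T Ψ₀ Ψ E u s t < ⊤) :
    energyInput T E u s t - E t (u t) ≤ (varB0 T Ψ₀ Ψ E u s t).toReal := by
  have hsT : s ∈ Icc 0 T := ⟨hs, hst.trans ht⟩
  have key : ∀ η : ℝ, 0 < η → energyInput T E u s t - E t (u t) ≤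
      (1 + 2 * η) * (varB0 T Ψ₀ Ψ E u s t).toReal + η * (t - s) := by
    intro η hη
    obtain ⟨δ, hδ, hstep⟩ := exists_energy_step hT hΨ₀ hΨ hE hu hs ht hfin hη
    -- Dividing into `N + 1` steps makes them shorter than `δ` and avoids dividing by zero; the
    -- errors add up to `2 * η` times the variation plus `η * (t - s)`.
    obtain ⟨N, hN⟩ := exists_nat_gt ((t - s) / δ)
    have hN0 : (0 : ℝ) < N + 1 := by positivity
    set h := (t - s) / (N + 1) with hh
    have hh0 : 0 ≤ h := div_nonneg (sub_nonneg.2 hst) hN0.le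
    have hhδ : h < δ := by
      rw [hh, div_lt_iff₀ hN0]
      rw [div_lt_iff₀ hδ] at hN
      nlinarith
    have hhN : s + (N + 1) * h = t := by
      rw [hh]; field_simp; ring
    have hind : ∀ n : ℕ, n ≤ N + 1 → E s (u s) - E (s + n * h) (u (s + n * h)) +
        ∫ r in s..(s + n * h), dtE T E r (u r) ≤
        (1 + 2 * η) * (varB0 T Ψ₀ Ψ E u s (s + n * h)).toReal + η * (n * h) := by
      intro n
      induction n with
      | zero => simp [varB0_self]
      | succ n ih =>
        intro hn
        have hn' : ((n : ℝ) + 1) ≤ N + 1 := by exact_mod_cast hn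
        have h1 : s ≤ s + n * h := le_add_of_nonneg_right (by positivity)
        have h2 : s + n * h ≤ s + (n + 1) * h := by nlinarith
        have h3 : s + (n + 1) * h ≤ t := by rw [← hhN]; gcongr
        have ih' := ih (by omega)
        have hst' := hstep (s + n * h) (s + (n + 1) * h) h1 h2 h3 (by linarith)
        have hadd := intervalIntegral.integral_add_adjacent_intervals
          (intervalIntegrable_dtE hT hE hu hsT (t := s + n * h)
            ⟨hs.trans h1, (h2.trans h3).trans ht⟩)
          (intervalIntegrable_dtE hT hE hu (s := s + n * h) (t := s + (n + 1) * h)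
            ⟨hs.trans h1, (h2.trans h3).trans ht⟩ ⟨hs.trans (h1.trans h2), h3.trans ht⟩)
        have hv1 : varB0 T Ψ₀ Ψ E u s (s + (n + 1) * h) ≠ ⊤ :=
          ((varB0_mono le_rfl (h1.trans h2) h3).trans_lt hfin).ne
        have hle := varB0_add_le (T := T) (Ψ₀ := Ψ₀) (Ψ := Ψ) (E := E) (u := u) h1 h2
        have hv2 := ne_top_of_le_ne_top hv1 (le_self_add.trans hle)
        have hv3 := ne_top_of_le_ne_top hv1 (le_add_self.trans hle)
        have hle' := ENNReal.toReal_mono hv1 hle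
        rw [ENNReal.toReal_add hv2 hv3] at hle'
        push_cast
        have hη2 : (0 : ℝ) ≤ 1 + 2 * η := by positivity
        have := mul_le_mul_of_nonneg_left hle' hη2
        rw [mul_add] at this
        rw [← hadd]
        linarith
    have hfinal := hind (N + 1) le_rfl
    push_cast at hfinal
    rw [hhN] at hfinal
    rw [energyInput]
    have : (N + 1) * h = t - s := by linarith
    rw [this] at hfinal
    linarith
  have hlim : Tendsto (fun η : ℝ => (1 + 2 * η) * (varB0 T Ψ₀ Ψ E u s t).toReal + η * (t - s))
      (𝓝[>] 0) (𝓝 ((1 + 2 * 0) * (varB0 T Ψ₀ Ψ E u s t).toReal + 0 * (t - s))) := by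
    have : Continuous fun η : ℝ => (1 + 2 * η) * (varB0 T Ψ₀ Ψ E u s t).toReal + η * (t - s) := by
      fun_prop
    exact (this.tendsto 0).mono_left nhdsWithin_le_nhds
  have h1 := ge_of_tendsto hlim (by filter_upwards [self_mem_nhdsWithin] with η hη using key η hη)
  simpa using h1

theorem energyInput_sub_add (hT : 0 < T) (hE : IsAdmissibleEnergy T E)
    (hu : BoundedVariationOn u (Icc 0 T)) {r s t : ℝ} (hr : r ∈ Icc 0 T) (hs : s ∈ Icc 0 T)
    (ht : t ∈ Icc 0 T) :
    energyInput T E u r s - E s (u s) + energyInput T E u s t = energyInput T E u r t := by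
  rw [energyInput, energyInput, energyInput, ← intervalIntegral.integral_add_adjacent_intervals
    (intervalIntegrable_dtE hT hE hu hr hs) (intervalIntegrable_dtE hT hE hu hs ht)]
  ring

theorem coe_add_coe_eq_coe_iff {v : ℝ≥0∞} {x y : ℝ} :
    (v : EReal) + (x : EReal) = (y : EReal) ↔ v < ⊤ ∧ v.toReal + x = y := by
  induction v with
  | top => simp
  | coe v =>
    simp only [ENNReal.coe_lt_top, true_and, ENNReal.coe_toReal]
    have h : (((v : ℝ≥0∞) : EReal)) = ((v : ℝ) : EReal) := rfl
    rw [h]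
    norm_cast

theorem coe_add_coe_le_coe_iff {v : ℝ≥0∞} {x y : ℝ} :
    (v : EReal) + (x : EReal) ≤ (y : EReal) ↔ v < ⊤ ∧ v.toReal + x ≤ y := by
  induction v with
  | top => simp
  | coe v =>
    simp only [ENNReal.coe_lt_top, true_and, ENNReal.coe_toReal]
    have h : (((v : ℝ≥0∞) : EReal)) = ((v : ℝ) : EReal) := rfl
    rw [h]
    norm_cast

/-- Subtract the balances on `[0,s]` and `[0,t]`: the variation `pVar` and the energy input are both
additive, and stability turns `pVar` on `[s,t]` into `varB0`. -/
theorem IsBVSolution.energyBalance (hT : 0 < T) (hΨ₀ : IsGauge Ψ₀)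
    (hΨ : IsViscousPotential Ψ₀ Ψ) (hE : IsAdmissibleEnergy T E)
    (h : IsBVSolution T Ψ₀ Ψ E u) : EnergyBalanceB0 T Ψ₀ Ψ E u := by
  intro s t hs hst ht
  have hsT : s ∈ Icc 0 T := ⟨hs, hst.trans ht⟩
  have htT : t ∈ Icc 0 T := ⟨hs.trans hst, ht⟩
  have hst' : LocallyStableOn T Ψ₀ E u (Ioo s t) := by
    filter_upwards [h.stable] with r hr hr'
    exact hr ⟨⟨hs.trans hr'.1.1.le, hr'.1.2.le.trans ht⟩, hr'.2⟩
  obtain ⟨h1, h2⟩ := coe_add_coe_eq_coe_iff.1 (h.balance s hsT)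
  obtain ⟨h3, h4⟩ := coe_add_coe_eq_coe_iff.1 (h.balance t htT)
  have hadd := pVar_add hT hΨ₀ hΨ hE h.bv (u := u) (a := 0) le_rfl hs hst ht
  have h5 : pVar T Ψ₀ Ψ E u s t < ⊤ := pVar_lt_top hT hΨ₀ hΨ hE h.bv hs ht
  rw [← hadd, ENNReal.toReal_add h1.ne h5.ne] at h4
  have h6 := energyInput_sub_add hT hE h.bv (left_mem_Icc.2 hT.le) hsT htT
  rw [← pVar_eq_varB0 hT hΨ₀ hΨ hE h.bv hs ht hst']
  exact coe_add_coe_eq_coe_iff.2 ⟨h5, by linarith⟩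

/-- A squeeze: on `[0,t]` and on `[t,T]` the variation is at least the energy spent, while by
superadditivity and the hypothesis the two variations together are at most the total. Both lower
bounds are therefore equalities. -/
theorem EnergyInequalityB0.isBVSolution (hT : 0 < T) (hΨ₀ : IsGauge Ψ₀)
    (hΨ : IsViscousPotential Ψ₀ Ψ) (hE : IsAdmissibleEnergy T E)
    (h : EnergyInequalityB0 T Ψ₀ Ψ E u) : IsBVSolution T Ψ₀ Ψ E u := by
  obtain ⟨hfin, hle⟩ := coe_add_coe_le_coe_iff.1 h
  have hu := boundedVariationOn_of_varB0_lt_top hΨ₀ hΨ hfin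
  have hst := LocallyStableOn.of_varB0_lt_top hT hΨ₀ hΨ hE hu le_rfl le_rfl hfin
  refine ⟨hu, ?_, fun t ht => ?_⟩
  · have hends : ∀ᵐ t : ℝ, t ∉ ({0, T} : Set ℝ) := (toFinite _).countable.ae_notMem _
    filter_upwards [hst, hends] with t h1 h2 h3
    refine h1 ⟨⟨lt_of_le_of_ne h3.1.1 fun h => h2 ?_, lt_of_le_of_ne h3.1.2 fun h => h2 ?_⟩, h3.2⟩
    · exact Or.inl h.symm
    · exact Or.inr h
  · have hst' : LocallyStableOn T Ψ₀ E u (Ioo 0 t) := by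
      filter_upwards [hst] with r hr hr'
      exact hr ⟨⟨hr'.1.1, hr'.1.2.trans_le ht.2⟩, hr'.2⟩
    rw [pVar_eq_varB0 hT hΨ₀ hΨ hE hu le_rfl ht.2 hst']
    have hadd := varB0_add_le (T := T) (Ψ₀ := Ψ₀) (Ψ := Ψ) (E := E) (u := u) ht.1 ht.2
    have h1 := (le_self_add.trans hadd).trans_lt hfin
    have h2 := (le_add_self.trans hadd).trans_lt hfin
    have h3 := ENNReal.toReal_mono hfin.ne hadd
    rw [ENNReal.toReal_add h1.ne h2.ne] at h3
    have h4 := energy_le_varB0 hT hΨ₀ hΨ hE hu le_rfl ht.1 ht.2 h1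
    have h5 := energy_le_varB0 hT hΨ₀ hΨ hE hu ht.1 ht.2 le_rfl h2
    have h6 := energyInput_sub_add hT hE hu (left_mem_Icc.2 hT.le) ht (right_mem_Icc.2 hT.le)
    exact coe_add_coe_eq_coe_iff.2 ⟨h1, by linarith⟩

end Energy

theorem EnergyBalanceB0.energyInequality {X : Type*} [NormedAddCommGroup X] [NormedSpace ℝ X]
    {T : ℝ} {Ψ₀ Ψ : X → ℝ} {E : ℝ → X → ℝ} {u : ℝ → X} (hT : 0 < T)
    (h : EnergyBalanceB0 T Ψ₀ Ψ E u) : EnergyInequalityB0 T Ψ₀ Ψ E u :=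
  (h 0 T le_rfl hT.le le_rfl).le

end RateIndep

theorem mainTheorem9 {X : Type*} [NormedAddCommGroup X] [NormedSpace ℝ X]
    [FiniteDimensional ℝ X] {T : ℝ} (hT : 0 < T) {Ψ₀ Ψ : X → ℝ} {E : ℝ → X → ℝ}
    (hΨ₀ : RateIndep.IsGauge Ψ₀) (hΨ : RateIndep.IsViscousPotential Ψ₀ Ψ)
    (hE : RateIndep.IsAdmissibleEnergy T E) :
    (∀ u : ℝ → X, BoundedVariationOn u (Icc 0 T) →
      ∀ a b : ℝ, 0 ≤ a → a ≤ b → b ≤ T →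
        RateIndep.pVar T Ψ₀ Ψ E u a b ≤ RateIndep.varB0 T Ψ₀ Ψ E u a b ∧
        (RateIndep.pVar T Ψ₀ Ψ E u a b = RateIndep.varB0 T Ψ₀ Ψ E u a b ↔
          RateIndep.LocallyStableOn T Ψ₀ E u (Ioo a b)) ∧
        (RateIndep.varB0 T Ψ₀ Ψ E u a b < ⊤ →
          RateIndep.LocallyStableOn T Ψ₀ E u (Ioo a b))) ∧
    (∀ u : ℝ → X,
      (RateIndep.IsBVSolution T Ψ₀ Ψ E u ↔ RateIndep.EnergyBalanceB0 T Ψ₀ Ψ E u) ∧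
      (RateIndep.IsBVSolution T Ψ₀ Ψ E u ↔ RateIndep.EnergyInequalityB0 T Ψ₀ Ψ E u)) := by
  refine ⟨fun u hu a b ha _ hb => ⟨RateIndep.pVar_le_varB0 hT hΨ₀ hΨ hE hu ha hb, ⟨fun h => ?_,
    RateIndep.pVar_eq_varB0 hT hΨ₀ hΨ hE hu ha hb⟩,
    RateIndep.LocallyStableOn.of_varB0_lt_top hT hΨ₀ hΨ hE hu ha hb⟩, fun u => ?_⟩
  -- Equality transfers the finiteness of `pVar` to `varB0`, and finiteness of the latter gives
  -- stability.
  · exact RateIndep.LocallyStableOn.of_varB0_lt_top hT hΨ₀ hΨ hE hu ha hb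
      (h ▸ RateIndep.pVar_lt_top hT hΨ₀ hΨ hE hu ha hb)
  · have h₁ : RateIndep.IsBVSolution T Ψ₀ Ψ E u → RateIndep.EnergyBalanceB0 T Ψ₀ Ψ E u :=
      fun h => h.energyBalance hT hΨ₀ hΨ hE
    have h₂ : RateIndep.EnergyInequalityB0 T Ψ₀ Ψ E u → RateIndep.IsBVSolution T Ψ₀ Ψ E u :=
      fun h => h.isBVSolution hT hΨ₀ hΨ hE
    exact ⟨⟨h₁, fun h => h₂ (h.energyInequality hT)⟩, ⟨fun h => (h₁ h).energyInequality hT, h₂⟩⟩
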